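/- **The group-buying allocation problem GAP.** An instance consists of $M\ge 0$ classes and $K\ge 0$ slots; integers $1\le l_i\le u_i$ (the lower and upper bound of class $i$) and a rational profit $p_i$ per item of class $i$, for $i=1,\dots,M$; and a target vector of non-negative integers $N_1>N_2>\cdots>N_K$, with sum $\Sigma N=\sum_{k=1}^K N_k$. An allocation is a vector $x=(x_1,\dots,x_M)$ of non-negative integers. It is *feasible* if for every $i$ either $x_i=0$ or $l_i\le x_i\le u_i$, and if it is majorized by the target vector: for every $r$, the sum of the $r$ largest entries of $x$ is at most the sum of the $r$ largest entries of $(N_1,\dots,N_K)$, where the shorter vector is padded with zeros. Its revenue is $\sum_{i=1}^M p_i x_i$, and $\mathrm{OPT}$ is the largest revenue of a feasible allocation. **Theorem.** GAP admits a fully polynomial time approximation scheme. That is, there is one algorithm which, given an instance of GAP and a rational number $\varepsilon>0$, outputs a feasible allocation with revenue at least $(1-\varepsilon)\,\mathrm{OPT}$ in time $\mathrm{poly}(M,K,\log\Sigma N,1/\varepsilon)$. Time is the number of steps of a random access machine over the integers (arithmetic operations $+,-,\cdot$ and integer division, comparisons, and memory accesses with indirect addressing, one step each), whose input consists of the integers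 $M,K,N_k,l_i,u_i$ and the numerators and denominators of the $p_i$ and of $\varepsilon$. Moreover, if $b$ is the bit length of the longest input integer, every integer that occurs during the computation has at most $(b+1)\cdot\mathrm{poly}(M,K,\log\Sigma N,1/\varepsilon)$ bits, so that the bound on the number of steps is not due to arithmetic on huge numbers. Here $\mathrm{poly}(M,K,\log\Sigma N,1/\varepsilon)$ means at most $C\,(M+K+\log\Sigma N+1/\varepsilon+1)^d$ for constants $C,d$ that depend only on the algorithm, and $\log 0$ is read as $0$. -/

import Mathlib

/-! ### The group-buying allocation problem -/

/-- The sum of the `r` largest entries of `x` (of all entries if `x` has fewer than `r`, that is,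
`x` is padded with zeros). -/
def sumLargest {n : ℕ} (x : Fin n → ℕ) (r : ℕ) : ℕ :=
  (((List.ofFn x).insertionSort (· ≥ ·)).take r).sum

/-- The majorization constraint `x ⪯ y`: for every `r`, the sum of the `r` largest entries of `x`
is at most the sum of the `r` largest entries of `y`. The shorter vector is padded with zeros. -/
def Majorized {m n : ℕ} (x : Fin m → ℕ) (y : Fin n → ℕ) : Prop :=
  ∀ r : ℕ, sumLargest x r ≤ sumLargest y r

/-- An instance of the group-buying allocation problem with `M` classes and `K` slots. -/
structure GAP (M K : ℕ) where
  /-- lower bounds `l_i` -/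
  lower : Fin M → ℕ
  /-- upper bounds `u_i` -/
  upper : Fin M → ℕ
  /-- profit `p_i` of one item of class `i` -/
  profit : Fin M → ℚ
  /-- target vector `N_1 > N_2 > ⋯ > N_K` -/
  target : Fin K → ℕ
  lower_pos : ∀ i, 0 < lower i
  lower_le_upper : ∀ i, lower i ≤ upper i
  target_strictAnti : StrictAnti target

namespace GAP

variable {M K : ℕ}

/-- `x i` is the number of items taken from class `i`. -/
structure Feasible (I : GAP M K) (x : Fin M → ℕ) : Prop where
  bounds : ∀ i, x i = 0 ∨ (I.lower i ≤ x i ∧ x i ≤ I.upper i)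
  majorized : Majorized x I.target

/-- The total profit of an allocation. -/
def revenue (I : GAP M K) (x : Fin M → ℕ) : ℚ := ∑ i, I.profit i * x i

/-- The sum of the entries of the target vector. -/
def targetSum (I : GAP M K) : ℕ := ∑ k, I.target k

theorem feasible_zero (I : GAP M K) : I.Feasible 0 := by
  refine ⟨fun i => Or.inl rfl, fun r => ?_⟩
  have h : sumLargest (0 : Fin M → ℕ) r = 0 := by
    unfold sumLargest
    rw [List.sum_eq_zero_iff]
    intro y hy
    have h1 := List.mem_of_mem_take hy
    rw [List.mem_insertionSort, List.mem_ofFn] at h1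
    obtain ⟨i, rfl⟩ := h1
    rfl
  rw [h]
  exact Nat.zero_le _

theorem finite_feasible (I : GAP M K) : {x | I.Feasible x}.Finite := by
  refine (Set.finite_Iic I.upper).subset fun x hx i => ?_
  rcases hx.bounds i with h | h
  · rw [h]; exact Nat.zero_le _
  · exact h.2

theorem exists_opt (I : GAP M K) : ∃ v, IsGreatest (I.revenue '' {x | I.Feasible x}) v := by
  obtain ⟨x, hx, hmax⟩ :=
    Set.exists_max_image {x | I.Feasible x} I.revenue I.finite_feasible ⟨0, I.feasible_zero⟩
  exact ⟨I.revenue x, ⟨x, hx, rfl⟩, by rintro _ ⟨y, hy, rfl⟩; exact hmax y hy⟩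

/-- `OPT`, the largest revenue of a feasible allocation. -/
noncomputable def opt (I : GAP M K) : ℚ := I.exists_opt.choose

theorem opt_isGreatest (I : GAP M K) : IsGreatest (I.revenue '' {x | I.Feasible x}) I.opt :=
  I.exists_opt.choose_spec

end GAP

/-! ### Random access machines

Programs of a random access machine in structured form. The memory consists of arrays of integer
cells; a program is a finite object, so it addresses finitely many arrays, but the index inside an
array is computed at run time (indirect addressing). Every arithmetic operation, memory access,
comparison and store is one step, and a machine of word length `w` is stuck as soon as a value does
not fit into `w` bits (and a sign). -/

namespace RAM

/-- `σ a j` is the content of cell `j` of array `a`. -/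
abbrev Mem := ℕ → ℤ → ℤ

inductive Expr
  | const (c : ℤ)
  | cell (a : ℕ) (j : Expr)
  | add (e f : Expr)
  | sub (e f : Expr)
  | mul (e f : Expr)
  | div (e f : Expr)

/-- The value of an expression. Division is integer division (rounding down for a positive
divisor), with value `0` for the divisor `0`. -/
def Expr.eval (σ : Mem) : Expr → ℤ
  | const c => c
  | cell a j => σ a (j.eval σ)
  | add e f => e.eval σ + f.eval σ
  | sub e f => e.eval σ - f.eval σ
  | mul e f => e.eval σ * f.eval σ
  | div e f => e.eval σ / f.eval σ

/-- The number of steps that evaluating an expression takes. -/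
def Expr.cost : Expr → ℕ
  | const _ => 1
  | cell _ j => j.cost + 1
  | add e f => e.cost + f.cost + 1
  | sub e f => e.cost + f.cost + 1
  | mul e f => e.cost + f.cost + 1
  | div e f => e.cost + f.cost + 1

/-- The integer `v` fits into a word of `w` bits and a sign: `|v| < 2 ^ w`. -/
def FitsWord (w : ℕ) (v : ℤ) : Prop := v.natAbs < 2 ^ w

/-- All values met while evaluating an expression fit into words of length `w`. -/
def Expr.Fits (w : ℕ) (σ : Mem) : Expr → Prop
  | const c => FitsWord w c
  | cell a j => j.Fits w σ ∧ FitsWord w (σ a (j.eval σ))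
  | add e f => e.Fits w σ ∧ f.Fits w σ ∧ FitsWord w (e.eval σ + f.eval σ)
  | sub e f => e.Fits w σ ∧ f.Fits w σ ∧ FitsWord w (e.eval σ - f.eval σ)
  | mul e f => e.Fits w σ ∧ f.Fits w σ ∧ FitsWord w (e.eval σ * f.eval σ)
  | div e f => e.Fits w σ ∧ f.Fits w σ ∧ FitsWord w (e.eval σ / f.eval σ)

/-- The memory after writing `v` into cell `j` of array `a`. -/
def Mem.write (σ : Mem) (a : ℕ) (j v : ℤ) : Mem :=
  Function.update σ a (Function.update (σ a) j v)

inductive Program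
  | skip
  /-- write the value of `e` into cell `j` of array `a` -/
  | store (a : ℕ) (j e : Expr)
  | seq (P Q : Program)
  /-- if `e < f` then `P` else `Q` -/
  | ifLt (e f : Expr) (P Q : Program)
  /-- while `e < f` do `P` -/
  | whileLt (e f : Expr) (P : Program)

/-- `Exec w P σ t τ`: on a machine of word length `w`, started with memory `σ`, the program `P`
halts after exactly `t` steps with memory `τ`. -/
inductive Exec (w : ℕ) : Program → Mem → ℕ → Mem → Prop
  | skip (σ : Mem) : Exec w .skip σ 1 σ
  | store (a : ℕ) (j e : Expr) (σ : Mem) :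
      j.Fits w σ → e.Fits w σ →
      Exec w (.store a j e) σ (j.cost + e.cost + 1) (σ.write a (j.eval σ) (e.eval σ))
  | seq {P Q : Program} {σ τ ρ : Mem} {s t : ℕ} :
      Exec w P σ s τ → Exec w Q τ t ρ → Exec w (.seq P Q) σ (s + t) ρ
  | ifTrue {e f : Expr} {P : Program} (Q : Program) {σ τ : Mem} {t : ℕ} :
      e.Fits w σ → f.Fits w σ → e.eval σ < f.eval σ → Exec w P σ t τ →
      Exec w (.ifLt e f P Q) σ (e.cost + f.cost + 1 + t) τ
  | ifFalse {e f : Expr} (P : Program) {Q : Program} {σ τ : Mem} {t : ℕ} :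
      e.Fits w σ → f.Fits w σ → ¬ e.eval σ < f.eval σ → Exec w Q σ t τ →
      Exec w (.ifLt e f P Q) σ (e.cost + f.cost + 1 + t) τ
  | whileTrue {e f : Expr} {P : Program} {σ τ ρ : Mem} {s t : ℕ} :
      e.Fits w σ → f.Fits w σ → e.eval σ < f.eval σ → Exec w P σ s τ →
      Exec w (.whileLt e f P) τ t ρ →
      Exec w (.whileLt e f P) σ (e.cost + f.cost + 1 + s + t) ρ
  | whileFalse {e f : Expr} (P : Program) {σ : Mem} :
      e.Fits w σ → f.Fits w σ → ¬ e.eval σ < f.eval σ →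
      Exec w (.whileLt e f P) σ (e.cost + f.cost + 1) σ

/-- The machine is deterministic. -/
theorem Exec.unique {w : ℕ} {P : Program} {σ τ : Mem} {t : ℕ} (h : Exec w P σ t τ) :
    ∀ {t' : ℕ} {τ' : Mem}, Exec w P σ t' τ' → t = t' ∧ τ = τ' := by
  induction h with
  | skip σ => intro _ _ h'; cases h'; exact ⟨rfl, rfl⟩
  | store => intro _ _ h'; cases h'; exact ⟨rfl, rfl⟩
  | seq _ _ ih₁ ih₂ =>
    intro _ _ h'
    cases h' with
    | seq a b => obtain ⟨rfl, rfl⟩ := ih₁ a; obtain ⟨rfl, rfl⟩ := ih₂ b; exact ⟨rfl, rfl⟩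
  | ifTrue _ _ _ hc _ ih =>
    intro _ _ h'
    cases h' with
    | ifTrue _ _ _ _ a => obtain ⟨rfl, rfl⟩ := ih a; exact ⟨rfl, rfl⟩
    | ifFalse _ _ _ hn _ => exact absurd hc hn
  | ifFalse _ _ _ hc _ ih =>
    intro _ _ h'
    cases h' with
    | ifTrue _ _ _ hn _ => exact absurd hn hc
    | ifFalse _ _ _ _ a => obtain ⟨rfl, rfl⟩ := ih a; exact ⟨rfl, rfl⟩
  | whileTrue _ _ hc _ _ ih₁ ih₂ =>
    intro _ _ h'
    cases h' with
    | whileTrue _ _ _ a b =>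
      obtain ⟨rfl, rfl⟩ := ih₁ a; obtain ⟨rfl, rfl⟩ := ih₂ b; exact ⟨rfl, rfl⟩
    | whileFalse _ _ _ hn => exact absurd hc hn
  | whileFalse _ _ _ hc =>
    intro _ _ h'
    cases h' with
    | whileTrue _ _ hn _ _ => exact absurd hn hc
    | whileFalse _ _ _ _ => exact ⟨rfl, rfl⟩

/-- The array with the entries of the vector `v` in cells `0, …, n - 1` and `0` elsewhere. -/
def ofVec {n : ℕ} (v : Fin n → ℤ) (j : ℤ) : ℤ :=
  if h : 0 ≤ j ∧ j < n then v ⟨j.toNat, by omega⟩ else 0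

end RAM

namespace GAP

variable {M K : ℕ}

/-- The initial memory. Array `0` holds `M`, `K` and the numerator and denominator of `ε`, array `1`
the target vector, arrays `2` and `3` the lower and upper bounds, arrays `4` and `5` the numerators
and denominators of the profits; all other cells are `0`. -/
def input (I : GAP M K) (ε : ℚ) : RAM.Mem
  | 0 => RAM.ofVec ![(M : ℤ), (K : ℤ), ε.num, (ε.den : ℤ)]
  | 1 => RAM.ofVec fun k => (I.target k : ℤ)
  | 2 => RAM.ofVec fun i => (I.lower i : ℤ)
  | 3 => RAM.ofVec fun i => (I.upper i : ℤ)
  | 4 => RAM.ofVec fun i => (I.profit i).num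
  | 5 => RAM.ofVec fun i => ((I.profit i).den : ℤ)
  | _ => fun _ => 0

/-- The vector `x` is the output in the memory `σ`: it stands in array `6`. -/
def IsOutput (σ : RAM.Mem) (x : Fin M → ℕ) : Prop :=
  ∀ i : Fin M, σ 6 ((i : ℕ) : ℤ) = (x i : ℤ)

/-- The bit length of the longest integer in the input. -/
def inputBits (I : GAP M K) (ε : ℚ) : ℕ :=
  max (max (max M.size K.size) (max ε.num.natAbs.size ε.den.size))
    (max (Finset.univ.sup fun k => (I.target k).size)
      (Finset.univ.sup fun i =>
        max (max (I.lower i).size (I.upper i).size)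
          (max (I.profit i).num.natAbs.size (I.profit i).den.size)))

end GAP

/-!
The scheme is a dynamic program that is compared with one particular near-optimal allocation.

*Structure.* Number the classes by decreasing profits. Among the optimal allocations take one that
prefers early classes. It has the exchange property `Problem.Exch`: if an earlier class gets less
than a later one, then the earlier one is at its upper bound or the later one at its lower bound,
since otherwise one item could be moved without leaving the majorization constraint
(`Problem.exists_optimal_exch`). Now round all entries down to *levels*, a decreasing sequence which
contains all bounds of the classes and in which neighbours differ by a factor of about `1 - ε / 2`.
Rounding is monotone and fixes the bounds, so it preserves feasibility and the exchange property
(`Problem.Exch.roundDown`), and it costs at most an `ε / 2` fraction of the revenue. A potential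
argument bounds the number of levels (`Problem.numLev_le`).

*Dynamic program.* Treat the levels in decreasing order, and for each level the classes in the order
of their numbers, deciding whether the class gets exactly that level. As the entries are chosen in
decreasing order, the majorization constraint for a new entry reduces to one inequality: the total
is at most the prefix sum of the target vector for the number of chosen classes
(`Problem.Scaling.Valid.pick`). So an allocation built so far may be replaced by another one with
the same number of chosen classes, the same revenue, and a smaller total, except that the
replacement may already have chosen a class that is to be chosen later. This is excluded by a third coordinate,
a threshold such that all classes from there on are at their lower bounds or not chosen. If the
replacement has chosen the class `j` at a level above `g`, and the compared allocation is to choose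
it at the level `g`, then `j` is below the threshold, as it is above its lower bound, so the
compared allocation has a later class at a larger level which is above its lower bound; by the exchange
property `j` is at its upper bound `g` there, and the replacement violates that bound
(`Problem.Scaling.Valid.eq_zero_of_exch`). Hence a table indexed by units of revenue, threshold and
number of chosen classes, with an allocation of smallest total in each state, suffices
(`Problem.Scaling.Dominates.step`). Revenue is counted in units of `ε / (2 * M)` times the largest
revenue from a single class, which is at most the optimum; this costs another `ε / 2` fraction
(`Problem.Profits.rev_le`).

*Machine.* Each table entry is one integer with the remaining capacity in the leading position and
the allocation in the digits below it, so that better entries are larger integers. The program is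
verified in a Hoare logic for total correctness with time bounds, `RAM.Runs`. There, only the values
that are stored have to be bounded, since the expressions in a fixed program have bounded size. The
dynamic program is verified in `Scheme.runs_dpP`, and everything is put together in
`GAP.exists_exec`.
-/

/-! ### A program logic for the random access machine -/

namespace RAM

instance : Add Expr := ⟨.add⟩
instance : Sub Expr := ⟨.sub⟩
instance : Mul Expr := ⟨.mul⟩
instance : Div Expr := ⟨.div⟩
instance (n : ℕ) : OfNat Expr n := ⟨.const n⟩

section eval
variable (σ : Mem) (e f : Expr)
@[simp] theorem Expr.eval_add : (e + f).eval σ = e.eval σ + f.eval σ := rfl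
@[simp] theorem Expr.eval_sub : (e - f).eval σ = e.eval σ - f.eval σ := rfl
@[simp] theorem Expr.eval_mul : (e * f).eval σ = e.eval σ * f.eval σ := rfl
@[simp] theorem Expr.eval_div : (e / f).eval σ = e.eval σ / f.eval σ := rfl
@[simp] theorem Expr.eval_cell (a : ℕ) : (Expr.cell a e).eval σ = σ a (e.eval σ) := rfl
@[simp] theorem Expr.eval_zero : (0 : Expr).eval σ = 0 := rfl
@[simp] theorem Expr.eval_one : (1 : Expr).eval σ = 1 := rfl
@[simp] theorem Expr.eval_two : (2 : Expr).eval σ = 2 := rfl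
@[simp] theorem Expr.eval_three : (3 : Expr).eval σ = 3 := rfl
end eval

@[simp] theorem Mem.write_same (σ : Mem) (a : ℕ) (j v : ℤ) :
    σ.write a j v a = Function.update (σ a) j v := by simp [Mem.write]

@[simp] theorem Mem.write_of_ne (σ : Mem) {a b : ℕ} (h : b ≠ a) (j v : ℤ) :
    σ.write a j v b = σ b := by simp [Mem.write, h]

/-- The scalar variable `a`: cell `0` of array `a`. -/
abbrev var (a : ℕ) : Expr := .cell a 0

/-- `a := e` for a scalar variable `a`. -/
abbrev Program.assign (a : ℕ) (e : Expr) : Program := .store a 0 e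

/-- `for a = 0, …, b - 1 do P`, with the scalar variable `a` as the counter. -/
def Program.forLt (a : ℕ) (b : Expr) (P : Program) : Program :=
  .seq (.assign a 0) (.whileLt (var a) b (.seq P (.assign a (var a + 1))))

/-- The constants that occur in an expression are at most `3` in absolute value. -/
def Expr.smallConsts : Expr → Bool
  | const c => c.natAbs ≤ 3
  | cell _ j => j.smallConsts
  | add e f | sub e f | mul e f | div e f => e.smallConsts && f.smallConsts

/-- Bounds on the size of an expression and on its constants, by which the intermediate results of
an evaluation fit into words of `64 * W` bits if the memory cells fit into words of `W` bits. -/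
def Expr.small (e : Expr) : Bool := e.smallConsts && decide (e.cost ≤ 64)

/-- All expressions of the program are small. -/
def Program.small : Program → Bool
  | skip => true
  | store _ j e => j.small && e.small
  | seq P Q => P.small && Q.small
  | ifLt e f P Q => e.small && f.small && P.small && Q.small
  | whileLt e f P => e.small && f.small && P.small

/-- The arrays into which the program may write. -/
def Program.writes : Program → List ℕ
  | skip => []
  | store a _ _ => [a]
  | seq P Q => P.writes ++ Q.writes
  | ifLt _ _ P Q => P.writes ++ Q.writes
  | whileLt _ _ P => P.writes

/-- A bound on the number of steps of a program without loops. For a loop the value `0` has no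
meaning. -/
def Program.bd : Program → ℕ
  | skip => 1
  | store _ j e => j.cost + e.cost + 1
  | seq P Q => P.bd + Q.bd
  | ifLt e f P Q => e.cost + f.cost + 1 + max P.bd Q.bd
  | whileLt _ _ _ => 0

/-- A program changes only the arrays to which it writes. -/
theorem Exec.frame {w : ℕ} {P : Program} {σ τ : Mem} {t : ℕ} (h : Exec w P σ t τ) :
    ∀ b, b ∉ P.writes → τ b = σ b := by
  induction h with
  | skip => intros; rfl
  | store a j e σ => intro b hb; exact Mem.write_of_ne _ (by simpa [Program.writes] using hb) _ _
  | seq _ _ ih₁ ih₂ =>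
    intro b hb
    simp only [Program.writes, List.mem_append, not_or] at hb
    rw [ih₂ b hb.2, ih₁ b hb.1]
  | ifTrue _ _ _ _ _ ih =>
    intro b hb
    simp only [Program.writes, List.mem_append, not_or] at hb
    exact ih b hb.1
  | ifFalse _ _ _ _ _ ih =>
    intro b hb
    simp only [Program.writes, List.mem_append, not_or] at hb
    exact ih b hb.2
  | whileTrue _ _ _ _ _ ih₁ ih₂ => intro b hb; rw [ih₂ b hb, ih₁ b hb]
  | whileFalse => intros; rfl

/-- All memory cells fit into words of `W` bits. -/
def Bdd (W : ℕ) (σ : Mem) : Prop := ∀ a j, FitsWord W (σ a j)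

theorem FitsWord.mono {v w : ℕ} (h : v ≤ w) {x : ℤ} (hx : FitsWord v x) : FitsWord w x :=
  lt_of_lt_of_le hx (Nat.pow_le_pow_right (by norm_num) h)

theorem fitsWord_of_le {W b : ℕ} {v : ℤ} (hb : b < 2 ^ W) (h0 : 0 ≤ v) (h : v ≤ b) :
    FitsWord W v := by
  unfold FitsWord; omega

theorem Expr.one_le_cost (e : Expr) : 1 ≤ e.cost := by cases e <;> simp [Expr.cost]

/-- Evaluation adds up bit lengths at worst: over cells of `W` bits, the value of an expression has
at most `W` bits for each step of the evaluation. -/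
theorem Expr.fitsWord_eval {W : ℕ} (hW : 2 ≤ W) {σ : Mem} (hσ : Bdd W σ) (e : Expr)
    (he : e.smallConsts) : FitsWord (W * e.cost) (e.eval σ) := by
  have h2 : ∀ {a b c : ℕ}, a < 2 ^ (W * b) → c ≤ a * 2 → c < 2 ^ (W * (b + 1)) := by
    intro a b c h h'
    calc c ≤ a * 2 := h'
      _ < 2 ^ (W * b) * 2 := by omega
      _ = 2 ^ (W * b + 1) := by ring
      _ ≤ _ := Nat.pow_le_pow_right (by norm_num) (by nlinarith)
  have hadd : ∀ {x y : ℤ} {a b : ℕ}, 1 ≤ a → 1 ≤ b → FitsWord (W * a) x → FitsWord (W * b) y →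
      x.natAbs + y.natAbs < 2 ^ (W * (a + b + 1)) := by
    intro x y a b ha hb hx hy
    have hx' := FitsWord.mono (w := W * (a + b)) (by nlinarith) hx
    have hy' := FitsWord.mono (w := W * (a + b)) (by nlinarith) hy
    unfold FitsWord at hx' hy'
    rcases le_total x.natAbs y.natAbs with h | h
    · exact h2 hy' (by omega)
    · exact h2 hx' (by omega)
  induction e with
  | const c =>
    simp only [smallConsts, decide_eq_true_eq] at he
    simp only [cost, mul_one, eval, FitsWord]
    calc c.natAbs < 2 ^ 2 := by omega
      _ ≤ _ := Nat.pow_le_pow_right (by norm_num) hW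
  | cell a j ih =>
    exact FitsWord.mono (by simp only [cost]; nlinarith) (hσ a (j.eval σ))
  | add e f ihe ihf =>
    simp only [smallConsts, Bool.and_eq_true] at he
    have := hadd e.one_le_cost f.one_le_cost (ihe he.1) (ihf he.2)
    simp only [FitsWord, cost, eval]
    omega
  | sub e f ihe ihf =>
    simp only [smallConsts, Bool.and_eq_true] at he
    have := hadd e.one_le_cost f.one_le_cost (ihe he.1) (ihf he.2)
    simp only [FitsWord, cost, eval]
    omega
  | mul e f ihe ihf =>
    simp only [smallConsts, Bool.and_eq_true] at he
    have h1 := ihe he.1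
    have h2 := ihf he.2
    simp only [FitsWord, cost, eval, Int.natAbs_mul] at *
    calc _ < 2 ^ (W * e.cost) * 2 ^ (W * f.cost) := Nat.mul_lt_mul'' h1 h2
      _ = 2 ^ (W * (e.cost + f.cost)) := by rw [← pow_add]; ring_nf
      _ ≤ _ := Nat.pow_le_pow_right (by norm_num) (by nlinarith)
  | div e f ihe ihf =>
    simp only [smallConsts, Bool.and_eq_true] at he
    have h1 := ihe he.1
    refine lt_of_le_of_lt (Int.natAbs_ediv_le_natAbs _ _) (FitsWord.mono ?_ h1)
    simp only [cost]; nlinarith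

theorem Expr.fits_of_bdd {W w : ℕ} (hW : 2 ≤ W) {σ : Mem} (hσ : Bdd W σ) (e : Expr)
    (he : e.smallConsts) (hw : W * e.cost ≤ w) : e.Fits w σ := by
  have hv := fun e' (h : smallConsts e' = true) (h' : W * cost e' ≤ w) =>
    FitsWord.mono h' (fitsWord_eval hW hσ e' h)
  induction e with
  | const c => exact hv _ he hw
  | cell a j ih =>
    simp only [cost] at hw
    exact ⟨ih he (by nlinarith), hv (.cell a j) he hw⟩
  | add e f ihe ihf | sub e f ihe ihf | mul e f ihe ihf | div e f ihe ihf =>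
    have he' := he
    simp only [smallConsts, Bool.and_eq_true] at he'
    have hw' := hw
    simp only [cost] at hw'
    exact ⟨ihe he'.1 (by nlinarith), ihf he'.2 (by nlinarith), hv _ he hw⟩

theorem Expr.fits_of_small {W : ℕ} (hW : 2 ≤ W) {σ : Mem} (hσ : Bdd W σ) {e : Expr}
    (he : e.small) : e.Fits (64 * W) σ := by
  simp only [small, Bool.and_eq_true, decide_eq_true_eq] at he
  exact e.fits_of_bdd hW hσ he.1 (by nlinarith [he.2])

/-- Total correctness with a time bound: if the cells of `σ` fit into `W` bits, then `P`, started in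
`σ`, halts after at most `T` steps in a memory that satisfies `post` and whose cells fit into `W`
bits. Only the values that are stored have to be bounded; the intermediate results are covered by
`Program.small`. -/
def Runs (W : ℕ) (P : Program) (T : ℕ) (σ : Mem) (post : Mem → Prop) : Prop :=
  2 ≤ W → P.small → Bdd W σ →
    ∃ t τ, Exec (64 * W) P σ t τ ∧ t ≤ T ∧ Bdd W τ ∧ post τ

section rules
variable {W : ℕ} {σ : Mem} {P Q : Program} {post : Mem → Prop}

theorem Runs.mono {T T' : ℕ} {post' : Mem → Prop} (h : Runs W P T σ post) (hT : T ≤ T')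
    (hp : ∀ τ, post τ → post' τ) : Runs W P T' σ post' := by
  intro hW hs hσ
  obtain ⟨t, τ, h1, h2, h3, h4⟩ := h hW hs hσ
  exact ⟨t, τ, h1, h2.trans hT, h3, hp τ h4⟩

/-- The frame rule: the arrays to which `P` does not write are unchanged. -/
theorem Runs.frame {T : ℕ} (h : Runs W P T σ post) :
    Runs W P T σ fun τ => (∀ b, b ∉ P.writes → τ b = σ b) ∧ post τ := by
  intro hW hs hσ
  obtain ⟨t, τ, h1, h2, h3, h4⟩ := h hW hs hσ
  exact ⟨t, τ, h1, h2, h3, h1.frame, h4⟩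

theorem Runs.skip (h : post σ) : Runs W .skip (Program.bd .skip) σ post :=
  fun _ _ hσ => ⟨1, σ, .skip σ, le_rfl, hσ, h⟩

theorem Bdd.write (hσ : Bdd W σ) {a : ℕ} {j v : ℤ} (hv : FitsWord W v) :
    Bdd W (σ.write a j v) := by
  intro b k
  by_cases hb : b = a
  · subst hb
    rw [Mem.write_same, Function.update_apply]
    split_ifs
    exacts [hv, hσ _ _]
  · rw [Mem.write_of_ne _ hb]; exact hσ _ _

theorem Runs.store {a : ℕ} {j e : Expr} (hv : Bdd W σ → FitsWord W (e.eval σ))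
    (h : post (σ.write a (j.eval σ) (e.eval σ))) :
    Runs W (.store a j e) (Program.bd (.store a j e)) σ post := by
  intro hW hs hσ
  simp only [Program.small, Bool.and_eq_true] at hs
  exact ⟨_, _, .store a j e σ (Expr.fits_of_small hW hσ hs.1) (Expr.fits_of_small hW hσ hs.2),
    le_rfl, hσ.write (hv hσ), h⟩

/-- The rule for assignments, with the new memory described by what is known about it. -/
theorem Runs.assign {a : ℕ} {e : Expr} (hv : Bdd W σ → FitsWord W (e.eval σ))
    (h : ∀ τ : Mem, (∀ c, c ≠ a → τ c = σ c) → τ a 0 = e.eval σ → post τ) :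
    Runs W (.assign a e) (Program.bd (.assign a e)) σ post :=
  Runs.store hv (h _ (fun _ hc => Mem.write_of_ne _ hc _ _) (by simp))

theorem Runs.seq {T₁ T₂ : ℕ} (h : Runs W P T₁ σ fun τ => Runs W Q T₂ τ post) :
    Runs W (.seq P Q) (T₁ + T₂) σ post := by
  intro hW hs hσ
  simp only [Program.small, Bool.and_eq_true] at hs
  obtain ⟨t, τ, h1, h2, h3, h4⟩ := h hW hs.1 hσ
  obtain ⟨t', τ', h1', h2', h3', h4'⟩ := h4 hW hs.2 h3
  exact ⟨_, _, .seq h1 h1', by omega, h3', h4'⟩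

theorem Runs.ifLt {T₁ T₂ : ℕ} {e f : Expr} (h₁ : e.eval σ < f.eval σ → Runs W P T₁ σ post)
    (h₂ : ¬ e.eval σ < f.eval σ → Runs W Q T₂ σ post) :
    Runs W (.ifLt e f P Q) (e.cost + f.cost + 1 + max T₁ T₂) σ post := by
  intro hW hs hσ
  simp only [Program.small, Bool.and_eq_true] at hs
  have he := Expr.fits_of_small hW hσ hs.1.1.1
  have hf := Expr.fits_of_small hW hσ hs.1.1.2
  by_cases h : e.eval σ < f.eval σ
  · obtain ⟨t, τ, h1, h2, h3, h4⟩ := h₁ h hW hs.1.2 hσ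
    exact ⟨_, _, .ifTrue Q he hf h h1, by omega, h3, h4⟩
  · obtain ⟨t, τ, h1, h2, h3, h4⟩ := h₂ h hW hs.2 hσ
    exact ⟨_, _, .ifFalse P he hf h h1, by omega, h3, h4⟩

/-- The rule for a loop whose body is executed exactly `n` times. -/
theorem Runs.whileLt {T n : ℕ} {e f : Expr} (Inv : ℕ → Mem → Prop)
    (hinv : Inv 0 σ)
    (hguard : ∀ k σ, k < n → Inv k σ → e.eval σ < f.eval σ)
    (hexit : ∀ σ, Inv n σ → ¬ e.eval σ < f.eval σ)
    (hbody : ∀ k σ, k < n → Inv k σ → Runs W P T σ (Inv (k + 1))) :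
    Runs W (.whileLt e f P) (n * (T + e.cost + f.cost + 1) + e.cost + f.cost + 1) σ (Inv n) := by
  intro hW hs hσ
  simp only [Program.small, Bool.and_eq_true] at hs
  have key : ∀ d k σ, k + d = n → Inv k σ → Bdd W σ →
      ∃ t τ, Exec (64 * W) (.whileLt e f P) σ t τ ∧
        t ≤ d * (T + e.cost + f.cost + 1) + e.cost + f.cost + 1 ∧ Bdd W τ ∧ Inv n τ := by
    intro d
    induction d with
    | zero =>
      intro k σ hk hi hσ
      obtain rfl : k = n := by omega
      exact ⟨_, _, .whileFalse P (Expr.fits_of_small hW hσ hs.1.1)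
        (Expr.fits_of_small hW hσ hs.1.2) (hexit σ hi), by omega, hσ, hi⟩
    | succ d ih =>
      intro k σ hk hi hσ
      obtain ⟨t, τ, h1, h2, h3, h4⟩ := hbody k σ (by omega) hi hW hs.2 hσ
      obtain ⟨t', τ', h1', h2', h3', h4'⟩ := ih (k + 1) τ (by omega) h4 h3
      refine ⟨_, _, .whileTrue (Expr.fits_of_small hW hσ hs.1.1)
        (Expr.fits_of_small hW hσ hs.1.2) (hguard k σ (by omega) hi) h1 h1', ?_, h3', h4'⟩
      rw [Nat.succ_mul]
      omega
  exact key n 0 σ (by omega) hinv hσ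

/-- A bound on the number of steps of a loop `for a = 0, …, n - 1`, whose body takes at most `T`
steps, if the bound `b` of the counter costs `c` steps. -/
def forCost (n T c : ℕ) : ℕ := (n + 1) * (T + c + 10) + 3

/-- The rule for counting loops. The arrays that the body does not write to are unchanged
throughout. -/
theorem Runs.forLt {a T n : ℕ} {b : Expr} (Inv : ℕ → Mem → Prop)
    (ha : a ∉ P.writes) (hn : n < 2 ^ W)
    (hb : ∀ τ, (∀ c, c ∉ a :: P.writes → τ c = σ c) → b.eval τ = n)
    (h0 : Inv 0 (σ.write a 0 0))
    (hbody : ∀ (k : ℕ) (τ : Mem), k < n → (∀ c, c ∉ a :: P.writes → τ c = σ c) → τ a 0 = k →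
      Inv k τ →
      Runs W P T τ fun τ' => Inv (k + 1) (τ'.write a 0 ((k : ℤ) + 1))) :
    Runs W (.forLt a b P) (forCost n T b.cost) σ fun τ =>
      (∀ c, c ∉ a :: P.writes → τ c = σ c) ∧ Inv n τ := by
  have hne : ∀ (τ : Mem) j v, ∀ c, c ∉ a :: P.writes → (τ.write a j v) c = τ c := by
    intro τ j v c hc
    exact Mem.write_of_ne _ (fun h => hc (by simp [h])) _ _
  refine Runs.mono (Runs.seq (T₂ := n * ((T + 6) + (var a).cost + b.cost + 1) +
    (var a).cost + b.cost + 1)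
    (Runs.store (fun _ => by simp [FitsWord]) ?_)) ?_ (fun _ h => h)
  · refine Runs.mono (Runs.whileLt (T := T + 6) (n := n) (fun k τ =>
      (∀ c, c ∉ a :: P.writes → τ c = σ c) ∧ τ a 0 = k ∧ Inv k τ) ?_ ?_ ?_ ?_) le_rfl ?_
    · exact ⟨hne _ _ _, by simp, h0⟩
    · rintro k τ hk ⟨h1, h2, -⟩
      rw [hb τ h1]
      simp [h2, hk]
    · rintro τ ⟨h1, h2, -⟩
      rw [hb τ h1]
      simp [h2]
    · rintro k τ hk ⟨h1, h2, h3⟩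
      refine Runs.seq (T₂ := 6) ((hbody k τ hk h1 h2 h3).frame.mono le_rfl ?_)
      rintro τ' ⟨h4, h5⟩
      have ha' : (var a + 1).eval τ' = (k : ℤ) + 1 := by simp [h4 a ha, h2]
      refine Runs.store (fun _ => ?_) ?_
      · rw [ha']
        exact fitsWord_of_le hn (by omega) (by omega)
      · rw [ha']
        refine ⟨fun c hc => ?_, by simp, h5⟩
        rw [hne _ _ _ c hc, h4 c (fun h => hc (by simp [h])), h1 c hc]
    · rintro τ ⟨h1, -, h3⟩
      exact ⟨h1, h3⟩
  · simp only [Program.bd, Expr.cost, forCost]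
    nlinarith

end rules

end RAM

/-! ### Majorization in terms of subsets -/

/-- The first `r` entries of a nonincreasing list have the largest sum among any `r` entries. -/
theorem Multiset.sum_le_sum_take {l : List ℕ} (hl : l.Pairwise (· ≥ ·)) :
    ∀ (r : ℕ) (s : Multiset ℕ), s ≤ (l : Multiset ℕ) → Multiset.card s ≤ r →
      s.sum ≤ (l.take r).sum := by
  induction l with
  | nil => intro r s hs _; simp [Multiset.le_zero.mp hs]
  | cons a l ih =>
    intro r s hs hr
    rw [List.pairwise_cons] at hl
    rcases Multiset.empty_or_exists_mem s with rfl | ⟨b, hb⟩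
    · simp
    obtain ⟨c, hc, hca, hle⟩ : ∃ c ∈ s, c ≤ a ∧ s.erase c ≤ (l : Multiset ℕ) := by
      rw [← Multiset.cons_coe] at hs
      by_cases ha : a ∈ s
      · exact ⟨a, ha, le_rfl, Multiset.erase_le_iff_le_cons.mpr hs⟩
      · have h : s ≤ (l : Multiset ℕ) := (Multiset.le_cons_of_notMem ha).mp hs
        exact ⟨b, hb, hl.1 b (Multiset.mem_of_le h hb), (Multiset.erase_le b s).trans h⟩
    have hpos : 0 < Multiset.card s := Multiset.card_pos_iff_exists_mem.mpr ⟨b, hb⟩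
    obtain ⟨r, rfl⟩ : ∃ r', r = r' + 1 := ⟨r - 1, by omega⟩
    have h1 := ih hl.2 r (s.erase c) hle (by
      rw [Multiset.card_erase_of_mem hc]; exact Nat.sub_le_of_le_add hr)
    rw [← Multiset.cons_erase hc, Multiset.sum_cons, List.take_succ_cons, List.sum_cons]
    exact Nat.add_le_add hca h1

theorem sum_le_sumLargest {n : ℕ} (x : Fin n → ℕ) (S : Finset (Fin n)) :
    ∑ i ∈ S, x i ≤ sumLargest x S.card := by
  refine Multiset.sum_le_sum_take (List.pairwise_insertionSort _ _) _ (S.val.map x) ?_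
    (by simp)
  rw [Multiset.coe_eq_coe.mpr (List.perm_insertionSort _ (List.ofFn x)), List.ofFn_eq_map,
    ← Multiset.map_coe]
  refine Multiset.map_le_map ?_
  exact (Multiset.le_iff_subset S.nodup).mpr fun i _ => by simp

theorem exists_sum_eq_sumLargest {n : ℕ} (x : Fin n → ℕ) (r : ℕ) :
    ∃ S : Finset (Fin n), S.card ≤ r ∧ ∑ i ∈ S, x i = sumLargest x r := by
  classical
  set I := (List.finRange n).insertionSort fun i j => x i ≥ x j with hI
  have hmap : (List.ofFn x).insertionSort (· ≥ ·) = I.map x := by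
    rw [List.ofFn_eq_map, hI]
    exact (List.map_insertionSort _ _ x _ fun _ _ _ _ => Iff.rfl).symm
  have hnd : (I.take r).Nodup :=
    (((List.perm_insertionSort _ _).nodup_iff).mpr (List.nodup_finRange n)).sublist
      (List.take_sublist _ _)
  refine ⟨(I.take r).toFinset, (List.toFinset_card_le _).trans (by simp), ?_⟩
  rw [List.sum_toFinset x hnd, sumLargest, hmap, List.map_take]

/-- The sum of the first `r` entries of `y`, padded with zeros. -/
def prefixSum {n : ℕ} (y : Fin n → ℕ) (r : ℕ) : ℕ :=
  ∑ i ∈ Finset.range r, if h : i < n then y ⟨i, h⟩ else 0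

theorem sumLargest_of_antitone {n : ℕ} {y : Fin n → ℕ} (hy : Antitone y) (r : ℕ) :
    sumLargest y r = prefixSum y r := by
  have hs : (List.ofFn y).Pairwise (· ≥ ·) := by
    rw [List.pairwise_ofFn]
    exact fun i j hij => hy hij.le
  rw [sumLargest, hs.insertionSort_eq, prefixSum]
  induction r with
  | zero => simp
  | succ r ih =>
    rw [Finset.sum_range_succ, ← ih, List.take_add_one, List.sum_append]
    congr 1
    by_cases h : r < n <;> simp [h]

theorem prefixSum_mono {n : ℕ} (y : Fin n → ℕ) : Monotone (prefixSum y) := fun _ _ h =>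
  Finset.sum_le_sum_of_subset (Finset.range_mono h)

/-- For a nonincreasing target vector, majorization is a bound on the sum over each set of
classes that depends on the number of the classes only. -/
theorem majorized_iff {m n : ℕ} {x : Fin m → ℕ} {y : Fin n → ℕ} (hy : Antitone y) :
    Majorized x y ↔ ∀ S : Finset (Fin m), ∑ i ∈ S, x i ≤ prefixSum y S.card := by
  constructor
  · intro h S
    rw [← sumLargest_of_antitone hy]
    exact (sum_le_sumLargest x S).trans (h _)
  · intro h r
    obtain ⟨S, hS, hsum⟩ := exists_sum_eq_sumLargest x r
    rw [← hsum, sumLargest_of_antitone hy]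
    exact (h S).trans (prefixSum_mono y hS)

/-! ### Allocations for sorted classes -/

/-- A group-buying problem in the form in which the algorithm treats it: the classes are numbered
`0, …, m - 1`, the majorization constraint is given by the prefix sums `F` of the target vector, and
`top` is its largest entry, by which the upper bounds have been cut off. -/
structure Problem where
  m : ℕ
  L : ℕ → ℕ
  U : ℕ → ℕ
  F : ℕ → ℕ
  top : ℕ
  L_pos : ∀ i < m, 0 < L i
  U_le : ∀ i < m, U i ≤ top
  F_mono : Monotone F

namespace Problem

variable (D : Problem)

/-- The feasible allocations, as functions on `ℕ` that vanish outside of `0, …, m - 1`. -/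
structure IsAlloc (x : ℕ → ℕ) : Prop where
  bounds : ∀ i < D.m, x i = 0 ∨ D.L i ≤ x i ∧ x i ≤ D.U i
  zero : ∀ i, D.m ≤ i → x i = 0
  sum_le : ∀ S ⊆ Finset.range D.m, ∑ i ∈ S, x i ≤ D.F S.card

/-- The revenue of `x` for the profits `p`. -/
def rev (p : ℕ → ℚ) (x : ℕ → ℕ) : ℚ := ∑ i ∈ Finset.range D.m, p i * x i

/-- The structure of optimal allocations: if an earlier class gets less than a later one, then the
earlier one is at its upper bound or the later one at its lower bound. -/
def Exch (x : ℕ → ℕ) : Prop :=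
  ∀ i j, i < j → j < D.m → x i ≠ 0 → x j ≠ 0 → x i < x j → x i = D.U i ∨ x j = D.L j

variable {D}

theorem IsAlloc.lt_m {x : ℕ → ℕ} (h : D.IsAlloc x) {i : ℕ} (hi : x i ≠ 0) : i < D.m := by
  by_contra hc
  exact hi (h.zero i (not_lt.mp hc))

theorem IsAlloc.mem {x : ℕ → ℕ} (h : D.IsAlloc x) {i : ℕ} (hi : x i ≠ 0) :
    D.L i ≤ x i ∧ x i ≤ D.U i := (h.bounds i (h.lt_m hi)).resolve_left hi

theorem IsAlloc.le_top {x : ℕ → ℕ} (h : D.IsAlloc x) (i : ℕ) : x i ≤ D.top := by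
  by_cases hi : x i = 0
  · omega
  · exact (h.mem hi).2.trans (D.U_le i (h.lt_m hi))

theorem isAlloc_zero : D.IsAlloc 0 := ⟨fun _ _ => Or.inl rfl, fun _ _ => rfl, by simp⟩

theorem finite_isAlloc : {x | D.IsAlloc x}.Finite := by
  refine ((Set.finite_Iic fun _ : Fin D.m => D.top).image
    fun v (i : ℕ) => if h : i < D.m then v ⟨i, h⟩ else 0).subset ?_
  intro x hx
  refine ⟨fun i => x i, fun i => hx.le_top i, ?_⟩
  funext i
  by_cases h : i < D.m
  · simp [h]
  · simp [h, hx.zero i (not_lt.mp h)]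

/-- Moving one item from a class to a class with fewer items does not leave the majorization
constraint. -/
theorem IsAlloc.transfer {z x : ℕ → ℕ} (hz : D.IsAlloc z) {i j : ℕ} (hi : z i ≠ 0)
    (hj : z j ≠ 0) (hlt : z i < z j) (hiU : z i ≠ D.U i) (hjL : z j ≠ D.L j)
    (hx : ∀ k, x k + (if k = j then 1 else 0) = z k + if k = i then 1 else 0) :
    D.IsAlloc x := by
  have hij : i ≠ j := by rintro rfl; omega
  have him := hz.lt_m hi
  have hjm := hz.lt_m hj
  refine ⟨fun k hk => ?_, fun k hk => ?_, fun S hS => ?_⟩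
  · have h := hx k
    have hi' := hz.mem hi
    have hj' := hz.mem hj
    by_cases hkj : k = j
    · subst hkj
      rw [if_pos rfl, if_neg hij.symm] at h
      right; omega
    · rw [if_neg hkj] at h
      by_cases hki : k = i
      · subst hki
        rw [if_pos rfl] at h
        right; omega
      · rw [if_neg hki] at h
        have := hz.bounds k hk
        simp only [add_zero] at h
        rwa [h]
  · have h := hx k
    rw [if_neg (by omega), if_neg (by omega), hz.zero k hk] at h
    exact h
  · have hsum : ∑ k ∈ S, x k + (if j ∈ S then 1 else 0) =
        ∑ k ∈ S, z k + if i ∈ S then 1 else 0 := by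
      have := Finset.sum_congr (rfl : S = S) fun k _ => hx k
      simpa [Finset.sum_add_distrib] using this
    have hS' := hz.sum_le S hS
    by_cases hcase : i ∈ S ∧ j ∉ S
    · obtain ⟨hiS, hjS⟩ := hcase
      rw [if_pos hiS, if_neg hjS] at hsum
      have hjE : j ∉ S.erase i := fun h => hjS (Finset.mem_of_mem_erase h)
      have h1 := hz.sum_le (insert j (S.erase i)) (by
        intro k hk
        rcases Finset.mem_insert.mp hk with rfl | hk
        · exact Finset.mem_range.mpr hjm
        · exact hS (Finset.mem_of_mem_erase hk))
      rw [Finset.sum_insert hjE, Finset.card_insert_of_notMem hjE,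
        Finset.card_erase_add_one hiS] at h1
      have h2 := Finset.add_sum_erase S z hiS
      omega
    · have : (if i ∈ S then 1 else 0) ≤ if j ∈ S then 1 else 0 := by
        by_cases h1 : i ∈ S <;> by_cases h2 : j ∈ S <;> simp_all
      omega

/-- If the profits are nonincreasing, some optimal allocation has the exchange property: take one
that prefers earlier classes among those of largest revenue. -/
theorem exists_optimal_exch {p : ℕ → ℚ} (hp : ∀ i j, i < j → j < D.m → p j ≤ p i) :
    ∃ z, D.IsAlloc z ∧ (∀ x, D.IsAlloc x → D.rev p x ≤ D.rev p z) ∧ D.Exch z := by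
  obtain ⟨z, hz, hmax⟩ := Set.exists_max_image {x | D.IsAlloc x}
    -- The second component increases when an item is moved to an earlier class.
    (fun x => toLex (D.rev p x, ∑ i ∈ Finset.range D.m, (D.m - i) * x i))
    finite_isAlloc ⟨0, isAlloc_zero⟩
  refine ⟨z, hz, fun x hx => ?_, fun i j hij hjm hi hj hlt => ?_⟩
  · have := hmax x hx
    rw [Prod.Lex.toLex_le_toLex] at this
    rcases this with h | h
    exacts [h.le, h.1.le]
  · by_contra hcon
    rw [not_or] at hcon
    set x : ℕ → ℕ := fun k => z k + (if k = i then 1 else 0) - if k = j then 1 else 0 with hxdef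
    have hx : ∀ k, x k + (if k = j then 1 else 0) = z k + if k = i then 1 else 0 := by
      intro k
      simp only [hxdef]
      by_cases hkj : k = j
      · subst hkj; simp; omega
      · simp [hkj]
    have hsum : ∀ f : ℕ → ℚ, ∑ k ∈ Finset.range D.m, f k * x k + f j =
        ∑ k ∈ Finset.range D.m, f k * z k + f i := by
      intro f
      have h1 : ∀ k, f k * x k + (if k = j then f k else 0) =
          f k * z k + if k = i then f k else 0 := by
        intro k
        have := congrArg (Nat.cast (R := ℚ)) (hx k)
        push_cast at this
        have h2 := congrArg (f k * ·) this
        simpa [mul_add] using h2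
      have := Finset.sum_congr (rfl : Finset.range D.m = _) fun k _ => h1 k
      simpa [Finset.sum_add_distrib, hjm, hij.trans hjm] using this
    have h := hmax x (hz.transfer hi hj hlt hcon.1 hcon.2 hx)
    rw [Prod.Lex.toLex_le_toLex] at h
    have h1 := hsum p
    have h2 := hsum fun k => ((D.m - k : ℕ) : ℚ)
    have h3 := hp i j hij hjm
    rcases h with h | ⟨-, h⟩
    · simp only [rev] at h
      linarith
    · have h' : ((∑ k ∈ Finset.range D.m, (D.m - k) * x k : ℕ) : ℚ) ≤
          (∑ k ∈ Finset.range D.m, (D.m - k) * z k : ℕ) := by exact_mod_cast h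
      simp only [Nat.cast_sum, Nat.cast_mul] at h'
      have h4 : ((D.m - j : ℕ) : ℚ) < (D.m - i : ℕ) := by
        have : D.m - j < D.m - i := by omega
        exact_mod_cast this
      linarith

end Problem

/-! ### Levels -/

namespace Problem

/-- `v` if it lies strictly between `a` and `g`, and `a` otherwise. -/
def bump (g a v : ℕ) : ℕ := if a < v ∧ v < g then v else a

/-- The level after `g` in a geometric sequence with ratio about `1 - a / (2 * b)`. For positive `g`
it is less than `g`, so that the sequence does not get stuck at small values. -/
def geom (a b g : ℕ) : ℕ := (g - 1) - a * (g - 1) / (2 * b)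

variable (D : Problem) (a b : ℕ)

/-- The largest number below `g` among `geom a b g` and the bounds of the first `k` classes. -/
def nextUpTo (g : ℕ) : ℕ → ℕ
  | 0 => geom a b g
  | k + 1 => bump g (bump g (nextUpTo g k) (D.L k)) (D.U k)

/-- The levels, in decreasing order: the values to which the algorithm restricts the entries of an
allocation. They contain all bounds of the classes, and consecutive levels are close together. -/
def lev : ℕ → ℕ
  | 0 => D.top
  | k + 1 => D.nextUpTo a b (lev k) D.m

variable {D a b}

theorem bump_lt {g c v : ℕ} (h : c < g) : bump g c v < g := by
  unfold bump; split_ifs with h' <;> omega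

theorem le_bump {g c v : ℕ} : c ≤ bump g c v := by
  unfold bump; split_ifs with h' <;> omega

theorem le_bump_right {g c v : ℕ} (h : v < g) : v ≤ bump g c v := by
  unfold bump; split_ifs with h' <;> omega

theorem bump_eq {g c v : ℕ} : bump g c v = c ∨ (bump g c v = v ∧ v < g) := by
  unfold bump; split_ifs with h'
  exacts [Or.inr ⟨rfl, h'.2⟩, Or.inl rfl]

theorem nextUpTo_lt {g : ℕ} (hg : 0 < g) (k : ℕ) : D.nextUpTo a b g k < g := by
  induction k with
  | zero => exact (Nat.sub_le _ _).trans_lt (by omega)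
  | succ k ih => exact bump_lt (bump_lt ih)

theorem geom_le_nextUpTo (g k : ℕ) : geom a b g ≤ D.nextUpTo a b g k := by
  induction k with
  | zero => exact le_rfl
  | succ k ih => exact ih.trans (le_bump.trans le_bump)

theorem le_nextUpTo {g i k : ℕ} (hi : i < k) :
    (D.L i < g → D.L i ≤ D.nextUpTo a b g k) ∧ (D.U i < g → D.U i ≤ D.nextUpTo a b g k) := by
  induction k with
  | zero => omega
  | succ k ih =>
    rcases Nat.lt_succ_iff_lt_or_eq.mp hi with h | rfl
    · exact ⟨fun h' => ((ih h).1 h').trans (le_bump.trans le_bump),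
        fun h' => ((ih h).2 h').trans (le_bump.trans le_bump)⟩
    · exact ⟨fun h' => (le_bump_right h').trans le_bump, fun h' => le_bump_right h'⟩

/-- The bounds of the classes. -/
def events (D : Problem) : Finset ℕ :=
  (Finset.range D.m).image D.L ∪ (Finset.range D.m).image D.U

theorem card_events_le : D.events.card ≤ 2 * D.m := by
  refine (Finset.card_union_le _ _).trans ?_
  have h1 := Finset.card_image_le (s := Finset.range D.m) (f := D.L)
  have h2 := Finset.card_image_le (s := Finset.range D.m) (f := D.U)
  simp only [Finset.card_range] at h1 h2
  omega

theorem nextUpTo_eq {g k : ℕ} (hk : k ≤ D.m) :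
    D.nextUpTo a b g k = geom a b g ∨ D.nextUpTo a b g k ∈ D.events := by
  induction k with
  | zero => exact Or.inl rfl
  | succ k ih =>
    have hL : D.L k ∈ D.events := Finset.mem_union_left _
      (Finset.mem_image_of_mem _ (Finset.mem_range.mpr hk))
    have hU : D.U k ∈ D.events := Finset.mem_union_right _
      (Finset.mem_image_of_mem _ (Finset.mem_range.mpr hk))
    have := ih (by omega)
    simp only [nextUpTo]
    rcases bump_eq (g := g) (c := bump g (D.nextUpTo a b g k) (D.L k)) (v := D.U k) with h | h
    · rw [h]
      rcases bump_eq (g := g) (c := D.nextUpTo a b g k) (v := D.L k) with h | h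
      · rwa [h]
      · rw [h.1]; exact Or.inr hL
    · rw [h.1]; exact Or.inr hU

theorem lev_succ_lt {k : ℕ} (h : 0 < D.lev a b k) : D.lev a b (k + 1) < D.lev a b k :=
  nextUpTo_lt h _

theorem lev_succ_le (k : ℕ) : D.lev a b (k + 1) ≤ D.lev a b k := by
  rcases Nat.eq_zero_or_pos (D.lev a b k) with h | h
  · rcases nextUpTo_eq (D := D) (a := a) (b := b) (g := D.lev a b k) le_rfl with h' | h'
    · simp only [lev, h']; simp [geom, h]
    · have : ∀ j, D.nextUpTo a b 0 j = 0 := by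
        intro j
        induction j with
        | zero => simp [nextUpTo, geom]
        | succ j ih => simp [nextUpTo, ih, bump]
      simp only [lev, h, this, le_refl]
  · exact (lev_succ_lt h).le

theorem lev_antitone : Antitone (D.lev a b) := antitone_nat_of_succ_le lev_succ_le

theorem exists_lev_le (v : ℕ) : ∃ k, D.lev a b k ≤ v := by
  have h : ∀ k, D.lev a b k ≤ D.top - k := by
    intro k
    induction k with
    | zero => exact le_rfl
    | succ k ih =>
      rcases Nat.eq_zero_or_pos (D.lev a b k) with h | h
      · have := lev_succ_le (D := D) (a := a) (b := b) k; omega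
      · have := lev_succ_lt h; omega
  exact ⟨D.top, (h _).trans (by omega)⟩

variable (D a b) in
/-- The number of positive levels. -/
def numLev : ℕ := Nat.find (exists_lev_le (D := D) (a := a) (b := b) 0)

theorem lev_numLev : D.lev a b (D.numLev a b) = 0 :=
  Nat.le_zero.mp (Nat.find_spec (exists_lev_le (D := D) (a := a) (b := b) 0))

theorem lev_pos {k : ℕ} (h : k < D.numLev a b) : 0 < D.lev a b k :=
  not_le.mp (Nat.find_min (exists_lev_le 0) h)

/-! #### The number of levels -/

/-- A potential that decreases by at least one from each level to the next positive one. For a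
geometric step from a large level the logarithm pays, for one from a level below `2 / e + 1` the
second summand, and for a step to one of the bounds in `E` the number of bounds that lie below the
level. -/
noncomputable def potential (E : Finset ℕ) (e : ℝ) (g : ℕ) : ℝ :=
  4 / e * Real.log g + min (g : ℝ) (2 / e + 1) + (E.filter (· < g)).card

theorem potential_nonneg {E : Finset ℕ} {e : ℝ} (he : 0 < e) (g : ℕ) :
    0 ≤ potential E e g := by
  have h1 : 0 ≤ Real.log g := Real.log_natCast_nonneg g
  unfold potential
  positivity

theorem potential_geom {E : Finset ℕ} (ha : 0 < a) (hb : 0 < b) {g : ℕ} (h : 0 < geom a b g) :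
    potential E (a / b) (geom a b g) + 1 ≤ potential E (a / b) g := by
  have haR : (0 : ℝ) < a := by exact_mod_cast ha
  have hbR : (0 : ℝ) < b := by exact_mod_cast hb
  set e : ℝ := a / b with he
  have hepos : 0 < e := by positivity
  obtain ⟨h', rfl⟩ : ∃ h', g = h' + 1 := ⟨g - 1, by
    have := h.trans_le (Nat.sub_le (g - 1) _)
    omega⟩
  set f := a * h' / (2 * b) with hf
  have hgeom : geom a b (h' + 1) = h' - f := by simp [geom, hf]
  rw [hgeom] at h ⊢
  have hcast : ((h' - f : ℕ) : ℝ) = h' - f := by rw [Nat.cast_sub (by omega)]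
  have hcard : ((E.filter (· < h' - f)).card : ℝ) ≤ (E.filter (· < h' + 1)).card := by
    refine Nat.cast_le.mpr (Finset.card_le_card fun x hx => ?_)
    rw [Finset.mem_filter] at hx ⊢
    exact ⟨hx.1, hx.2.trans_le ((Nat.sub_le _ _).trans (Nat.le_succ _))⟩
  have hpos : (0 : ℝ) < (h' : ℝ) - f := by rw [← hcast]; exact_mod_cast h
  have hf0 : (0 : ℝ) ≤ f := Nat.cast_nonneg f
  unfold potential
  rw [hcast]
  push_cast
  have hy : a * (h' : ℝ) = e * h' / 2 * (2 * b) := by rw [he]; field_simp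
  have hfy : e * h' / 2 < f + 1 := by
    have h1 : a * h' < (f + 1) * (2 * b) := by
      rw [hf, mul_comm (_ + 1)]; exact Nat.lt_mul_div_succ _ (by omega)
    have h2 : (a : ℝ) * h' < (f + 1) * (2 * b) := by exact_mod_cast h1
    rw [hy] at h2
    exact lt_of_mul_lt_mul_right h2 (by positivity)
  by_cases hsmall : f = 0
  · -- Each of the last steps decreases the level by one, and there are at most `2 / e + 1` of them.
    have hle : (h' : ℝ) + 1 ≤ 2 / e + 1 := by
      rw [hsmall, Nat.cast_zero, zero_add] at hfy
      have : (h' : ℝ) ≤ 2 / e := by rw [le_div_iff₀ hepos]; nlinarith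
      linarith
    have hlog : Real.log (h' - f) ≤ Real.log (h' + 1) := Real.log_le_log hpos (by linarith)
    have hlog' := mul_le_mul_of_nonneg_left hlog (show 0 ≤ 4 / e by positivity)
    rw [min_eq_left hle]
    have hmin := min_le_left ((h' : ℝ) - f) (2 / e + 1)
    linarith
  · -- The other steps decrease the level by a factor of at least `1 - e / 4`.
    have hf1 : (1 : ℝ) ≤ f := by exact_mod_cast Nat.one_le_iff_ne_zero.mpr hsmall
    have hstep : (h' : ℝ) - f ≤ (h' + 1) * (1 - e / 4) := by nlinarith
    have h14 : 0 < 1 - e / 4 := by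
      by_contra hc
      have : ((h' : ℝ) + 1) * (1 - e / 4) ≤ 0 :=
        mul_nonpos_of_nonneg_of_nonpos (by positivity) (not_lt.mp hc)
      linarith
    have hlog : Real.log (h' - f) ≤ Real.log (h' + 1) - e / 4 := by
      calc Real.log (h' - f) ≤ Real.log ((h' + 1) * (1 - e / 4)) := Real.log_le_log hpos hstep
        _ = Real.log (h' + 1) + Real.log (1 - e / 4) :=
          Real.log_mul (by positivity) h14.ne'
        _ ≤ _ := by linarith [Real.log_le_sub_one_of_pos h14]
    have hlog' := mul_le_mul_of_nonneg_left hlog (show 0 ≤ 4 / e by positivity)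
    have h1 : 4 / e * (Real.log (h' + 1) - e / 4) = 4 / e * Real.log (h' + 1) - 1 := by
      field_simp
    have hmin : min ((h' : ℝ) - f) (2 / e + 1) ≤ min ((h' : ℝ) + 1) (2 / e + 1) :=
      min_le_min_right _ (by linarith)
    linarith

theorem potential_event {E : Finset ℕ} {e : ℝ} (he : 0 < e) {g g' : ℕ} (h0 : 0 < g')
    (h : g' < g) (hE : g' ∈ E) : potential E e g' + 1 ≤ potential E e g := by
  have hcard : (E.filter (· < g')).card + 1 ≤ (E.filter (· < g)).card := by
    refine Finset.card_lt_card ((Finset.ssubset_iff_of_subset fun x hx => ?_).mpr ⟨g', ?_, ?_⟩)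
    · rw [Finset.mem_filter] at hx ⊢
      exact ⟨hx.1, by omega⟩
    · exact Finset.mem_filter.mpr ⟨hE, h⟩
    · simp
  have hcard' : ((E.filter (· < g')).card : ℝ) + 1 ≤ (E.filter (· < g)).card := by
    exact_mod_cast hcard
  have hgg : (g' : ℝ) ≤ g := by exact_mod_cast h.le
  have hlog : Real.log g' ≤ Real.log g := Real.log_le_log (by exact_mod_cast h0) hgg
  have hlog' := mul_le_mul_of_nonneg_left hlog (show 0 ≤ 4 / e by positivity)
  have hmin : min (g' : ℝ) (2 / e + 1) ≤ min (g : ℝ) (2 / e + 1) := min_le_min_right _ hgg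
  unfold potential
  linarith

theorem numLev_le (ha : 0 < a) (hb : 0 < b) :
    (D.numLev a b : ℝ) ≤
      4 / (a / b : ℝ) * Real.log D.top + 2 / (a / b : ℝ) + 2 + 2 * D.m := by
  have hepos : (0 : ℝ) < a / b := by positivity
  have key : ∀ k, k < D.numLev a b →
      k + potential D.events (a / b) (D.lev a b k) ≤ potential D.events (a / b) D.top := by
    intro k
    induction k with
    | zero => intro _; simp [lev]
    | succ k ih =>
      intro hk
      have h1 := ih (by omega)
      have hpos : 0 < D.lev a b (k + 1) := lev_pos hk
      have h2 : potential D.events (a / b) (D.lev a b (k + 1)) + 1 ≤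
          potential D.events (a / b) (D.lev a b k) := by
        rcases nextUpTo_eq (D := D) (a := a) (b := b) (g := D.lev a b k) le_rfl with h' | h'
        · have h3 : D.lev a b (k + 1) = geom a b (D.lev a b k) := h'
          rw [h3] at hpos ⊢
          exact potential_geom ha hb hpos
        · exact potential_event hepos hpos (lev_succ_lt (lev_pos (by omega))) h'
      push_cast
      linarith
  have hcard : ((D.events.filter (· < D.top)).card : ℝ) ≤ 2 * D.m := by
    exact_mod_cast (Finset.card_filter_le _ _).trans card_events_le
  have hmin := min_le_right (D.top : ℝ) (2 / (a / b : ℝ) + 1)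
  have htop : potential D.events (a / b) D.top ≤
      4 / (a / b : ℝ) * Real.log D.top + 2 / (a / b : ℝ) + 1 + 2 * D.m := by
    unfold potential; linarith
  rcases Nat.eq_zero_or_pos (D.numLev a b) with h | h
  · have := potential_nonneg (E := D.events) hepos D.top
    rw [h, Nat.cast_zero]
    linarith
  · have h1 := key (D.numLev a b - 1) (by omega)
    have h2 := potential_nonneg (E := D.events) hepos (D.lev a b (D.numLev a b - 1))
    rw [Nat.cast_sub h] at h1
    push_cast at h1
    linarith

/-! #### Rounding down to levels -/

variable (D a b) in
/-- The largest level that is at most `v`. -/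
def roundDown (v : ℕ) : ℕ := D.lev a b (Nat.find (exists_lev_le (D := D) (a := a) (b := b) v))

theorem roundDown_le (v : ℕ) : D.roundDown a b v ≤ v :=
  Nat.find_spec (exists_lev_le (D := D) (a := a) (b := b) v)

theorem roundDown_mono : Monotone (D.roundDown a b) := fun _ _ h =>
  lev_antitone (Nat.find_mono fun _ hk => hk.trans h)

theorem exists_lev_eq_roundDown (v : ℕ) : ∃ k, D.lev a b k = D.roundDown a b v := ⟨_, rfl⟩

theorem roundDown_cases (v : ℕ) : (D.roundDown a b v = D.top ∧ D.top ≤ v) ∨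
    ∃ g, v < g ∧ D.roundDown a b v = D.nextUpTo a b g D.m := by
  unfold roundDown
  rcases h : Nat.find (exists_lev_le (D := D) (a := a) (b := b) v) with _ | k
  · left
    refine ⟨rfl, ?_⟩
    have := Nat.find_spec (exists_lev_le (D := D) (a := a) (b := b) v)
    rwa [h] at this
  · right
    exact ⟨D.lev a b k, not_le.mp (Nat.find_min (exists_lev_le v) (by omega)), rfl⟩

/-- Rounding down does not pass the bounds of the classes, since they are levels. -/
theorem le_roundDown {c v : ℕ} (hc : ∃ i < D.m, c = D.L i ∨ c = D.U i) (htop : v ≤ D.top)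
    (hcv : c ≤ v) : c ≤ D.roundDown a b v := by
  rcases roundDown_cases (D := D) (a := a) (b := b) v with ⟨h, h'⟩ | ⟨g, hg, h⟩
  · omega
  · rw [h]
    obtain ⟨i, hi, rfl | rfl⟩ := hc
    · exact (le_nextUpTo hi).1 (by omega)
    · exact (le_nextUpTo hi).2 (by omega)

/-- Rounding down loses at most the fraction `e / 2` for `e = a / b`. If `g` is the level above `v`,
then `v ≤ g - 1`, and the level reached is at least the geometric step from `g`. -/
theorem mul_le_roundDown (hb : 0 < b) (hab : a ≤ 2 * b) {v : ℕ} (hv : v ≤ D.top) :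
    (1 - a / b / 2 : ℚ) * v ≤ D.roundDown a b v := by
  have hbQ : (0 : ℚ) < b := by exact_mod_cast hb
  rcases roundDown_cases (D := D) (a := a) (b := b) v with ⟨h, h'⟩ | ⟨g, hg, h⟩
  · have hvt : v = D.roundDown a b v := by omega
    have : (0 : ℚ) ≤ a / b / 2 := by positivity
    rw [← hvt]
    nlinarith [Nat.cast_nonneg (α := ℚ) v]
  · have h1 : geom a b g ≤ D.roundDown a b v := h ▸ geom_le_nextUpTo g D.m
    have h2 : (geom a b g : ℚ) = ((g - 1 : ℕ) : ℚ) - ((a * (g - 1) / (2 * b) : ℕ) : ℚ) := by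
      unfold geom
      refine Nat.cast_sub (Nat.div_le_of_le_mul ?_)
      exact Nat.mul_le_mul_right _ hab
    have h3 : ((a * (g - 1) / (2 * b) : ℕ) : ℚ) ≤ a / b / 2 * (g - 1 : ℕ) := by
      refine Nat.cast_div_le.trans (le_of_eq ?_)
      push_cast
      field_simp
    have h4 : (0 : ℚ) ≤ 1 - a / b / 2 := by
      have : (a : ℚ) ≤ 2 * b := by exact_mod_cast hab
      rw [sub_nonneg, div_div, div_le_one (by positivity)]
      linarith
    have h5 : (v : ℚ) ≤ (g - 1 : ℕ) := by
      have : v ≤ g - 1 := by omega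
      exact_mod_cast this
    calc (1 - a / b / 2 : ℚ) * v ≤ (1 - a / b / 2) * (g - 1 : ℕ) :=
          mul_le_mul_of_nonneg_left h5 h4
      _ ≤ geom a b g := by rw [h2]; linarith
      _ ≤ _ := by exact_mod_cast h1

theorem IsAlloc.roundDown_mem {z : ℕ → ℕ} (hz : D.IsAlloc z) {i : ℕ} (hi : z i ≠ 0) :
    D.L i ≤ D.roundDown a b (z i) ∧ D.roundDown a b (z i) ≤ D.U i :=
  ⟨le_roundDown ⟨i, hz.lt_m hi, Or.inl rfl⟩ (hz.le_top i) (hz.mem hi).1,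
    (roundDown_le _).trans (hz.mem hi).2⟩

theorem IsAlloc.roundDown {z : ℕ → ℕ} (hz : D.IsAlloc z) :
    D.IsAlloc fun i => D.roundDown a b (z i) := by
  have h0 : D.roundDown a b 0 = 0 := Nat.le_zero.mp (roundDown_le 0)
  refine ⟨fun i _ => ?_, fun i hi => ?_, fun S hS => ?_⟩
  · by_cases h : z i = 0
    · exact Or.inl (by rw [h, h0])
    · exact Or.inr (hz.roundDown_mem h)
  · simp only [hz.zero i hi, h0]
  · exact (Finset.sum_le_sum fun i _ => roundDown_le _).trans (hz.sum_le S hS)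

/-- Rounding is monotone and fixes the bounds of the classes, so it preserves the exchange
property. -/
theorem Exch.roundDown {z : ℕ → ℕ} (hz : D.IsAlloc z) (h : D.Exch z) :
    D.Exch fun i => D.roundDown a b (z i) := by
  have h0 : D.roundDown a b 0 = 0 := Nat.le_zero.mp (roundDown_le 0)
  intro i j hij hj hi0 hj0 hlt
  have hi0' : z i ≠ 0 := fun hc => hi0 (by simp only [hc, h0])
  have hj0' : z j ≠ 0 := fun hc => hj0 (by simp only [hc, h0])
  have hlt' : z i < z j := by
    by_contra hc
    exact absurd (roundDown_mono (D := D) (a := a) (b := b) (not_lt.mp hc)) (not_le.mpr hlt)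
  rcases h i j hij hj hi0' hj0' hlt' with h1 | h1
  · left
    refine le_antisymm (hz.roundDown_mem hi0').2 ?_
    simp only [h1]
    exact le_roundDown ⟨i, hij.trans hj, Or.inr rfl⟩ (h1 ▸ hz.le_top i) le_rfl
  · right
    refine le_antisymm ?_ (hz.roundDown_mem hj0').1
    simp only [h1]
    exact roundDown_le _

end Problem

/-! ### The dynamic program -/

namespace Problem

variable (D : Problem)

/-- Profits in integral units: `un i v` is the number of units earned by `v` items of class `i`. All
coordinates of the states of the dynamic program are less than `Z`. -/
structure Scaling where
  un : ℕ → ℕ → ℕ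
  Z : ℕ
  un_zero : ∀ i, un i 0 = 0
  m_lt : D.m < Z
  sum_lt : ∀ x, D.IsAlloc x → ∑ i ∈ Finset.range D.m, un i (x i) < Z

variable {D}

/-! #### Encoding of allocations -/

section Encoding

variable (D)

/-- The base in which allocations are encoded. -/
def base : ℕ := D.top + 2

/-- The number of items of an allocation. -/
def total (x : ℕ → ℕ) : ℕ := ∑ i ∈ Finset.range D.m, x i

/-- An allocation as a positive integer with the digits `1, x 0, …, x (m - 1)`, and the remaining
capacity `F m - total x` above them. So comparing codes means comparing remaining capacities in the
first place. -/
def enc (x : ℕ → ℕ) : ℕ :=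
  1 + ∑ i ∈ Finset.range D.m, x i * D.base ^ (i + 1) + (D.F D.m - D.total x) * D.base ^ (D.m + 1)

variable {D}

theorem IsAlloc.total_le {x : ℕ → ℕ} (hx : D.IsAlloc x) : D.total x ≤ D.F D.m := by
  simpa [total] using hx.sum_le (Finset.range D.m) subset_rfl

theorem low_digits_lt {x : ℕ → ℕ} (hx : ∀ i, x i ≤ D.top) (k : ℕ) :
    1 + ∑ i ∈ Finset.range k, x i * D.base ^ (i + 1) < D.base ^ (k + 1) := by
  induction k with
  | zero => simp [base]
  | succ k ih =>
    rw [Finset.sum_range_succ, pow_succ _ (k + 1)]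
    have h1 : x k * D.base ^ (k + 1) ≤ D.top * D.base ^ (k + 1) := Nat.mul_le_mul_right _ (hx k)
    have h2 : D.base ^ (k + 1) * D.base = D.top * D.base ^ (k + 1) + 2 * D.base ^ (k + 1) := by
      unfold base; ring
    omega

theorem base_pos : 0 < D.base := Nat.succ_pos _

/-- The remaining capacity is read off the code by one division. -/
theorem enc_div_top {x : ℕ → ℕ} (hx : ∀ i, x i ≤ D.top) :
    D.enc x / D.base ^ (D.m + 1) = D.F D.m - D.total x := by
  unfold enc
  rw [Nat.add_mul_div_right _ _ (pow_pos base_pos _), Nat.div_eq_of_lt (low_digits_lt hx _),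
    zero_add]

/-- The digit `x j` is read off the code by two divisions. -/
theorem enc_digit {x : ℕ → ℕ} (hx : ∀ i, x i ≤ D.top) {j : ℕ} (hj : j < D.m) :
    D.enc x / D.base ^ (j + 1) = x j + D.base * (D.enc x / D.base ^ (j + 2)) := by
  obtain ⟨h, hh⟩ : D.base ^ (j + 2) ∣ ∑ i ∈ Finset.Ico (j + 1) D.m, x i * D.base ^ (i + 1) +
      (D.F D.m - D.total x) * D.base ^ (D.m + 1) := by
    refine dvd_add (Finset.dvd_sum fun i hi => ?_) ?_
    · exact dvd_mul_of_dvd_right (pow_dvd_pow _ (by have := Finset.mem_Ico.mp hi; omega)) _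
    · exact dvd_mul_of_dvd_right (pow_dvd_pow _ (by omega)) _
  have hsplit : D.enc x = (1 + ∑ i ∈ Finset.range j, x i * D.base ^ (i + 1)) +
      D.base ^ (j + 1) * (x j + D.base * h) := by
    unfold enc
    rw [← Finset.sum_range_add_sum_Ico _ (show j + 1 ≤ D.m from hj), Finset.sum_range_succ]
    have : D.base ^ (j + 2) = D.base ^ (j + 1) * D.base := pow_succ _ _
    rw [this] at hh
    linarith
  have hdiv : D.enc x / D.base ^ (j + 1) = x j + D.base * h := by
    rw [hsplit, Nat.add_mul_div_left _ _ (pow_pos base_pos _),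
      Nat.div_eq_of_lt (low_digits_lt hx j), zero_add]
  rw [pow_succ _ (j + 1), ← Nat.div_div_eq_div_mul, hdiv, Nat.add_mul_div_left _ _ base_pos,
    Nat.div_eq_of_lt (by have := hx j; unfold base; omega), zero_add]

theorem enc_pos (x : ℕ → ℕ) : 0 < D.enc x := by unfold enc; omega

theorem lt_enc (x : ℕ → ℕ) : (D.F D.m - D.total x) * D.base ^ (D.m + 1) < D.enc x := by
  unfold enc; omega

theorem enc_lt {x : ℕ → ℕ} (hx : ∀ i, x i ≤ D.top) :
    D.enc x < (D.F D.m - D.total x + 1) * D.base ^ (D.m + 1) := by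
  have := low_digits_lt hx D.m
  unfold enc
  rw [add_mul, one_mul]
  omega

theorem enc_lt' {x : ℕ → ℕ} (hx : ∀ i, x i ≤ D.top) :
    D.enc x < (D.F D.m + 1) * D.base ^ (D.m + 1) :=
  (enc_lt hx).trans_le (Nat.mul_le_mul_right _ (by omega))

/-- The effect of a pick on sums over all classes. -/
theorem sum_update {f : ℕ → ℕ → ℕ} {x : ℕ → ℕ} {m j g : ℕ} (hj : j < m) (hx : x j = 0)
    (hf : f j 0 = 0) :
    ∑ i ∈ Finset.range m, f i (Function.update x j g i) =
      ∑ i ∈ Finset.range m, f i (x i) + f j g := by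
  have hj' := Finset.mem_range.mpr hj
  rw [← Finset.add_sum_erase _ _ hj', ← Finset.add_sum_erase _ (fun i => f i (x i)) hj']
  have : ∑ i ∈ (Finset.range m).erase j, f i (Function.update x j g i) =
      ∑ i ∈ (Finset.range m).erase j, f i (x i) :=
    Finset.sum_congr rfl fun i hi => by
      rw [Function.update_of_ne (Finset.ne_of_mem_erase hi)]
  simp only [Function.update_self, hx, hf, this]
  ring

theorem total_update {x : ℕ → ℕ} {j g : ℕ} (hj : j < D.m) (hx : x j = 0) :
    D.total (Function.update x j g) = D.total x + g :=
  sum_update (f := fun _ v => v) hj hx rfl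

/-- A pick adds `g` at the digit of class `j` and takes `g` from the remaining capacity. -/
theorem enc_update {x : ℕ → ℕ} {j g : ℕ} (hj : j < D.m) (hx : x j = 0)
    (hle : D.total x + g ≤ D.F D.m) :
    D.enc (Function.update x j g) + g * D.base ^ (D.m + 1) =
      D.enc x + g * D.base ^ (j + 1) := by
  unfold enc
  rw [total_update hj hx, sum_update (f := fun i v => v * D.base ^ (i + 1)) hj hx (by simp)]
  obtain ⟨d, hd⟩ := Nat.exists_eq_add_of_le hle
  rw [hd, show D.total x + g + d - (D.total x + g) = d by omega,
    show D.total x + g + d - D.total x = g + d by omega]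
  ring

end Encoding

/-! #### Valid states -/

/-- The number of classes from which something is taken. -/
def cnt (D : Problem) (x : ℕ → ℕ) : ℕ := ∑ i ∈ Finset.range D.m, if x i ≠ 0 then 1 else 0

namespace Scaling

variable (V : D.Scaling)

/-- The number of units that `x` earns. -/
def units (x : ℕ → ℕ) : ℕ := ∑ i ∈ Finset.range D.m, V.un i (x i)

/-- The number of the state with `q` units, threshold `c` and `r` chosen classes. -/
def idx (q c r : ℕ) : ℕ := (q * V.Z + c) * V.Z + r

/-- The threshold after `g` items have been taken from class `j`. -/
def nextC (D : Problem) (g j c : ℕ) : ℕ := if D.L j < g then max c (j + 1) else c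

/-- The allocation `x` is represented by the state `(q, c, r)` before class `j` is treated at level
`g`: the entries of `x` are those that have been treated so far, and those of the classes
`c, c + 1, …` are at their lower bounds. -/
structure Valid (g j q c r : ℕ) (x : ℕ → ℕ) : Prop where
  alloc : D.IsAlloc x
  units_eq : V.units x = q
  cnt_eq : D.cnt x = r
  done : ∀ i, x i ≠ 0 → g < x i ∨ x i = g ∧ i < j
  crit : ∀ i, x i ≠ 0 → i < c ∨ x i = D.L i
  c_le : c ≤ D.m

/-- Class `j` can be added with `g` items to an allocation `x` that has `r` chosen classes. Of the
majorization constraint, only the bound on the total is tested. -/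
def CanPick (D : Problem) (g j r : ℕ) (x : ℕ → ℕ) : Prop :=
  x j = 0 ∧ D.L j ≤ g ∧ g ≤ D.U j ∧ D.total x + g ≤ D.F (r + 1)

variable {V} {g j q c r : ℕ} {x : ℕ → ℕ}

theorem cnt_le (x : ℕ → ℕ) : D.cnt x ≤ D.m := by
  refine (Finset.sum_le_sum (g := fun _ => 1) fun i _ => ?_).trans (by simp)
  split_ifs <;> omega

theorem cnt_update (hj : j < D.m) (hx : x j = 0) (hg : 0 < g) :
    D.cnt (Function.update x j g) = D.cnt x + 1 := by
  refine (sum_update (f := fun _ v => if v ≠ 0 then 1 else 0) hj hx (by simp)).trans ?_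
  simp [cnt, hg.ne']

theorem units_update (hj : j < D.m) (hx : x j = 0) :
    V.units (Function.update x j g) = V.units x + V.un j g :=
  sum_update (f := V.un) hj hx (V.un_zero j)

theorem idx_inj {q' c' r' : ℕ} (hc : c < V.Z) (hr : r < V.Z) (hc' : c' < V.Z) (hr' : r' < V.Z)
    (h : V.idx q c r = V.idx q' c' r') : q = q' ∧ c = c' ∧ r = r' := by
  unfold idx at h
  have hZ : 0 < V.Z := by omega
  have key : ∀ {u v s t : ℕ}, s < V.Z → t < V.Z → u * V.Z + s = v * V.Z + t → u = v ∧ s = t := by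
    intro u v s t hs ht h
    have h1 := congrArg (· / V.Z) h
    simp only [Nat.add_comm (_ * V.Z), Nat.add_mul_div_right _ _ hZ, Nat.div_eq_of_lt hs,
      Nat.div_eq_of_lt ht, zero_add] at h1
    subst h1
    exact ⟨rfl, by omega⟩
  obtain ⟨h1, h2⟩ := key hr hr' h
  obtain ⟨h3, h4⟩ := key hc hc' h1
  exact ⟨h3, h4, h2⟩

theorem idx_lt (hq : q < V.Z) (hc : c < V.Z) (hr : r < V.Z) : V.idx q c r < V.Z * V.Z * V.Z := by
  unfold idx
  have h1 : (q + 1) * V.Z ≤ V.Z * V.Z := Nat.mul_le_mul_right _ hq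
  have h2 : (q * V.Z + c + 1) * V.Z ≤ V.Z * V.Z * V.Z := Nat.mul_le_mul_right _ (by nlinarith)
  nlinarith

namespace Valid

theorem c_lt (h : V.Valid g j q c r x) : c < V.Z := h.c_le.trans_lt V.m_lt

theorem r_lt (h : V.Valid g j q c r x) : r < V.Z := by
  rw [← h.cnt_eq]; exact (cnt_le x).trans_lt V.m_lt

theorem q_lt (h : V.Valid g j q c r x) : q < V.Z := by
  rw [← h.units_eq]; exact V.sum_lt x h.alloc

theorem idx_lt (h : V.Valid g j q c r x) : V.idx q c r < V.Z * V.Z * V.Z :=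
  Scaling.idx_lt h.q_lt h.c_lt h.r_lt

theorem succ (h : V.Valid g j q c r x) : V.Valid g (j + 1) q c r x :=
  { h with done := fun i hi => (h.done i hi).imp id fun h' => ⟨h'.1, by omega⟩ }

theorem next_level {g' : ℕ} (h : V.Valid g j q c r x) (hg : g' < g) : V.Valid g' 0 q c r x :=
  { h with done := fun i hi => by have := h.done i hi; omega }

theorem r_succ_le (h : V.Valid g j q c r x) (hj : j < D.m) (hx : x j = 0) : r + 1 ≤ D.m := by
  rw [← h.cnt_eq, ← cnt_update (g := 1) hj hx (by omega)]
  exact cnt_le _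

/-- A pick leads to a feasible allocation again. The new entry `g` is the smallest one, so the
majorization constraint for a set of at most `r` classes that contains `j` follows from the one in
which `j` is replaced by a chosen class outside of the set. -/
theorem pick (h : V.Valid g j q c r x) (hj : j < D.m) (hp : CanPick D g j r x) :
    V.Valid g (j + 1) (q + V.un j g) (nextC D g j c) (r + 1) (Function.update x j g) := by
  obtain ⟨hx, hL, hU, hF⟩ := hp
  have hg : 0 < g := (D.L_pos j hj).trans_le hL
  refine ⟨⟨fun i hi => ?_, fun i hi => ?_, fun S hS => ?_⟩, ?_, ?_, fun i hi => ?_,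
    fun i hi => ?_, ?_⟩
  · rcases eq_or_ne i j with rfl | hij
    · rw [Function.update_self]; exact Or.inr ⟨hL, hU⟩
    · rw [Function.update_of_ne hij]; exact h.alloc.bounds i hi
  · rw [Function.update_of_ne (by omega)]; exact h.alloc.zero i hi
  · by_cases hjS : j ∈ S
    · have hsum : ∑ i ∈ S, Function.update x j g i = g + ∑ i ∈ S.erase j, x i := by
        rw [← Finset.add_sum_erase _ _ hjS, Function.update_self]
        congr 1
        exact Finset.sum_congr rfl fun i hi => Function.update_of_ne (Finset.ne_of_mem_erase hi) _ _
      rw [hsum]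
      by_cases hcard : r + 1 ≤ S.card
      · have : ∑ i ∈ S.erase j, x i ≤ D.total x :=
          Finset.sum_le_sum_of_subset ((Finset.erase_subset _ _).trans hS)
        have := D.F_mono hcard
        omega
      · -- Fewer than `r` classes of `S` other than `j` are chosen, so `S` misses a chosen class,
        -- and that one has at least `g` items.
        obtain ⟨i, him, hi0, hiS⟩ : ∃ i < D.m, x i ≠ 0 ∧ i ∉ S := by
          by_contra hcon
          push Not at hcon
          have hsub : (Finset.range D.m).filter (x · ≠ 0) ⊆ S.erase j := by
            intro i hi
            rw [Finset.mem_filter, Finset.mem_range] at hi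
            refine Finset.mem_erase.mpr ⟨?_, hcon i hi.1 hi.2⟩
            rintro rfl
            exact hi.2 hx
          have hcle := Finset.card_le_card hsub
          rw [Finset.card_filter, Finset.card_erase_of_mem hjS] at hcle
          have := h.cnt_eq
          unfold cnt at this
          have : 0 < S.card := Finset.card_pos.mpr ⟨j, hjS⟩
          omega
        have hiE : i ∉ S.erase j := fun hc => hiS (Finset.mem_of_mem_erase hc)
        have h1 := h.alloc.sum_le (insert i (S.erase j)) (by
          intro k hk
          rcases Finset.mem_insert.mp hk with rfl | hk
          · exact Finset.mem_range.mpr him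
          · exact hS (Finset.mem_of_mem_erase hk))
        rw [Finset.sum_insert hiE, Finset.card_insert_of_notMem hiE,
          Finset.card_erase_add_one hjS] at h1
        have := h.done i hi0
        omega
    · rw [Finset.sum_congr rfl fun i hi => Function.update_of_ne
        (show i ≠ j from fun hc => hjS (hc ▸ hi)) _ _]
      exact h.alloc.sum_le S hS
  · rw [units_update hj hx, h.units_eq]
  · rw [cnt_update hj hx hg, h.cnt_eq]
  · rcases eq_or_ne i j with rfl | hij
    · rw [Function.update_self]; omega
    · rw [Function.update_of_ne hij] at hi ⊢
      have := h.done i hi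
      omega
  · rcases eq_or_ne i j with rfl | hij
    · rw [Function.update_self]; unfold nextC; split_ifs <;> omega
    · rw [Function.update_of_ne hij] at hi ⊢
      have := h.crit i hi
      unfold nextC; split_ifs <;> omega
  · have := h.c_le
    unfold nextC; split_ifs <;> omega

end Valid

/-! #### Layers of the table -/

variable (V)

/-- The nonzero entries of a layer of the table encode allocations. -/
def Sound (g j : ℕ) (A : ℕ → ℤ) : Prop :=
  ∀ n < V.Z * V.Z * V.Z, A n ≠ 0 → ∃ q c r x, V.Valid g j q c r x ∧ n = V.idx q c r ∧ A n = D.enc x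

/-- The entries of the layer `A` with numbers less than `n` have been passed on to the layer `A'`,
both without and with a pick of class `j`. -/
def Closed (g j n : ℕ) (A A' : ℕ → ℤ) : Prop :=
  ∀ q c r x, V.Valid g j q c r x → V.idx q c r < n → A (V.idx q c r) = D.enc x →
    (D.enc x : ℤ) ≤ A' (V.idx q c r) ∧ (CanPick D g j r x →
      (D.enc (Function.update x j g) : ℤ) ≤ A' (V.idx (q + V.un j g) (nextC D g j c) (r + 1)))

/-- The part of `y` that has been treated before class `j` is treated at level `g`. -/
def restrict (y : ℕ → ℕ) (g j i : ℕ) : ℕ := if g < y i ∨ y i = g ∧ i < j then y i else 0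

/-- The smallest threshold for `x`: the classes from there on are at their lower bounds or not
chosen. -/
def threshold (D : Problem) (x : ℕ → ℕ) : ℕ :=
  ((Finset.range D.m).filter fun i => x i ≠ 0 ∧ x i ≠ D.L i).sup (· + 1)

/-- The layer `A` contains an entry that is at least as good as `y`: it has the same state and at
least the same remaining capacity. -/
def Dominates (A : ℕ → ℤ) (y : ℕ → ℕ) : Prop :=
  (((D.F D.m - D.total y) * D.base ^ (D.m + 1) : ℕ) : ℤ) <
    A (V.idx (V.units y) (threshold D y) (D.cnt y))

variable {V} {y : ℕ → ℕ}

theorem restrict_succ_of_ne (h : y j ≠ g) : restrict y g (j + 1) = restrict y g j := by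
  funext i
  unfold restrict
  rcases eq_or_ne i j with rfl | hij
  · simp [h]
  · have : i < j + 1 ↔ i < j := by omega
    simp only [this]

theorem restrict_succ_of_eq (h : y j = g) :
    restrict y g (j + 1) = Function.update (restrict y g j) j g := by
  funext i
  rcases eq_or_ne i j with rfl | hij
  · simp [restrict, h]
  · rw [Function.update_of_ne hij]
    unfold restrict
    have : i < j + 1 ↔ i < j := by omega
    simp only [this]

theorem threshold_update (hj : j < D.m) (hx : x j = 0) (hL : D.L j ≤ g) :
    threshold D (Function.update x j g) = nextC D g j (threshold D x) := by
  have hpos := D.L_pos j hj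
  unfold nextC threshold
  split_ifs with h
  · have : (Finset.range D.m).filter (fun i => Function.update x j g i ≠ 0 ∧
        Function.update x j g i ≠ D.L i) =
        insert j ((Finset.range D.m).filter fun i => x i ≠ 0 ∧ x i ≠ D.L i) := by
      ext i
      rw [Finset.mem_insert, Finset.mem_filter, Finset.mem_filter]
      rcases eq_or_ne i j with rfl | hij
      · simp [hj]; omega
      · simp [hij]
    rw [this, Finset.sup_insert, max_comm]
  · congr 1
    ext i
    rw [Finset.mem_filter, Finset.mem_filter]
    rcases eq_or_ne i j with rfl | hij
    · simp [hx]; omega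
    · simp [hij]

theorem threshold_le (x : ℕ → ℕ) : threshold D x ≤ D.m :=
  Finset.sup_le fun i hi => by
    rw [Finset.mem_filter, Finset.mem_range] at hi; omega

theorem IsAlloc.mono_zero {y' : ℕ → ℕ} (hy : D.IsAlloc y) (h : ∀ i, y' i = 0 ∨ y' i = y i) :
    D.IsAlloc y' := by
  refine ⟨fun i hi => ?_, fun i hi => ?_, fun S hS => ?_⟩
  · rcases h i with h | h
    · exact Or.inl h
    · rw [h]; exact hy.bounds i hi
  · rcases h i with h | h
    · exact h
    · rw [h]; exact hy.zero i hi
  · refine (Finset.sum_le_sum fun i _ => ?_).trans (hy.sum_le S hS)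
    rcases h i with h | h <;> omega

theorem isAlloc_restrict (hy : D.IsAlloc y) (g j : ℕ) : D.IsAlloc (restrict y g j) :=
  IsAlloc.mono_zero hy fun i => by unfold restrict; split_ifs <;> simp

/-- The total of an allocation is bounded by the prefix sum for its number of chosen classes. -/
theorem IsAlloc.total_le_cnt (hx : D.IsAlloc x) : D.total x ≤ D.F (D.cnt x) := by
  have h := hx.sum_le ((Finset.range D.m).filter (x · ≠ 0)) (Finset.filter_subset _ _)
  rwa [Finset.sum_filter_ne_zero, Finset.card_filter] at h

/-- An entry of the table in the state of the restriction of `y` to the part treated so far can be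
extended by class `j` like `y` itself. This is where the exchange property is used: it excludes that
the entry has already chosen class `j`. -/
theorem Valid.eq_zero_of_exch (hy : D.IsAlloc y) (hex : D.Exch y) (hg : 0 < g) (hyj : y j = g)
    (h : V.Valid g j q (threshold D (restrict y g j)) r x) : x j = 0 := by
  by_contra hne
  have hd : g < x j := by have := h.done j hne; omega
  have hm := hy.mem (i := j) (by omega)
  rcases h.crit j hne with hc | hc
  · obtain ⟨i, hi, hji⟩ := (Finset.lt_sup_iff (f := fun i => i + 1)).mp hc
    rw [Finset.mem_filter, Finset.mem_range] at hi
    obtain ⟨him, hi0, hiL⟩ := hi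
    have hr : restrict y g j i = y i ∧ (g < y i ∨ y i = g ∧ i < j) := by
      unfold restrict at hi0 ⊢
      split_ifs at hi0 ⊢ with hcond
      · exact ⟨rfl, hcond⟩
      · exact absurd rfl hi0
    rw [hr.1] at hi0 hiL
    have hlt : j < i := by
      rcases Nat.lt_succ_iff_lt_or_eq.mp hji with h' | rfl
      · exact h'
      · omega
    have hxU := (h.alloc.mem hne).2
    rcases hex j i hlt him (by omega) hi0 (by omega) with h' | h'
    · omega
    · exact hiL h'
  · omega

/-- The induction step of the dynamic program: if a layer has an entry that is at least as good as
the part of `y` treated so far, then so has the next layer. If `y` picks class `j`, then the entry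
can do the same: it has not chosen class `j` by the exchange property, and as it has as many chosen
classes and at most as many items, the total stays below the same prefix sum. -/
theorem Dominates.step (hy : D.IsAlloc y) (hex : D.Exch y) (hj : j < D.m) (hg : 0 < g)
    {A A' : ℕ → ℤ} (hS : V.Sound g j A) (hC : V.Dominates A (restrict y g j))
    (hcl : V.Closed g j (V.Z * V.Z * V.Z) A A') : V.Dominates A' (restrict y g (j + 1)) := by
  have hy' := isAlloc_restrict hy g j
  unfold Dominates at hC ⊢
  have hlt : V.idx (V.units (restrict y g j)) (threshold D (restrict y g j))
      (D.cnt (restrict y g j)) < V.Z * V.Z * V.Z :=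
    Scaling.idx_lt (V.sum_lt _ hy') ((threshold_le _).trans_lt V.m_lt)
      ((cnt_le _).trans_lt V.m_lt)
  obtain ⟨q, c, r, x, hv, hidx, hA⟩ := hS _ hlt (by
    have h0 := Int.natCast_nonneg
      ((D.F D.m - D.total (restrict y g j)) * D.base ^ (D.m + 1))
    omega)
  obtain ⟨hq, hc, hr⟩ := idx_inj ((threshold_le _).trans_lt V.m_lt) ((cnt_le _).trans_lt V.m_lt)
    hv.c_lt hv.r_lt hidx
  rw [hidx] at hA hC hlt
  obtain ⟨h1, h2⟩ := hcl q c r x hv hlt hA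
  by_cases hyj : y j = g
  · have hx0 : x j = 0 := by
      subst hc
      exact hv.eq_zero_of_exch hy hex hg hyj
    have hr0 : restrict y g j j = 0 := by simp [restrict, hyj]
    have hm := hy.mem (i := j) (by omega)
    have htot : D.total x ≤ D.total (restrict y g j) := by
      rw [hA] at hC
      have h3 := (Int.ofNat_lt.mp hC).trans (enc_lt fun i => hv.alloc.le_top i)
      have h4 := Nat.lt_of_mul_lt_mul_right h3
      have := hv.alloc.total_le
      omega
    have hy'' := isAlloc_restrict hy g (j + 1)
    have htot' := total_update (g := g) hj hr0
    have hcnt' := cnt_update hj hr0 hg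
    rw [← restrict_succ_of_eq hyj] at htot' hcnt'
    have hp : CanPick D g j r x := by
      refine ⟨hx0, hyj ▸ hm.1, hyj ▸ hm.2, ?_⟩
      have := IsAlloc.total_le_cnt hy''
      rw [htot', hcnt', hr] at this
      omega
    refine lt_of_lt_of_le ?_ ((h2 hp).trans_eq ?_)
    · refine Int.ofNat_lt.mpr (lt_of_le_of_lt ?_ (lt_enc _))
      refine Nat.mul_le_mul_right _ ?_
      rw [total_update hj hx0]
      omega
    · rw [hcnt', hr, restrict_succ_of_eq hyj, threshold_update hj hr0 (hyj ▸ hm.1),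
        units_update hj hr0, hq, hc]
  · rw [restrict_succ_of_ne hyj, hq, hc, hr]
    rw [hA] at hC
    exact hC.trans_le h1

/-- There is nothing to be done between two levels if the entries of `y` are levels. -/
theorem Dominates.next_level {g' : ℕ} {A : ℕ → ℤ} (hy : D.IsAlloc y) (hg : g' < g)
    (hlev : ∀ i, y i ≤ g' ∨ g ≤ y i) (hC : V.Dominates A (restrict y g D.m)) :
    V.Dominates A (restrict y g' 0) := by
  have : restrict y g' 0 = restrict y g D.m := by
    funext i
    unfold restrict
    have h1 := hlev i
    have h2 := hy.zero i
    split_ifs <;> omega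
  unfold Dominates at hC ⊢
  rwa [this]

theorem Sound.next_level {g' : ℕ} {A : ℕ → ℤ} (hg : g' < g) (hS : V.Sound g j A) :
    V.Sound g' 0 A := fun n hn hA => by
  obtain ⟨q, c, r, x, h1, h2⟩ := hS n hn hA
  exact ⟨q, c, r, x, h1.next_level hg, h2⟩

theorem valid_zero (g : ℕ) : V.Valid g 0 0 0 0 0 :=
  ⟨isAlloc_zero, by simp [units, V.un_zero], by simp [cnt], by simp, by simp, Nat.zero_le _⟩

theorem Dominates.zero (hy : D.IsAlloc y) {A : ℕ → ℤ} (hA : A 0 = D.enc 0) :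
    V.Dominates A (restrict y D.top 0) := by
  have : restrict y D.top 0 = 0 := by
    funext i
    have := hy.le_top i
    unfold restrict
    rw [if_neg (by omega)]; rfl
  unfold Dominates
  rw [this]
  have h0 : threshold D 0 = 0 := by simp [threshold]
  have hv := valid_zero (V := V) 0
  rw [h0, hv.units_eq, hv.cnt_eq, show V.idx 0 0 0 = 0 by simp [idx], hA]
  exact Int.ofNat_lt.mpr (lt_enc 0)

/-- At the end, the table has an entry with at least as many units as `y`. -/
theorem Dominates.exists_entry (hy : D.IsAlloc y) {A : ℕ → ℤ}
    (hC : V.Dominates A (restrict y 0 0)) :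
    ∃ n < V.Z * V.Z * V.Z, V.units y * V.Z * V.Z ≤ n ∧ 0 < A n := by
  have : restrict y 0 0 = y := by
    funext i
    unfold restrict
    split_ifs <;> omega
  unfold Dominates at hC
  rw [this] at hC
  refine ⟨_, Scaling.idx_lt (V.sum_lt _ hy) ((threshold_le y).trans_lt V.m_lt)
    ((cnt_le y).trans_lt V.m_lt), ?_, lt_of_le_of_lt (Int.natCast_nonneg _) hC⟩
  calc V.units y * V.Z * V.Z ≤ (V.units y * V.Z + threshold D y) * V.Z :=
        Nat.mul_le_mul_right _ (Nat.le_add_right _ _)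
    _ ≤ _ := Nat.le_add_right _ _

end Scaling

end Problem

/-! ### Updating the table -/

/-- `f` with the value at `k` raised to at least `v`. -/
def raise {α : Type*} [DecidableEq α] (f : α → ℤ) (k : α) (v : ℤ) : α → ℤ :=
  Function.update f k (max (f k) v)

theorem raise_apply {α : Type*} [DecidableEq α] (f : α → ℤ) (k : α) (v : ℤ) (i : α) :
    raise f k v i = if i = k then max (f i) v else f i := by
  unfold raise
  rw [Function.update_apply]
  split_ifs with h
  exacts [by rw [h], rfl]

theorem le_raise {α : Type*} [DecidableEq α] (f : α → ℤ) (k : α) (v : ℤ) (i : α) :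
    f i ≤ raise f k v i := by
  rw [raise_apply]; split_ifs
  exacts [le_max_left _ _, le_rfl]

theorem le_raise_self {α : Type*} [DecidableEq α] (f : α → ℤ) (k : α) (v : ℤ) :
    v ≤ raise f k v k := by
  rw [raise_apply, if_pos rfl]; exact le_max_right _ _

namespace Problem

variable {D : Problem}

/-- Allocations are determined by their codes. -/
theorem enc_inj {x y : ℕ → ℕ} (hx : D.IsAlloc x) (hy : D.IsAlloc y) (h : D.enc x = D.enc y) :
    x = y := by
  funext i
  by_cases hi : i < D.m
  · have h1 := enc_digit (fun i => hx.le_top i) hi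
    have h2 := enc_digit (fun i => hy.le_top i) hi
    rw [h] at h1
    omega
  · rw [hx.zero i (not_lt.mp hi), hy.zero i (not_lt.mp hi)]

namespace Scaling

variable (V : D.Scaling) {g j q c r n t : ℕ} {x : ℕ → ℕ}

/-- The number of entries of a layer. -/
def size : ℕ := V.Z * V.Z * V.Z

/-- The `t`-th layer of the table `f`. -/
def layer (t : ℕ) (f : ℤ → ℤ) (n : ℕ) : ℤ := f ((t : ℤ) * V.size + n)

variable {V}

theorem layer_raise (t n : ℕ) (f : ℤ → ℤ) (v : ℤ) :
    V.layer t (raise f ((t : ℤ) * V.size + n) v) = raise (V.layer t f) n v := by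
  funext i
  simp [layer, raise_apply]

theorem layer_raise_succ (hn : n < V.size) (m : ℕ) (f : ℤ → ℤ) (v : ℤ) :
    V.layer t (raise f (((t + 1 : ℕ) : ℤ) * V.size + m) v) n = V.layer t f n := by
  unfold layer
  rw [raise_apply, if_neg]
  push_cast
  rw [add_mul, one_mul]
  omega

theorem Sound.raise {A : ℕ → ℤ} (hA : V.Sound g j A) (h : V.Valid g j q c r x) :
    V.Sound g j (raise A (V.idx q c r) (D.enc x)) := by
  intro n hn hne
  rw [raise_apply] at hne ⊢
  split_ifs at hne ⊢ with hcase
  · subst hcase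
    have hpos : (0 : ℤ) < D.enc x := by exact_mod_cast enc_pos x
    rcases le_total (A (V.idx q c r)) (D.enc x) with hle | hle
    · exact ⟨q, c, r, x, h, rfl, max_eq_right hle⟩
    · rw [max_eq_left hle]
      exact hA _ hn (by omega)
  · exact hA n hn hne

theorem Closed.mono {A A' A'' : ℕ → ℤ} (h : V.Closed g j n A A') (hle : ∀ i, A' i ≤ A'' i) :
    V.Closed g j n A A'' := fun q c r x hv hi hA =>
  ⟨((h q c r x hv hi hA).1).trans (hle _), fun hp => ((h q c r x hv hi hA).2 hp).trans (hle _)⟩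

theorem Closed.succ {A A' : ℕ → ℤ} (h : V.Closed g j n A A')
    (hn : ∀ q c r x, V.Valid g j q c r x → V.idx q c r = n → A n = D.enc x →
      (D.enc x : ℤ) ≤ A' n ∧ (CanPick D g j r x →
      (D.enc (Function.update x j g) : ℤ) ≤ A' (V.idx (q + V.un j g) (nextC D g j c) (r + 1)))) :
    V.Closed g j (n + 1) A A' := by
  intro q c r x hv hi hA
  rcases Nat.lt_succ_iff_lt_or_eq.mp hi with hlt | heq
  · exact h q c r x hv hlt hA
  · have := hn q c r x hv heq (heq ▸ hA)
    rwa [← heq] at this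

variable (V) in
/-- The state of the table `f` while layer `t` with the entries `A` is processed, when class `j` is
treated at level `g`: the first `n` entries have been passed on to layer `t + 1`, and the layers
behind that one are empty. -/
structure TableInv (g j t : ℕ) (A : ℕ → ℤ) (n : ℕ) (f : ℤ → ℤ) : Prop where
  layer_eq : ∀ i < V.size, V.layer t f i = A i
  sound : V.Sound g (j + 1) (V.layer (t + 1) f)
  closed : V.Closed g j n A (V.layer (t + 1) f)
  zero : ∀ k : ℤ, ((t + 2 : ℕ) : ℤ) * V.size ≤ k → f k = 0

theorem TableInv.succ_of_eq_zero {A : ℕ → ℤ} {f : ℤ → ℤ} (h : V.TableInv g j t A n f)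
    (hA : A n = 0) : V.TableInv g j t A (n + 1) f :=
  { h with
    closed := h.closed.succ fun q c r x _ _ hA' => by
      have := enc_pos (D := D) x
      omega }

theorem TableInv.raise {A : ℕ → ℤ} {f : ℤ → ℤ} (h : V.TableInv g j t A n f)
    (hv : V.Valid g (j + 1) q c r x) :
    V.TableInv g j t A n (raise f (((t + 1 : ℕ) : ℤ) * V.size + V.idx q c r) (D.enc x)) := by
  have hlt : V.idx q c r < V.size := hv.idx_lt
  refine ⟨fun i hi => ?_, ?_, ?_, fun k hk => ?_⟩
  · rw [layer_raise_succ hi]; exact h.layer_eq i hi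
  · rw [layer_raise]; exact h.sound.raise hv
  · rw [layer_raise]; exact h.closed.mono (le_raise _ _ _)
  · rw [raise_apply, if_neg]
    · exact h.zero k hk
    · push_cast at hk ⊢
      rw [add_mul] at hk ⊢
      omega

/-- The entries of the new layer after the `n`-th entry, which encodes `x`, has been passed on. -/
theorem TableInv.succ {A : ℕ → ℤ} {f : ℤ → ℤ} (h : V.TableInv g j t A n f)
    (hv : V.Valid g j q c r x) (hn : n = V.idx q c r) (hA : A n = D.enc x)
    (h1 : (D.enc x : ℤ) ≤ V.layer (t + 1) f n)
    (h2 : CanPick D g j r x → (D.enc (Function.update x j g) : ℤ) ≤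
      V.layer (t + 1) f (V.idx (q + V.un j g) (nextC D g j c) (r + 1))) :
    V.TableInv g j t A (n + 1) f :=
  { h with
    closed := h.closed.succ fun q' c' r' x' hv' hi' hA' => by
      obtain ⟨rfl, rfl, rfl⟩ := idx_inj hv.c_lt hv.r_lt hv'.c_lt hv'.r_lt (hn.symm.trans hi'.symm)
      obtain rfl : x = x' := enc_inj hv.alloc hv'.alloc (by
        rw [hA] at hA'; exact_mod_cast hA')
      exact ⟨h1, h2⟩ }

end Scaling

end Problem

/-! ### The program

The arrays `0, …, 6` are those of the input and the output. The program cuts off the upper bounds in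
array `3`. Of the other arrays,
* `aPrefix` holds the prefix sums of the target vector,
* `aOrd` the classes in the order of decreasing profits,
* `aTable` the layers of the table of the dynamic program one after the other, and
* `aPow` the powers of the base in which allocations are encoded.

The remaining ones are scalar variables: `vI`, `vJ`, `vN` count classes, positions and states, `vT`
counts layers, `vG` is the current level and `vNext` the one after it, `vLbNum / vLbDen` is the
largest revenue from a single class, and `vZ` is the bound `Z` on the coordinates of a state. -/

local notation "aPrefix" => (7 : ℕ)
local notation "aOrd" => (8 : ℕ)
local notation "aTable" => (9 : ℕ)
local notation "aPow" => (10 : ℕ)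
local notation "vI" => (11 : ℕ)
local notation "vJ" => (12 : ℕ)
local notation "vCnt" => (13 : ℕ)
local notation "vLbNum" => (14 : ℕ)
local notation "vLbDen" => (15 : ℕ)
local notation "vZ" => (16 : ℕ)
local notation "vG" => (17 : ℕ)
local notation "vT" => (18 : ℕ)
local notation "vN" => (19 : ℕ)
local notation "vNext" => (20 : ℕ)
local notation "vEntry" => (21 : ℕ)
local notation "vUnits" => (22 : ℕ)
local notation "vState" => (23 : ℕ)

namespace Scheme

open RAM RAM.Expr RAM.Program

/-- The number of classes. -/
abbrev eM : Expr := cell 0 0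
/-- The numerator of `ε`. -/
abbrev eNum : Expr := cell 0 2
/-- The denominator of `ε`. -/
abbrev eDen : Expr := cell 0 3
/-- The largest entry of the target vector. -/
abbrev eTop : Expr := cell 1 0
/-- The class at position `vJ` of the order by profits. -/
abbrev eCls : Expr := cell aOrd (var vJ)
/-- The lower bound of that class. -/
abbrev eL : Expr := cell 2 eCls
/-- The upper bound of that class. -/
abbrev eU : Expr := cell 3 eCls
/-- The number of entries of a layer of the table. -/
abbrev eSize : Expr := var vZ * var vZ * var vZ
/-- The digit of the current entry that belongs to position `vJ`. -/
abbrev eDigit : Expr :=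
  var vEntry / cell aPow (var vJ + 1) - (eTop + 2) * (var vEntry / cell aPow (var vJ + 2))
/-- The number of units that `vG` items of the class at position `vJ` earn. -/
abbrev eUnits : Expr :=
  (cell 4 eCls * var vG * 2 * eM * eDen * var vLbDen) / (cell 5 eCls * eNum * var vLbNum)
/-- The threshold `c` in the state with number `vN = (q * Z + c) * Z + r`. -/
abbrev eThr : Expr := var vN / var vZ - var vN / var vZ / var vZ * var vZ

/-- Raise the table entry with index `k` to at least `v`. -/
def raiseP (k v : Expr) : Program := ifLt (cell aTable k) v (store aTable k v) skip

/-- Add the class at position `vJ` with `vG` items to the allocation in the current entry, and raise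
the entry of the new state in the next layer. -/
def takeP : Program :=
  .seq (assign vUnits eUnits) <|
  .seq (assign vState (var vN + 1 + var vUnits * var vZ * var vZ)) <|
  .seq (ifLt eL (var vG)
    (ifLt eThr (var vJ + 1) (assign vState (var vState + (var vJ + 1 - eThr) * var vZ)) skip)
    skip) <|
  raiseP ((var vT + 1) * eSize + var vState)
    (var vEntry + var vG * cell aPow (var vJ + 1) - var vG * cell aPow (eM + 1))

/-- Add the class at position `vJ` if that is possible: `vG` lies between its bounds, the total
stays below the prefix sum for one more class, and the class has not been chosen yet. The total enters
through the remaining capacity, which is the part of the entry above the digits. -/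
def pickP : Program :=
  ifLt (var vG) eL skip <|
  ifLt eU (var vG) skip <|
  ifLt (cell aPrefix (var vN - var vN / var vZ * var vZ + 1) + var vEntry / cell aPow (eM + 1))
    (cell aPrefix eM + var vG) skip <|
  ifLt 0 eDigit skip takeP

/-- Pass entry `vN` of layer `vT` of the table on to the next layer. -/
def entryP : Program :=
  .seq (assign vEntry (cell aTable (var vT * eSize + var vN))) <|
  ifLt 0 (var vEntry)
    (.seq (raiseP ((var vT + 1) * eSize + var vN) (var vEntry)) pickP)
    skip

/-- Treat all classes at level `vG`. -/
def levelP : Program :=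
  forLt vJ eM (.seq (forLt vN eSize entryP) (assign vT (var vT + 1)))

/-- Raise `vNext` to the value of `v` if that is less than `vG`. -/
def bumpP (v : Expr) : Program :=
  ifLt (var vNext) v (ifLt v (var vG) (assign vNext v) skip) skip

/-- The geometric step to the next level. -/
abbrev eGeom : Expr := var vG - 1 - eNum * (var vG - 1) / (2 * eDen)

/-- Go to the next level. -/
def nextP : Program :=
  .seq (assign vNext 0) <|
  .seq (ifLt 0 eGeom (assign vNext eGeom) skip) <|
  .seq (forLt vJ eM (.seq (bumpP eL) (bumpP eU))) <|
  assign vG (var vNext)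

/-- The dynamic program. -/
def dpP : Program :=
  .seq (store aTable 0 (1 + cell aPrefix eM * cell aPow (eM + 1))) <|
  .seq (assign vG eTop) <|
  whileLt 0 (var vG) (.seq levelP nextP)

/-- Find the last nonzero entry of the last layer, and decode it. The number of units is the leading
coordinate of a state, so no entry has more units. -/
def outputP : Program :=
  .seq (forLt vN eSize <|
    ifLt 0 (cell aTable (var vT * eSize + var vN))
      (assign vEntry (cell aTable (var vT * eSize + var vN))) skip) <|
  forLt vJ eM (store 6 eCls eDigit)

/-- Put class `vI` in position `vCnt`, and cut off its upper bound at the largest entry of the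
target vector. An unprofitable class gets the upper bound `0`, by which it is excluded. -/
def placeP : Program :=
  .seq (store aOrd (var vCnt) (var vI)) <|
  ifLt 0 (cell 4 (var vI))
    (ifLt eTop (cell 3 (var vI)) (store 3 (var vI) eTop) skip)
    (store 3 (var vI) 0)

/-- Compute the order of the classes by profits, and cut off the upper bounds. The position of a
class is the number of classes before it. -/
def sortP : Program :=
  forLt vI eM <|
  .seq (assign vCnt 0) <|
  .seq (forLt vJ eM <|
    ifLt (cell 4 (var vI) * cell 5 (var vJ) * eM + var vJ)
      (cell 4 (var vJ) * cell 5 (var vI) * eM + var vI) (assign vCnt (var vCnt + 1)) skip)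
  placeP

/-- Compute the prefix sums of the target vector and the powers of the base of the encoding. -/
def prefixP : Program :=
  .seq (store aPow 0 1) <|
  forLt vI (eM + 1) <|
  .seq (store aPrefix (var vI + 1) (cell aPrefix (var vI) + cell 1 (var vI))) <|
  store aPow (var vI + 1) (cell aPow (var vI) * (eTop + 2))

/-- Compute the largest revenue from a single class. -/
def boundP : Program :=
  .seq (assign vLbDen 1) <|
  forLt vI eM <|
  ifLt (cell 3 (var vI)) (cell 2 (var vI)) skip <|
  ifLt (var vLbNum * cell 5 (var vI)) (cell 4 (var vI) * cell 3 (var vI) * var vLbDen)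
    (.seq (assign vLbNum (cell 4 (var vI) * cell 3 (var vI))) (assign vLbDen (cell 5 (var vI))))
    skip

/-- The approximation scheme. -/
def program : Program :=
  .seq sortP <| .seq prefixP <| .seq boundP <|
  .seq (assign vZ (2 * eM * eM * eDen / eNum + eM + 2)) <|
  .seq dpP outputP

theorem small_program : program.small = true := by decide

/-! ### Correctness of the dynamic program -/

section DP

variable {D : Problem} {V : D.Scaling} {a b W : ℕ}

/-- What the memory holds after the preprocessing. -/
structure Ctx (V : D.Scaling) (a b : ℕ) (σ : Mem) : Prop where
  m_eq : σ 0 0 = D.m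
  num_eq : σ 0 2 = a
  den_eq : σ 0 3 = b
  top_eq : σ 1 0 = D.top
  L_eq : ∀ j : ℕ, j < D.m → σ 2 (σ aOrd j) = D.L j
  U_eq : ∀ j : ℕ, j < D.m → σ 3 (σ aOrd j) = D.U j
  F_eq : ∀ r : ℕ, r ≤ D.m → σ aPrefix r = D.F r
  pow_eq : ∀ k : ℕ, k ≤ D.m + 1 → σ aPow k = (D.base ^ k : ℕ)
  Z_eq : σ vZ 0 = V.Z
  un_eq : ∀ j g : ℕ, j < D.m → 0 < g → g ≤ D.U j →
    (σ 4 (σ aOrd j) * g * 2 * D.m * b * σ vLbDen 0) /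
      (σ 5 (σ aOrd j) * a * σ vLbNum 0) = V.un j g

/-- The arrays that hold the result of the preprocessing. -/
def ctxArrays : List ℕ := [0, 1, 2, 3, 4, 5, 7, 8, 10, 14, 15, 16]

theorem Ctx.congr {σ τ : Mem} (h : Ctx V a b σ) (hc : ∀ c ∈ ctxArrays, τ c = σ c) :
    Ctx V a b τ := by
  simp only [ctxArrays, List.forall_mem_cons, List.not_mem_nil, false_imp_iff, implies_true,
    and_true] at hc
  obtain ⟨h0, h1, h2, h3, h4, h5, h7, h8, h10, h14, h15, h16⟩ := hc
  constructor
  · rw [h0]; exact h.m_eq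
  · rw [h0]; exact h.num_eq
  · rw [h0]; exact h.den_eq
  · rw [h1]; exact h.top_eq
  · rw [h2, h8]; exact h.L_eq
  · rw [h3, h8]; exact h.U_eq
  · rw [h7]; exact h.F_eq
  · rw [h10]; exact h.pow_eq
  · rw [h16]; exact h.Z_eq
  · rw [h4, h8, h15, h5, h14]; exact h.un_eq

/-- The word length leaves room for everything that the dynamic program stores. -/
structure Room (V : D.Scaling) (a b W : ℕ) : Prop where
  size : V.size < 2 ^ W
  enc : (D.F D.m + 1) * D.base ^ (D.m + 1) < 2 ^ W
  top : D.top < 2 ^ W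
  steps : D.numLev a b * D.m < 2 ^ W
  Z_lt : V.Z < 2 ^ W

theorem Room.m_lt (h : Room V a b W) : D.m < 2 ^ W := V.m_lt.trans h.Z_lt

theorem runs_raiseP {σ : Mem} {post : Mem → Prop} {k v : Expr} (hv : FitsWord W (v.eval σ))
    (h : ∀ τ : Mem, (∀ c, c ≠ aTable → τ c = σ c) →
      τ aTable = raise (σ aTable) (k.eval σ) (v.eval σ) → post τ) :
    Runs W (raiseP k v) (raiseP k v).bd σ post := by
  refine Runs.ifLt (fun hlt => Runs.store (fun _ => hv) (h _ ?_ ?_)) fun hlt =>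
    Runs.skip (h _ ?_ ?_)
  · exact fun c hc => Mem.write_of_ne _ hc _ _
  · rw [eval_cell] at hlt
    rw [Mem.write_same, raise, max_eq_right hlt.le]
  · exact fun _ _ => rfl
  · rw [eval_cell] at hlt
    rw [raise, max_eq_left (not_lt.mp hlt)]
    exact (Function.update_eq_self _ _).symm

/-- The scalar variables while an entry of the table is treated. -/
structure Loc (g j t n : ℕ) (σ : Mem) : Prop where
  g_eq : σ vG 0 = g
  j_eq : σ vJ 0 = j
  t_eq : σ vT 0 = t
  n_eq : σ vN 0 = n

theorem Loc.congr {g j t n : ℕ} {σ τ : Mem} (h : Loc g j t n σ)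
    (hc : ∀ c ∈ [vG, vJ, vT, vN], τ c = σ c) : Loc g j t n τ := by
  simp only [List.forall_mem_cons, List.not_mem_nil, false_imp_iff, implies_true, and_true] at hc
  obtain ⟨h1, h2, h3, h4⟩ := hc
  exact ⟨by rw [h1]; exact h.g_eq, by rw [h2]; exact h.j_eq, by rw [h3]; exact h.t_eq,
    by rw [h4]; exact h.n_eq⟩

theorem fitsWord_natCast {n : ℕ} (h : n < 2 ^ W) : FitsWord W (n : ℤ) := by
  simpa [FitsWord] using h

section entry

variable {g j t n q c r : ℕ} {x : ℕ → ℕ} {A : ℕ → ℤ} {σ : Mem}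

theorem idx_div (hr : r < V.Z) : ((V.idx q c r : ℕ) : ℤ) / V.Z = ((q * V.Z + c : ℕ) : ℤ) := by
  rw [← Int.natCast_div]
  unfold Problem.Scaling.idx
  rw [Nat.add_comm (_ * _), Nat.add_mul_div_right _ _ (by omega), Nat.div_eq_of_lt hr, zero_add]

theorem idx_div_div (hc : c < V.Z) : ((q * V.Z + c : ℕ) : ℤ) / V.Z = (q : ℤ) := by
  rw [← Int.natCast_div, Nat.add_comm (_ * _), Nat.add_mul_div_right _ _ (by omega),
    Nat.div_eq_of_lt hc, zero_add]

theorem runs_takeP (hroom : Room V a b W) (hctx : Ctx V a b σ) (hloc : Loc g j t n σ)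
    (hj : j < D.m) (hv : V.Valid g j q c r x) (hn : n = V.idx q c r)
    (hE : σ vEntry 0 = D.enc x) (hp : Problem.Scaling.CanPick D g j r x) :
    Runs W takeP takeP.bd σ fun τ => τ aTable = raise (σ aTable) (((t + 1 : ℕ) : ℤ) * V.size +
      V.idx (q + V.un j g) (Problem.Scaling.nextC D g j c) (r + 1))
      (D.enc (Function.update x j g)) := by
  have hv' := hv.pick hj hp
  have hg : 0 < g := (D.L_pos j hj).trans_le hp.2.1
  have hU := hp.2.2.1
  have hsize : ∀ s, s ≤ V.idx (q + V.un j g) (Problem.Scaling.nextC D g j c) (r + 1) →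
      FitsWord W (s : ℤ) := fun s hs =>
    fitsWord_natCast ((hs.trans_lt hv'.idx_lt).trans hroom.size)
  have hcn : c ≤ Problem.Scaling.nextC D g j c := by
    unfold Problem.Scaling.nextC; split_ifs <;> omega
  -- the state after the first assignment to `vState`
  have hst : V.idx (q + V.un j g) c (r + 1) ≤
      V.idx (q + V.un j g) (Problem.Scaling.nextC D g j c) (r + 1) := by
    unfold Problem.Scaling.idx
    exact Nat.add_le_add_right (Nat.mul_le_mul_right _ (Nat.add_le_add_left hcn _)) _
  unfold takeP
  have hu : eUnits.eval σ = V.un j g := by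
    simp only [eval_div, eval_mul, eval_cell, eval_zero, eval_two, eval_three, hloc.j_eq, hloc.g_eq,
      hctx.m_eq, hctx.num_eq, hctx.den_eq]
    exact hctx.un_eq j g hj hg hU
  refine Runs.seq (Runs.assign (fun _ => ?_) fun τ₁ hf₁ hτ₁ => ?_)
  · rw [hu]
    have := hv'.q_lt
    exact fitsWord_natCast (lt_of_le_of_lt (by omega) hroom.Z_lt)
  rw [hu] at hτ₁
  have hctx₁ := hctx.congr fun c hc => hf₁ c (by rintro rfl; simp [ctxArrays] at hc)
  have hloc₁ := hloc.congr fun c hc => hf₁ c (by rintro rfl; simp at hc)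
  have hs₁ : (var vN + 1 + var vUnits * var vZ * var vZ).eval τ₁ =
      V.idx (q + V.un j g) c (r + 1) := by
    simp only [eval_add, eval_mul, eval_cell, eval_zero, eval_one, hloc₁.n_eq, hτ₁, hctx₁.Z_eq, hn]
    unfold Problem.Scaling.idx
    push_cast
    ring
  refine Runs.seq (Runs.assign (fun _ => ?_) fun τ₂ hf₂ hτ₂ => ?_)
  · rw [hs₁]; exact hsize _ hst
  rw [hs₁] at hτ₂
  have hctx₂ := hctx₁.congr fun c hc => hf₂ c (by rintro rfl; simp [ctxArrays] at hc)
  have hloc₂ := hloc₁.congr fun c hc => hf₂ c (by rintro rfl; simp at hc)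
  have hthr : eThr.eval τ₂ = c := by
    simp only [eval_sub, eval_div, eval_mul, eval_cell, eval_zero, hloc₂.n_eq, hctx₂.Z_eq, hn]
    rw [idx_div hv.r_lt, idx_div_div hv.c_lt]
    push_cast
    ring
  have hL₂ : eL.eval τ₂ = D.L j := by
    simp only [eval_cell, eval_zero, hloc₂.j_eq]
    exact hctx₂.L_eq j hj
  refine Runs.seq (Runs.mono (post := fun τ₃ => (∀ c, c ≠ vState → τ₃ c = τ₂ c) ∧
    τ₃ vState 0 = V.idx (q + V.un j g) (Problem.Scaling.nextC D g j c) (r + 1))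
    (Runs.ifLt (fun h1 => Runs.ifLt
      (fun h2 => Runs.assign (fun _ => ?_) fun τ₃ hf₃ hτ₃ => ⟨hf₃, ?_⟩)
      fun h2 => Runs.skip ⟨fun _ _ => rfl, ?_⟩) fun h1 => Runs.skip ⟨fun _ _ => rfl, ?_⟩)
    le_rfl ?_)
  rotate_right
  · rintro τ₃ ⟨hf₃, hτ₃⟩
    have hctx₃ := hctx₂.congr fun c hc => hf₃ c (by rintro rfl; simp [ctxArrays] at hc)
    have hloc₃ := hloc₂.congr fun c hc => hf₃ c (by rintro rfl; simp at hc)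
    have hE₃ : τ₃ vEntry 0 = D.enc x := by
      rw [hf₃ _ (by simp), hf₂ _ (by simp), hf₁ _ (by simp), hE]
    have hF := D.F_mono (hv.r_succ_le hj hp.1)
    have henc := Problem.enc_update hj hp.1 (hp.2.2.2.trans hF)
    have hval : (var vEntry + var vG * cell aPow (var vJ + 1) -
        var vG * cell aPow (eM + 1)).eval τ₃ = D.enc (Function.update x j g) := by
      simp only [eval_sub, eval_add, eval_mul, eval_cell, eval_zero, eval_one, hE₃, hloc₃.g_eq,
        hloc₃.j_eq, hctx₃.m_eq]
      have h1 := hctx₃.pow_eq (j + 1) (by omega)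
      have h2 := hctx₃.pow_eq (D.m + 1) le_rfl
      push_cast at h1 h2
      rw [h1, h2]
      have := congrArg (Nat.cast (R := ℤ)) henc
      push_cast at this
      linarith
    have hidx : ((var vT + 1) * eSize + var vState).eval τ₃ = ((t + 1 : ℕ) : ℤ) * V.size +
        V.idx (q + V.un j g) (Problem.Scaling.nextC D g j c) (r + 1) := by
      simp only [eval_add, eval_mul, eval_cell, eval_zero, eval_one, hloc₃.t_eq, hctx₃.Z_eq, hτ₃]
      unfold Problem.Scaling.size
      push_cast
      ring
    refine runs_raiseP ?_ fun τ₄ hf₄ hτ₄ => ?_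
    · rw [hval]
      exact fitsWord_natCast ((Problem.enc_lt' fun i => hv'.alloc.le_top i).trans hroom.enc)
    · rw [hτ₄, hval, hidx, hf₃ _ (by simp), hf₂ _ (by simp), hf₁ _ (by simp)]
  all_goals rw [hL₂, eval_cell, eval_zero, hloc₂.g_eq] at h1
  all_goals try rw [hthr, eval_add, eval_cell, eval_zero, eval_one, hloc₂.j_eq] at h2
  · have hs₃ : (var vState + (var vJ + 1 - eThr) * var vZ).eval τ₂ =
        V.idx (q + V.un j g) (Problem.Scaling.nextC D g j c) (r + 1) := by
      rw [eval_add, eval_mul, eval_sub, hthr]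
      simp only [eval_add, eval_cell, eval_zero, eval_one, hloc₂.j_eq, hctx₂.Z_eq, hτ₂]
      unfold Problem.Scaling.nextC Problem.Scaling.idx
      rw [if_pos (by omega), max_eq_right (by omega)]
      push_cast
      ring
    rw [hs₃]
    exact hsize _ le_rfl
  · have hs₃ : (var vState + (var vJ + 1 - eThr) * var vZ).eval τ₂ =
        V.idx (q + V.un j g) (Problem.Scaling.nextC D g j c) (r + 1) := by
      rw [eval_add, eval_mul, eval_sub, hthr]
      simp only [eval_add, eval_cell, eval_zero, eval_one, hloc₂.j_eq, hctx₂.Z_eq, hτ₂]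
      unfold Problem.Scaling.nextC Problem.Scaling.idx
      rw [if_pos (by omega), max_eq_right (by omega)]
      push_cast
      ring
    rw [hτ₃, hs₃]
  · rw [hτ₂]
    unfold Problem.Scaling.nextC
    rw [if_pos (by omega), max_eq_left (by omega)]
  · rw [hτ₂]
    unfold Problem.Scaling.nextC
    rw [if_neg (by omega)]

theorem eval_eDigit (hctx : Ctx V a b σ) (hjσ : σ vJ 0 = j) (hj : j < D.m)
    (htop : ∀ i, x i ≤ D.top) (hE : σ vEntry 0 = D.enc x) : eDigit.eval σ = x j := by
  simp only [eval_sub, eval_div, eval_mul, eval_add, eval_cell, eval_zero, eval_one, eval_two,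
    hjσ, hE, hctx.top_eq]
  have h1 := hctx.pow_eq (j + 1) (by omega)
  have h2 := hctx.pow_eq (j + 2) (by omega)
  have h3 := congrArg (Nat.cast (R := ℤ)) (Problem.enc_digit htop hj)
  have h4 : (D.base : ℤ) = D.top + 2 := by simp [Problem.base]
  push_cast at h1 h2 h3
  rw [h1, h2, h3, ← h4]
  ring

theorem runs_pickP (hroom : Room V a b W) (hctx : Ctx V a b σ) (hloc : Loc g j t n σ)
    (hj : j < D.m) (hv : V.Valid g j q c r x) (hn : n = V.idx q c r)
    (hE : σ vEntry 0 = D.enc x) :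
    Runs W pickP pickP.bd σ fun τ =>
      (¬ Problem.Scaling.CanPick D g j r x ∧ τ aTable = σ aTable) ∨
      (Problem.Scaling.CanPick D g j r x ∧
        τ aTable = raise (σ aTable) (((t + 1 : ℕ) : ℤ) * V.size +
          V.idx (q + V.un j g) (Problem.Scaling.nextC D g j c) (r + 1))
          (D.enc (Function.update x j g))) := by
  have htop : ∀ i, x i ≤ D.top := fun i => hv.alloc.le_top i
  have hL : eL.eval σ = D.L j := by
    simp only [eval_cell, eval_zero, hloc.j_eq]; exact hctx.L_eq j hj
  have hU : eU.eval σ = D.U j := by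
    simp only [eval_cell, eval_zero, hloc.j_eq]; exact hctx.U_eq j hj
  have hdig := eval_eDigit hctx hloc.j_eq hj htop hE
  have hg : (var vG).eval σ = g := hloc.g_eq
  unfold pickP
  refine Runs.ifLt (fun h => Runs.skip (Or.inl ⟨?_, rfl⟩)) fun h1 =>
    Runs.ifLt (fun h => Runs.skip (Or.inl ⟨?_, rfl⟩)) fun h2 =>
    Runs.ifLt (fun h => Runs.skip (Or.inl ⟨?_, rfl⟩)) fun h3 =>
    Runs.ifLt (fun h => Runs.skip (Or.inl ⟨?_, rfl⟩)) fun h4 => ?_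
  · rw [hL, hg] at h
    exact fun hp => by have := hp.2.1; omega
  · rw [hU, hg] at h
    exact fun hp => by have := hp.2.2.1; omega
  all_goals
    rw [hL, hg] at h1
    rw [hU, hg] at h2
  · intro hp
    have hr := hv.r_succ_le hj hp.1
    have hF := hp.2.2.2
    have htot := hv.alloc.total_le
    simp only [eval_sub, eval_add, eval_mul, eval_div, eval_cell, eval_zero, eval_one, hloc.n_eq,
      hctx.Z_eq, hctx.m_eq, hE, hloc.g_eq, hn] at h
    rw [idx_div hv.r_lt] at h
    have e1 : ((V.idx q c r : ℕ) : ℤ) - ((q * V.Z + c : ℕ) : ℤ) * V.Z + 1 = ((r + 1 : ℕ) : ℤ) := by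
      unfold Problem.Scaling.idx; push_cast; ring
    have e2 := hctx.pow_eq (D.m + 1) le_rfl
    push_cast at e2
    rw [e1, hctx.F_eq _ hr, hctx.F_eq _ le_rfl, e2, ← Nat.cast_pow, ← Int.natCast_div,
      Problem.enc_div_top htop] at h
    omega
  · rw [hdig, eval_zero] at h
    exact fun hp => by have := hp.1; omega
  · rw [hdig, eval_zero] at h4
    have hx0 : x j = 0 := by omega
    have hr := hv.r_succ_le hj hx0
    have htot := hv.alloc.total_le
    simp only [eval_sub, eval_add, eval_mul, eval_div, eval_cell, eval_zero, eval_one, hloc.n_eq,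
      hctx.Z_eq, hctx.m_eq, hE, hloc.g_eq, hn] at h3
    rw [idx_div hv.r_lt] at h3
    have e1 : ((V.idx q c r : ℕ) : ℤ) - ((q * V.Z + c : ℕ) : ℤ) * V.Z + 1 = ((r + 1 : ℕ) : ℤ) := by
      unfold Problem.Scaling.idx; push_cast; ring
    have e2 := hctx.pow_eq (D.m + 1) le_rfl
    push_cast at e2
    rw [e1, hctx.F_eq _ hr, hctx.F_eq _ le_rfl, e2, ← Nat.cast_pow, ← Int.natCast_div,
      Problem.enc_div_top htop] at h3
    have hp : Problem.Scaling.CanPick D g j r x := ⟨hx0, by omega, by omega, by omega⟩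
    exact (runs_takeP hroom hctx hloc hj hv hn hE hp).mono le_rfl fun τ hτ => Or.inr ⟨hp, hτ⟩

theorem runs_entryP (hroom : Room V a b W) (hctx : Ctx V a b σ) (hloc : Loc g j t n σ)
    (hj : j < D.m) (hn : n < V.size) (hA : V.Sound g j A)
    (hinv : V.TableInv g j t A n (σ aTable)) :
    Runs W entryP entryP.bd σ fun τ => V.TableInv g j t A (n + 1) (τ aTable) := by
  have hread : (cell aTable (var vT * eSize + var vN)).eval σ = A n := by
    rw [← hinv.layer_eq n hn]
    simp only [eval_cell, eval_add, eval_mul, eval_zero, hloc.t_eq, hloc.n_eq, hctx.Z_eq]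
    unfold Problem.Scaling.layer Problem.Scaling.size
    push_cast
    rfl
  unfold entryP
  refine Runs.seq (Runs.assign (fun hb => hb _ _) fun τ₁ hf₁ hτ₁ => ?_)
  rw [hread] at hτ₁
  have hctx₁ := hctx.congr fun c hc => hf₁ c (by rintro rfl; simp [ctxArrays] at hc)
  have hloc₁ := hloc.congr fun c hc => hf₁ c (by rintro rfl; simp at hc)
  have hE : (var vEntry).eval τ₁ = A n := hτ₁
  rw [← hf₁ aTable (by simp)] at hinv
  refine Runs.ifLt (fun hpos => ?_) fun hpos => Runs.skip ?_
  · rw [hE, eval_zero] at hpos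
    obtain ⟨q, c, r, x, hv, hidx, henc⟩ := hA n hn hpos.ne'
    have hk : ((var vT + 1) * eSize + var vN).eval τ₁ =
        ((t + 1 : ℕ) : ℤ) * V.size + V.idx q c r := by
      simp only [eval_add, eval_mul, eval_cell, eval_zero, eval_one, hloc₁.t_eq, hctx₁.Z_eq,
        hloc₁.n_eq, hidx]
      unfold Problem.Scaling.size
      push_cast
      ring
    refine Runs.seq (runs_raiseP ?_ fun τ₂ hf₂ hτ₂ => ?_)
    · rw [hE, henc]
      exact fitsWord_natCast ((Problem.enc_lt' fun i => hv.alloc.le_top i).trans hroom.enc)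
    · rw [hk, hE, henc] at hτ₂
      have hinv₂ := hinv.raise hv.succ
      rw [← hτ₂] at hinv₂
      have hself : (D.enc x : ℤ) ≤ V.layer (t + 1) (τ₂ aTable) n := by
        rw [hτ₂, Problem.Scaling.layer_raise, ← hidx]
        exact le_raise_self _ _ _
      refine (runs_pickP hroom (hctx₁.congr fun c hc => hf₂ c ?_) (hloc₁.congr fun c hc => hf₂ c ?_)
        hj hv hidx ?_).mono le_rfl ?_
      · rintro rfl; simp [ctxArrays] at hc
      · rintro rfl; simp at hc
      · rw [hf₂ _ (by simp), hτ₁, henc]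
      · rintro τ₃ (⟨hnp, hτ₃⟩ | ⟨hp, hτ₃⟩)
        · rw [hτ₃]
          exact hinv₂.succ hv hidx henc hself fun hp => absurd hp hnp
        · have hinv₃ := hinv₂.raise (hv.pick hj hp)
          rw [← hτ₃] at hinv₃
          refine hinv₃.succ hv hidx henc ?_ fun _ => ?_
          · refine hself.trans ?_
            rw [hτ₃, Problem.Scaling.layer_raise]
            exact le_raise _ _ _ _
          · rw [hτ₃, Problem.Scaling.layer_raise]
            exact le_raise_self _ _ _
  · rw [hE, eval_zero] at hpos
    refine hinv.succ_of_eq_zero ?_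
    by_contra hne
    obtain ⟨q, c, r, x, -, -, henc⟩ := hA n hn hne
    have := Problem.enc_pos (D := D) x
    omega

end entry

section loops

variable {g j t n : ℕ} {y : ℕ → ℕ} {σ : Mem}

/-- The state of the table before class `j` is treated at level `g`: layer `t` is complete with
respect to `y`, and the layers behind it are empty. -/
structure LayerInv (V : D.Scaling) (y : ℕ → ℕ) (g j t : ℕ) (f : ℤ → ℤ) : Prop where
  sound : V.Sound g j (V.layer t f)
  dom : V.Dominates (V.layer t f) (Problem.Scaling.restrict y g j)
  zero : ∀ k : ℤ, ((t + 1 : ℕ) : ℤ) * V.size ≤ k → f k = 0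

theorem LayerInv.tableInv {f : ℤ → ℤ} (h : LayerInv V y g j t f) :
    V.TableInv g j t (V.layer t f) 0 f := by
  refine ⟨fun _ _ => rfl, fun n _ hne => absurd (h.zero _ ?_) hne, fun _ _ _ _ _ hi => ?_,
    fun k hk => h.zero k (le_trans ?_ hk)⟩
  · omega
  · exact absurd hi (Nat.not_lt_zero _)
  · exact mul_le_mul_of_nonneg_right (by push_cast; omega) (Int.natCast_nonneg _)

theorem LayerInv.succ (hy : D.IsAlloc y) (hex : D.Exch y) (hj : j < D.m) (hg : 0 < g)
    {f f' : ℤ → ℤ} (h : LayerInv V y g j t f) (h' : V.TableInv g j t (V.layer t f) V.size f') :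
    LayerInv V y g (j + 1) (t + 1) f' :=
  ⟨h'.sound, h.dom.step hy hex hj hg h.sound h'.closed, h'.zero⟩

/-- A bound on the number of steps of `levelP`. -/
def levelCost (m s : ℕ) : ℕ := forCost m (forCost s entryP.bd eSize.cost + 6) eM.cost

theorem runs_levelP (hroom : Room V a b W) (hctx : Ctx V a b σ) (hy : D.IsAlloc y)
    (hex : D.Exch y) (hg : 0 < g) (hgσ : σ vG 0 = g) (htσ : σ vT 0 = t) (ht : t + D.m < 2 ^ W)
    (h : LayerInv V y g 0 t (σ aTable)) :
    Runs W levelP (levelCost D.m V.size) σ fun τ =>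
      τ vT 0 = (t + D.m : ℕ) ∧ LayerInv V y g D.m (t + D.m) (τ aTable) := by
  unfold levelP levelCost
  refine (Runs.forLt (n := D.m)
    (Inv := fun j τ => τ vT 0 = (t + j : ℕ) ∧ LayerInv V y g j (t + j) (τ aTable))
    (by decide) hroom.m_lt ?_ ?_ ?_).mono le_rfl fun τ hτ => hτ.2
  · intro τ hτ
    rw [eval_cell, eval_zero, hτ 0 (by decide), hctx.m_eq]
  · simpa using ⟨htσ, h⟩
  · rintro j τ hj hf hjτ ⟨htτ, hinv⟩
    have hctxτ := hctx.congr fun c hc => hf c (by revert c hc; decide)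
    have hgτ : τ vG 0 = g := by rw [hf vG (by decide), hgσ]
    refine Runs.seq ((Runs.forLt (n := V.size) (T := entryP.bd)
      (Inv := fun n τ' => V.TableInv g j (t + j) (V.layer (t + j) (τ aTable)) n (τ' aTable))
      (by decide) hroom.size ?_ ?_ ?_).frame.mono le_rfl ?_)
    · intro τ' hf'
      simp only [eval_mul, eval_cell, eval_zero, hf' vZ (by decide), hctxτ.Z_eq]
      unfold Problem.Scaling.size
      push_cast
      rfl
    · simpa using hinv.tableInv
    · intro n τ' hn hf' hnτ' hinv'
      have hctxτ' := hctxτ.congr fun c hc => hf' c (by revert c hc; decide)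
      have hloc : Loc g j (t + j) n τ' := ⟨by rw [hf' vG (by decide), hgτ],
        by rw [hf' vJ (by decide), hjτ], by rw [hf' vT (by decide), htτ], hnτ'⟩
      refine (runs_entryP hroom hctxτ' hloc hj hn hinv.sound hinv').mono le_rfl fun τ'' h'' => ?_
      simpa using h''
    · rintro τ' ⟨hf', -, hinv'⟩
      have htτ' : (var vT + 1).eval τ' = (t + (j + 1) : ℕ) := by
        rw [eval_add, eval_cell, eval_zero, hf' vT (by decide), htτ, eval_one]
        push_cast; ring
      refine Runs.assign (fun _ => ?_) fun τ'' hf'' ht'' => ?_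
      · rw [htτ']; exact fitsWord_natCast (by omega)
      · refine ⟨?_, ?_⟩
        · rw [Mem.write_of_ne _ (by decide), ht'', htτ']
        · rw [Mem.write_of_ne _ (by decide), hf'' _ (by decide)]
          exact hinv.succ hy hex hj hg hinv'

theorem runs_bumpP {v : Expr} {c d : ℕ} (hg : σ vG 0 = g) (hc : σ vNext 0 = c)
    (hv : v.eval σ = d) (hW : g < 2 ^ W) :
    Runs W (bumpP v) (bumpP v).bd σ fun τ => τ vNext 0 = Problem.bump g c d := by
  have h1 : (var vNext).eval σ = c := hc
  have h2 : (var vG).eval σ = g := hg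
  unfold bumpP Problem.bump
  refine Runs.ifLt (fun h => Runs.ifLt (fun h' => Runs.assign (fun _ => ?_) fun τ _ hτ => ?_)
    fun h' => Runs.skip ?_) fun h => Runs.skip ?_
  all_goals rw [h1, hv] at h
  all_goals try rw [h2, hv] at h'
  · rw [hv]; exact fitsWord_natCast (by omega)
  · rw [hτ, hv, if_pos (by omega)]
  · rw [hc, if_neg (by omega)]
  · rw [hc, if_neg (by omega)]

/-- A bound on the number of steps of `nextP`. -/
def nextCost (m : ℕ) : ℕ :=
  3 + ((Expr.cost 0 + eGeom.cost + 1 + max (assign vNext eGeom).bd 1) +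
    (forCost m ((bumpP eL).bd + (bumpP eU).bd) eM.cost + (assign vG (var vNext)).bd))

theorem runs_nextP (hroom : Room V a b W) (hctx : Ctx V a b σ) (hg : 0 < g) (hgtop : g ≤ D.top)
    (hgσ : σ vG 0 = g) :
    Runs W nextP (nextCost D.m) σ fun τ => τ vG 0 = D.nextUpTo a b g D.m := by
  have hgeom : ∀ τ : Mem, (∀ c, c ≠ vNext → τ c = σ c) →
      (Problem.geom a b g : ℤ) = max 0 (eGeom.eval τ) := by
    intro τ hτ
    have e1 : ((a * (g - 1) / (2 * b) : ℕ) : ℤ) = a * ((g : ℤ) - 1) / (2 * b) := by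
      push_cast [Nat.cast_sub hg]; rfl
    simp only [eval_sub, eval_div, eval_mul, eval_cell, eval_zero, eval_one, eval_two, eval_three,
      hτ _ (show vG ≠ vNext by decide), hτ _ (show 0 ≠ vNext by decide), hgσ, hctx.num_eq,
      hctx.den_eq, ← e1]
    unfold Problem.geom
    omega
  have hlt : ∀ k, D.nextUpTo a b g k < 2 ^ W := fun k =>
    ((Problem.nextUpTo_lt hg k).trans_le hgtop).trans hroom.top
  have hgW : g < 2 ^ W := hgtop.trans_lt hroom.top
  unfold nextP nextCost
  refine Runs.seq (Runs.assign (fun _ => by simp [FitsWord]) fun τ₁ hf₁ hτ₁ => ?_)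
  rw [eval_zero] at hτ₁
  refine Runs.seq (Runs.mono (post := fun τ => (∀ c, c ≠ vNext → τ c = σ c) ∧
    τ vNext 0 = Problem.geom a b g) (Runs.ifLt (fun h => Runs.assign (fun _ => ?_)
      fun τ₂ hf₂ hτ₂ => ⟨fun c hc => by rw [hf₂ c hc, hf₁ c hc], ?_⟩)
      fun h => Runs.skip ⟨hf₁, ?_⟩) le_rfl ?_)
  · have := hgeom τ₁ hf₁
    rw [eval_zero] at h
    rw [max_eq_right h.le] at this
    rw [← this]
    exact fitsWord_natCast (hlt 0)
  · have := hgeom τ₁ hf₁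
    rw [eval_zero] at h
    rw [max_eq_right h.le] at this
    rw [hτ₂, this]
  · have := hgeom τ₁ hf₁
    rw [eval_zero, not_lt] at h
    rw [max_eq_left h] at this
    rw [hτ₁, this]
  rintro τ₂ ⟨hf₂, hτ₂⟩
  have hctx₂ := hctx.congr fun c hc => hf₂ c (by revert c hc; decide)
  have hgτ₂ : τ₂ vG 0 = g := by rw [hf₂ _ (by decide), hgσ]
  refine Runs.seq ((Runs.forLt (n := D.m)
    (Inv := fun k τ => τ vNext 0 = D.nextUpTo a b g k) (by decide) hroom.m_lt ?_ ?_ ?_).mono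
    le_rfl ?_)
  · intro τ hτ
    rw [eval_cell, eval_zero, hτ 0 (by decide), hctx₂.m_eq]
  · rw [Mem.write_of_ne _ (by decide), hτ₂]; rfl
  · intro k τ hk hf hkτ hinv
    have hctxτ := hctx₂.congr fun c hc => hf c (by revert c hc; decide)
    have hgτ : τ vG 0 = g := by rw [hf vG (by decide), hgτ₂]
    refine Runs.seq ((runs_bumpP (d := D.L k) hgτ hinv ?_ hgW).frame.mono le_rfl ?_)
    · simp only [eval_cell, eval_zero, hkτ]
      exact hctxτ.L_eq k hk
    · rintro τ' ⟨hf', hτ'⟩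
      refine (runs_bumpP (g := g) (c := Problem.bump g (D.nextUpTo a b g k) (D.L k))
        (d := D.U k) ?_ hτ' ?_ hgW).mono le_rfl ?_
      · rw [hf' vG (by decide), hgτ]
      · simp only [eval_cell, eval_zero, hf' vJ (by decide), hf' aOrd (by decide),
          hf' 3 (by decide), hkτ]
        exact hctxτ.U_eq k hk
      · intro τ'' h''
        rw [Mem.write_of_ne _ (by decide), h'']
        rfl
  · rintro τ₃ ⟨-, hτ₃⟩
    refine Runs.assign (fun hb => ?_) fun τ₄ _ hτ₄ => ?_
    · rw [eval_cell]; exact hb _ _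
    · rw [hτ₄, eval_cell, eval_zero, hτ₃]

/-- A bound on the number of steps of `dpP`. -/
def dpCost (l m s : ℕ) : ℕ := l * (levelCost m s + nextCost m + 10) + 50

theorem runs_dpP (hroom : Room V a b W) (hctx : Ctx V a b σ) (hy : D.IsAlloc y)
    (hex : D.Exch y) (hlev : ∀ i, ∃ k, D.lev a b k = y i) (htσ : σ vT 0 = 0)
    (hzero : ∀ k, σ aTable k = 0) :
    Runs W dpP (dpCost (D.numLev a b) D.m V.size) σ fun τ => Ctx V a b τ ∧ ∃ t : ℕ,
      τ vT 0 = t ∧ LayerInv V y 0 0 t (τ aTable) := by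
  have henc0 : (1 + cell aPrefix eM * cell aPow (eM + 1)).eval σ = D.enc 0 := by
    simp only [eval_add, eval_mul, eval_cell, eval_zero, eval_one, hctx.m_eq]
    have h1 := hctx.pow_eq (D.m + 1) le_rfl
    push_cast at h1
    rw [h1, hctx.F_eq _ le_rfl]
    simp [Problem.enc, Problem.total]
  unfold dpP
  refine Runs.mono (T := _ + (_ + (D.numLev a b * (levelCost D.m V.size + nextCost D.m +
    Expr.cost 0 + (var vG).cost + 1) + Expr.cost 0 + (var vG).cost + 1)))
    (Runs.seq (Runs.store (fun _ => ?_) (Runs.seq (Runs.assign (fun hb => ?_)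
    fun τ₁ hf₁ hτ₁ => ?_)))) ?_ fun _ h => h
  · rw [henc0]
    exact fitsWord_natCast ((Problem.enc_lt' fun i => Nat.zero_le _).trans hroom.enc)
  · rw [eval_cell]; exact hb _ _
  rw [eval_zero, henc0] at hf₁
  have hf₁' : ∀ c, c ≠ vG → c ≠ aTable → τ₁ c = σ c := fun c hc hc' => by
    rw [hf₁ c hc, Mem.write_of_ne _ hc']
  have hctx₁ := hctx.congr fun c hc => hf₁' c (by revert c hc; decide) (by revert c hc; decide)
  have htab : ∀ k, τ₁ aTable k = if k = 0 then (D.enc 0 : ℤ) else 0 := by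
    intro k
    rw [hf₁ _ (by decide), Mem.write_same, Function.update_apply, hzero]
  have htop : τ₁ vG 0 = D.top := by
    rw [hτ₁, eval_cell, eval_zero, eval_zero, Mem.write_of_ne _ (by decide), hctx.top_eq]
  have hsize : 0 < V.size := by
    have := V.m_lt
    unfold Problem.Scaling.size
    have : 0 < V.Z := by omega
    positivity
  refine (Runs.whileLt (n := D.numLev a b) (Inv := fun k τ => Ctx V a b τ ∧
    τ vG 0 = D.lev a b k ∧ τ vT 0 = (k * D.m : ℕ) ∧
    LayerInv V y (D.lev a b k) 0 (k * D.m) (τ aTable)) ?_ ?_ ?_ ?_).mono le_rfl ?_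
  · refine ⟨hctx₁, htop, ?_, ⟨fun n hn hne => ?_, ?_, fun k hk => ?_⟩⟩
    · rw [hf₁' _ (by decide) (by decide), htσ]; simp
    · have h0 : V.layer (0 * D.m) (τ₁ aTable) n = if n = 0 then (D.enc 0 : ℤ) else 0 := by
        simp only [Problem.Scaling.layer, htab]
        simp
      rw [h0] at hne ⊢
      split_ifs at hne ⊢ with hn0
      · exact ⟨0, 0, 0, 0, Problem.Scaling.valid_zero _, by simp [hn0, Problem.Scaling.idx], rfl⟩
      · exact absurd rfl hne
    · refine Problem.Scaling.Dominates.zero hy ?_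
      simp [Problem.Scaling.layer, htab]
    · rw [htab, if_neg]
      have : (0 : ℤ) < V.size := by exact_mod_cast hsize
      push_cast at hk
      simp only [zero_mul, zero_add, one_mul] at hk
      omega
  · rintro k τ hk ⟨-, hgτ, -⟩
    rw [eval_zero, eval_cell, eval_zero, hgτ]
    exact_mod_cast Problem.lev_pos hk
  · rintro τ ⟨-, hgτ, -⟩
    rw [eval_zero, eval_cell, eval_zero, hgτ, Problem.lev_numLev]
    simp
  · rintro k τ hk ⟨hctxτ, hgτ, htτ, hinv⟩
    have hpos := Problem.lev_pos hk
    have hsteps : k * D.m + D.m ≤ D.numLev a b * D.m := by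
      rw [← Nat.succ_mul]; exact Nat.mul_le_mul_right _ hk
    refine Runs.seq ((runs_levelP hroom hctxτ hy hex hpos hgτ htτ
      (hsteps.trans_lt hroom.steps) hinv).frame.mono le_rfl ?_)
    rintro τ' ⟨hf', htτ', hinv'⟩
    have hctxτ' := hctxτ.congr fun c hc => hf' c (by revert c hc; decide)
    refine (runs_nextP hroom hctxτ' hpos (Problem.lev_antitone (Nat.zero_le k)) ?_).frame.mono
      le_rfl ?_
    · rw [hf' vG (by decide), hgτ]
    rintro τ'' ⟨hf'', hgτ''⟩
    have hlt := Problem.lev_succ_lt hpos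
    have hsucc : (k + 1) * D.m = k * D.m + D.m := Nat.succ_mul _ _
    refine ⟨hctxτ'.congr fun c hc => hf'' c (by revert c hc; decide), hgτ'', ?_, ?_⟩
    · rw [hf'' vT (by decide), htτ', hsucc]
    · rw [hf'' aTable (by decide), hsucc]
      refine ⟨hinv'.sound.next_level hlt, hinv'.dom.next_level hy hlt fun i => ?_, hinv'.zero⟩
      obtain ⟨l, hl⟩ := hlev i
      rw [← hl]
      rcases Nat.lt_or_ge k l with h | h
      · exact Or.inl (Problem.lev_antitone h)
      · exact Or.inr (Problem.lev_antitone h)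
  · rintro τ ⟨h1, -, h2, h3⟩
    rw [Problem.lev_numLev] at h3
    exact ⟨h1, _, h2, h3⟩
  · have h1 : Expr.cost 0 = 1 := rfl
    have h2 : (var vG).cost = 2 := rfl
    have h3 : (store aTable 0 (1 + cell aPrefix eM * cell aPow (eM + 1))).bd = 13 := rfl
    have h4 : (assign vG eTop).bd = 4 := rfl
    unfold dpCost
    rw [h1, h2, h3, h4]
    nlinarith

/-- A bound on the number of steps of `outputP`. -/
def outputCost (m s : ℕ) : ℕ :=
  forCost s (ifLt 0 (cell aTable (var vT * eSize + var vN))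
    (assign vEntry (cell aTable (var vT * eSize + var vN))) skip).bd eSize.cost +
  forCost m (store 6 eCls eDigit).bd eM.cost

theorem runs_outputP (hroom : Room V a b W) (hctx : Ctx V a b σ) (hy : D.IsAlloc y)
    (htσ : σ vT 0 = t) (h : LayerInv V y 0 0 t (σ aTable))
    (hinj : ∀ i j : ℕ, i < D.m → j < D.m → σ aOrd i = σ aOrd j → i = j) :
    Runs W outputP (outputCost D.m V.size) σ fun τ => ∃ x, D.IsAlloc x ∧ V.units y ≤ V.units x ∧
      ∀ j : ℕ, j < D.m → τ 6 (σ aOrd j) = x j := by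
  set A := V.layer t (σ aTable) with hAdef
  have hdom : V.Dominates A (Problem.Scaling.restrict y 0 0) := h.dom
  obtain ⟨n₀, hn₀, hle₀, hpos₀⟩ := hdom.exists_entry hy
  unfold outputP outputCost
  refine Runs.seq ((Runs.forLt (n := V.size) (Inv := fun n τ => n₀ < n → ∃ i, n₀ ≤ i ∧ i < V.size ∧
    0 < A i ∧ τ vEntry 0 = A i) (by decide) hroom.size ?_ ?_ ?_).mono le_rfl ?_)
  · intro τ hf
    simp only [eval_mul, eval_cell, eval_zero, hf vZ (by decide), hctx.Z_eq]
    unfold Problem.Scaling.size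
    push_cast
    rfl
  · intro hlt; omega
  · intro n τ hn hf hnτ hinv
    have hread : (cell aTable (var vT * eSize + var vN)).eval τ = A n := by
      simp only [eval_cell, eval_add, eval_mul, eval_zero, hf vT (by decide), hf vZ (by decide),
        hf aTable (by decide), htσ, hnτ, hctx.Z_eq, hAdef]
      unfold Problem.Scaling.layer Problem.Scaling.size
      push_cast
      rfl
    refine Runs.ifLt (fun hpos => Runs.assign (fun hb => hb _ _) fun τ' hf' hτ' => ?_)
      fun hpos => Runs.skip ?_
    all_goals rw [hread, eval_zero] at hpos
    · intro hlt
      refine ⟨n, by omega, hn, hpos, ?_⟩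
      rw [Mem.write_of_ne _ (by decide), hτ', hread]
    · intro hlt
      rw [Mem.write_of_ne _ (by decide)]
      refine hinv (lt_of_le_of_ne (by omega) ?_)
      rintro rfl
      exact hpos hpos₀
  · rintro τ ⟨hf, hinv⟩
    obtain ⟨i, hi₀, hi, hposi, hτi⟩ := hinv hn₀
    obtain ⟨q, c, r, x, hv, hidx, henc⟩ := h.sound i hi hposi.ne'
    have hctxτ := hctx.congr fun c hc => hf c (by revert c hc; decide)
    have hunits : V.units y ≤ V.units x := by
      rw [hv.units_eq]
      by_contra hlt
      have h1 : (q + 1) * V.Z * V.Z ≤ V.units y * V.Z * V.Z :=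
        Nat.mul_le_mul_right _ (Nat.mul_le_mul_right _ (by omega))
      have h2 : V.idx q c r < (q + 1) * V.Z * V.Z := by
        have := hv.c_lt
        have := hv.r_lt
        unfold Problem.Scaling.idx
        have h3 : (q * V.Z + c + 1) * V.Z ≤ (q + 1) * V.Z * V.Z :=
          Nat.mul_le_mul_right _ (by nlinarith)
        nlinarith
      omega
    refine (Runs.forLt (n := D.m) (Inv := fun j τ' => ∀ i : ℕ, i < j → τ' 6 (σ aOrd i) = x i)
      (by decide) hroom.m_lt ?_ ?_ ?_).mono le_rfl ?_
    · intro τ' hf'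
      rw [eval_cell, eval_zero, hf' 0 (by decide), hctxτ.m_eq]
    · intro i hi; omega
    · intro j τ' hj hf' hjτ' hinv'
      have hctxτ' := hctxτ.congr fun c hc => hf' c (by revert c hc; decide)
      have hdig := eval_eDigit (x := x) hctxτ' hjτ' hj (fun i => hv.alloc.le_top i)
        (by rw [hf' vEntry (by decide), hτi]; exact henc)
      refine Runs.store (fun _ => ?_) ?_
      · rw [hdig]
        exact fitsWord_natCast ((hv.alloc.le_top j).trans_lt hroom.top)
      · intro i hi
        have hcls : eCls.eval τ' = σ aOrd j := by
          rw [eval_cell, eval_cell, eval_zero, hjτ', hf' aOrd (by decide), hf aOrd (by decide)]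
        rw [Mem.write_of_ne _ (by decide), Mem.write_same, Function.update_apply, hcls, hdig]
        split_ifs with heq
        · rw [hinj i j (by omega) hj heq]
        · refine hinv' i ?_
          rcases Nat.lt_succ_iff_lt_or_eq.mp hi with h' | rfl
          · exact h'
          · exact absurd rfl heq
    · rintro τ' ⟨-, hτ'⟩
      exact ⟨x, hv.alloc, hunits, hτ'⟩

end loops

end DP

/-! ### Correctness of the preprocessing -/

section Preprocessing

variable {W M : ℕ} {σ : Mem}

/-- Class `j` stands before class `i` in the order by profits, where the classes with the same
profit are ordered by their numbers. As `i` and `j` are less than `M`, they only matter if the cross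
products of the profits agree. -/
def Before (M : ℕ) (σ : Mem) (j i : ℕ) : Prop :=
  σ 4 i * σ 5 j * M + j < σ 4 j * σ 5 i * M + i

instance (M : ℕ) (σ : Mem) (j i : ℕ) : Decidable (Before M σ j i) := by
  unfold Before; infer_instance

/-- The position of class `i` in the order by profits. -/
def rank (M : ℕ) (σ : Mem) (i : ℕ) : ℕ := ((Finset.range M).filter (Before M σ · i)).card

/-- The upper bound of class `i` that is used by the algorithm. -/
def cap (σ : Mem) (i : ℕ) : ℤ := if 0 < σ 4 i then min (σ 3 i) (σ 1 0) else 0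

/-- A bound on the number of steps of `sortP`. -/
def sortCost (M : ℕ) : ℕ := forCost M (forCost M 100 eM.cost + 100) eM.cost

theorem runs_sortP (hM : σ 0 0 = M) (hW : M < 2 ^ W)
    (hinj : ∀ i j, i < M → j < M → rank M σ i = rank M σ j → i = j) :
    Runs W sortP (sortCost M) σ fun τ =>
      (∀ i : ℕ, i < M → τ aOrd (rank M σ i) = i) ∧ ∀ i : ℕ, i < M → τ 3 i = cap σ i := by
  unfold sortP sortCost
  refine (Runs.forLt (n := M) (Inv := fun k τ => (∀ i : ℕ, i < k → τ aOrd (rank M σ i) = i) ∧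
    ∀ i : ℕ, τ 3 i = if i < k then cap σ i else σ 3 i) (by decide) hW ?_ ?_ ?_).mono le_rfl ?_
  · intro τ hf
    rw [eval_cell, eval_zero, hf 0 (by decide), hM]
  · refine ⟨fun i hi => absurd hi (Nat.not_lt_zero _), fun i => ?_⟩
    rw [Mem.write_of_ne _ (by decide), if_neg (Nat.not_lt_zero _)]
  · rintro k τ hk hf hkτ ⟨hord, hcap⟩
    refine Runs.mono (T := 3 + (forCost M 100 eM.cost + placeP.bd)) (Runs.seq
      (Runs.assign (fun _ => by simp [FitsWord]) fun τ₁ hf₁ hτ₁ =>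
      Runs.seq ((Runs.forLt (n := M) (T := 100)
      (Inv := fun j τ' => τ' vCnt 0 = (((Finset.range j).filter (Before M σ · k)).card : ℕ))
      (by decide) hW ?_ ?_ ?_).mono le_rfl ?_))) ?_ fun _ h => h
    · intro τ' hf'
      rw [eval_cell, eval_zero, hf' 0 (by decide), hf₁ 0 (by decide), hf 0 (by decide), hM]
    · rw [Mem.write_of_ne _ (by decide), hτ₁]; rfl
    · intro j τ' hj hf' hjτ' hinv
      have hsame : ∀ c ∈ [0, 4, 5], τ' c = σ c := by
        intro c hc
        rw [hf' c (by revert c hc; decide), hf₁ c (by revert c hc; decide),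
          hf c (by revert c hc; decide)]
      have hkτ' : τ' vI 0 = k := by rw [hf' _ (by decide), hf₁ _ (by decide), hkτ]
      have hcond : (cell 4 (var vI) * cell 5 (var vJ) * eM + var vJ).eval τ' <
          (cell 4 (var vJ) * cell 5 (var vI) * eM + var vI).eval τ' ↔ Before M σ j k := by
        simp only [eval_add, eval_mul, eval_cell, eval_zero, hkτ', hjτ', hsame 0 (by decide),
          hsame 4 (by decide), hsame 5 (by decide), hM]
        rfl
      have hcard : ((Finset.range (j + 1)).filter (Before M σ · k)).card =
          ((Finset.range j).filter (Before M σ · k)).card + if Before M σ j k then 1 else 0 := by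
        rw [Finset.card_filter, Finset.card_filter, Finset.sum_range_succ]
      have hle : ((Finset.range (j + 1)).filter (Before M σ · k)).card ≤ M :=
        (Finset.card_filter_le _ _).trans (by rw [Finset.card_range]; omega)
      refine Runs.mono (Runs.ifLt (fun h => Runs.assign (fun _ => ?_) fun τ'' _ hτ'' => ?_)
        fun h => Runs.skip ?_) (by decide) fun _ h => h
      all_goals rw [hcond] at h
      · rw [if_pos h] at hcard
        rw [eval_add, eval_cell, eval_zero, hinv, eval_one]
        exact fitsWord_natCast (n := _ + 1) (by omega)
      · rw [if_pos h] at hcard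
        rw [Mem.write_of_ne _ (by decide), hτ'', eval_add, eval_cell, eval_zero, hinv, eval_one,
          hcard]
        push_cast; rfl
      · rw [if_neg h] at hcard
        rw [Mem.write_of_ne _ (by decide), hinv, hcard, add_zero]
    · rintro τ₂ ⟨hf₂, hcnt⟩
      have hf₂' : ∀ c ∈ [0, 1, 3, 4, 5, aOrd, vI], τ₂ c = τ c := by
        intro c hc
        rw [hf₂ c (by revert c hc; decide), hf₁ c (by revert c hc; decide)]
      have hk₂ : τ₂ vI 0 = k := by rw [hf₂' _ (by decide), hkτ]
      have hrank : τ₂ vCnt 0 = (rank M σ k : ℕ) := hcnt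
      unfold placeP
      refine Runs.seq (Runs.store (fun hb => hb _ _) ?_)
      rw [eval_cell, eval_cell, eval_zero, hrank, hk₂]
      set τ₃ := τ₂.write aOrd ((rank M σ k : ℕ) : ℤ) (k : ℤ) with hτ₃
      have hf₃ : ∀ c, c ≠ aOrd → τ₃ c = τ₂ c := fun c hc => Mem.write_of_ne _ hc _ _
      have hord₃ : ∀ i : ℕ, i < k + 1 → τ₃ aOrd (rank M σ i) = i := by
        intro i hi
        rw [hτ₃, Mem.write_same, Function.update_apply, hf₂' _ (by decide)]
        split_ifs with heq
        · rw [hinj i k (by omega) hk (by exact_mod_cast heq)]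
        · refine hord i (lt_of_le_of_ne (by omega) ?_)
          rintro rfl
          exact heq rfl
      have h4 : τ₃ 4 k = σ 4 k := by
        rw [hf₃ _ (by decide), hf₂' _ (by decide), hf 4 (by decide)]
      have h1 : τ₃ 1 0 = σ 1 0 := by
        rw [hf₃ _ (by decide), hf₂' _ (by decide), hf 1 (by decide)]
      have h3 : ∀ i : ℕ, τ₃ 3 i = if i < k then cap σ i else σ 3 i := by
        intro i
        rw [hf₃ _ (by decide), hf₂' _ (by decide), hcap]
      have hk₃ : τ₃ vI 0 = k := by rw [hf₃ _ (by decide), hk₂]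
      have h3k : τ₃ 3 k = σ 3 k := by rw [h3, if_neg (lt_irrefl _)]
      have hfin : ∀ v : ℤ, v = cap σ k → ∀ i : ℕ, Function.update (τ₃ 3) (k : ℤ) v i =
          if i < k + 1 then cap σ i else σ 3 i := by
        rintro v rfl i
        rw [Function.update_apply]
        rcases lt_trichotomy i k with h | rfl | h
        · rw [if_neg (by omega), if_pos (by omega), h3, if_pos h]
        · rw [if_pos rfl, if_pos (by omega)]
        · rw [if_neg (by omega), if_neg (by omega), h3, if_neg (by omega)]
      have hskip : τ₃ 3 k = cap σ k → ∀ i : ℕ, τ₃ 3 i =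
          if i < k + 1 then cap σ i else σ 3 i := by
        intro h i
        have := hfin (τ₃ 3 k) h i
        rwa [Function.update_eq_self] at this
      refine Runs.ifLt (fun h => Runs.ifLt (fun h' => Runs.store (fun hb => hb _ _) ?_)
        fun h' => Runs.skip ?_) fun h => Runs.store (fun _ => by simp [FitsWord]) ?_
      all_goals simp only [eval_cell, eval_zero, hk₃, h4] at h
      all_goals try simp only [eval_cell, eval_zero, hk₃, h1, h3k] at h'
      · refine ⟨hord₃, ?_⟩
        simp only [eval_cell, eval_zero, hk₃, h1]
        refine hfin _ ?_
        rw [cap, if_pos h, min_eq_right h'.le]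
      · refine ⟨hord₃, hskip ?_⟩
        rw [h3k, cap, if_pos h, min_eq_left (not_lt.mp h')]
      · refine ⟨hord₃, ?_⟩
        simp only [eval_cell, eval_zero, hk₃]
        refine hfin _ ?_
        rw [cap, if_neg h]
    · have : placeP.bd ≤ 90 := by decide
      omega
  · rintro τ ⟨-, h1, h2⟩
    exact ⟨h1, fun i hi => by rw [h2, if_pos hi]⟩

/-- A bound on the number of steps of `prefixP`. -/
def prefixCost (M : ℕ) : ℕ := 10 + forCost (M + 1) 100 (eM + 1 : Expr).cost

theorem runs_prefixP {N : ℕ → ℕ} (hM : σ 0 0 = M) (hN : ∀ i : ℕ, σ 1 i = N i)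
    (h0 : σ aPrefix 0 = 0) (hMW : M + 1 < 2 ^ W)
    (hNW : ∑ i ∈ Finset.range (M + 1), N i < 2 ^ W) (hpW : (N 0 + 2) ^ (M + 1) < 2 ^ W) :
    Runs W prefixP (prefixCost M) σ fun τ =>
      ∀ r : ℕ, r ≤ M + 1 → τ aPrefix r = (∑ i ∈ Finset.range r, N i : ℕ) ∧
        τ aPow r = ((N 0 + 2) ^ r : ℕ) := by
  unfold prefixP prefixCost
  refine Runs.mono (T := 3 + forCost (M + 1) 100 (eM + 1).cost) (Runs.seq (Runs.store (fun _ => ?_)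
    ((Runs.forLt (n := M + 1) (T := 100)
    (Inv := fun k τ => ∀ r : ℕ, r ≤ k → τ aPrefix r = (∑ i ∈ Finset.range r, N i : ℕ) ∧
        τ aPow r = ((N 0 + 2) ^ r : ℕ)) (by decide) hMW ?_ ?_ ?_).mono le_rfl ?_))) ?_ fun _ h => h
  · rw [eval_one]
    exact fitsWord_natCast (n := 1) (lt_of_le_of_lt (by omega) hMW)
  · intro τ hf
    rw [eval_add, eval_cell, eval_zero, hf 0 (by decide), Mem.write_of_ne _ (by decide), hM,
      eval_one]
    push_cast; rfl
  · intro r hr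
    obtain rfl : r = 0 := by omega
    simp [h0]
  · intro k τ hk hf hkτ hinv
    have hN' : ∀ i : ℕ, τ 1 i = N i := by
      intro i
      rw [hf 1 (by decide), Mem.write_of_ne _ (by decide), hN]
    have hN0 : τ 1 0 = N 0 := hN' 0
    have e1 : (cell aPrefix (var vI) + cell 1 (var vI)).eval τ =
        (∑ i ∈ Finset.range (k + 1), N i : ℕ) := by
      simp only [eval_add, eval_cell, eval_zero, hkτ, (hinv k le_rfl).1, hN',
        Finset.sum_range_succ]
      push_cast; rfl
    have e2 : (cell aPow (var vI) * (eTop + 2)).eval τ = ((N 0 + 2) ^ (k + 1) : ℕ) := by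
      simp only [eval_add, eval_mul, eval_cell, eval_zero, eval_two, hkτ, (hinv k le_rfl).2, hN0,
        pow_succ]
      push_cast; rfl
    have e3 : (var vI + 1).eval τ = ((k + 1 : ℕ) : ℤ) := by
      rw [eval_add, eval_cell, eval_zero, hkτ, eval_one]; push_cast; rfl
    refine Runs.mono (Runs.seq (Runs.store (fun _ => ?_) (Runs.store (fun _ => ?_) ?_)))
      (by decide) fun _ h => h
    · rw [e1]
      exact fitsWord_natCast ((Finset.sum_le_sum_of_subset
        (Finset.range_mono (by omega))).trans_lt hNW)
    · simp only [eval_mul, eval_add, eval_cell, eval_zero, eval_two,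
        Mem.write_of_ne _ (show vI ≠ aPrefix by decide),
        Mem.write_of_ne _ (show aPow ≠ aPrefix by decide),
        Mem.write_of_ne _ (show 1 ≠ aPrefix by decide)]
      simp only [eval_mul, eval_add, eval_cell, eval_zero, eval_two] at e2
      rw [e2]
      exact fitsWord_natCast ((Nat.pow_le_pow_right (by omega) (by omega)).trans_lt hpW)
    · intro r hr
      have e2' : (cell aPow (var vI) * (eTop + 2)).eval (τ.write aPrefix ((var vI + 1).eval τ)
          ((cell aPrefix (var vI) + cell 1 (var vI)).eval τ)) =
          (cell aPow (var vI) * (eTop + 2)).eval τ := by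
        simp
      have e3' : (var vI + 1).eval (τ.write aPrefix ((var vI + 1).eval τ)
          ((cell aPrefix (var vI) + cell 1 (var vI)).eval τ)) = (var vI + 1).eval τ := by
        simp
      rw [e2', e3', e1, e2, e3]
      rw [Mem.write_of_ne _ (show aPrefix ≠ vI by decide),
        Mem.write_of_ne _ (show aPow ≠ vI by decide),
        Mem.write_of_ne _ (show aPrefix ≠ aPow by decide), Mem.write_same, Mem.write_same,
        Mem.write_of_ne _ (show aPow ≠ aPrefix by decide), Function.update_apply,
        Function.update_apply]
      rcases Nat.lt_or_ge k r with h | h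
      · obtain rfl : r = k + 1 := by omega
        rw [if_pos rfl, if_pos rfl]
        exact ⟨rfl, rfl⟩
      · rw [if_neg (by omega), if_neg (by omega)]
        exact hinv r h
  · exact fun τ h => h.2
  · omega

/-- `n / d` is the largest revenue from a single one of the first `k` classes, or `0` if there is
none that can be chosen at all. -/
structure SingleBound (σ : Mem) (k : ℕ) (n d : ℤ) : Prop where
  den_pos : 0 < d
  num_nonneg : 0 ≤ n
  le : ∀ i : ℕ, i < k → σ 2 i ≤ σ 3 i → σ 4 i * σ 3 i * d ≤ n * σ 5 i
  attained : n = 0 ∨ ∃ i : ℕ, i < k ∧ σ 2 i ≤ σ 3 i ∧ n = σ 4 i * σ 3 i ∧ d = σ 5 i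

theorem SingleBound.congr {τ : Mem} {k : ℕ} {n d : ℤ} (h : SingleBound σ k n d)
    (hc : ∀ c ∈ [2, 3, 4, 5], τ c = σ c) : SingleBound τ k n d := by
  simp only [List.forall_mem_cons, List.not_mem_nil, false_imp_iff, implies_true, and_true] at hc
  obtain ⟨h2, h3, h4, h5⟩ := hc
  refine ⟨h.den_pos, h.num_nonneg, ?_, ?_⟩
  · rw [h2, h3, h4, h5]; exact h.le
  · rw [h2, h3, h4, h5]; exact h.attained

/-- A bound on the number of steps of `boundP`. -/
def boundCost (M : ℕ) : ℕ := 10 + forCost M 100 eM.cost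

theorem runs_boundP (hM : σ 0 0 = M) (hMW : M < 2 ^ W) (h1W : 1 < 2 ^ W)
    (hden : ∀ i : ℕ, i < M → 0 < σ 5 i)
    (hfits : ∀ i : ℕ, i < M → FitsWord W (σ 4 i * σ 3 i)) (h0 : σ vLbNum 0 = 0) :
    Runs W boundP (boundCost M) σ fun τ => SingleBound τ M (τ vLbNum 0) (τ vLbDen 0) := by
  unfold boundP boundCost
  refine Runs.mono (T := 3 + forCost M 100 eM.cost) (Runs.seq (Runs.assign (fun _ => ?_)
    fun τ₀ hf₀ hτ₀ => (Runs.forLt (n := M)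
    (T := 100) (Inv := fun k τ => SingleBound σ k (τ vLbNum 0) (τ vLbDen 0)) (by decide) hMW
    ?_ ?_ ?_).mono le_rfl ?_)) ?_ fun _ h => h
  · rw [eval_one]; exact fitsWord_natCast (n := 1) h1W
  · intro τ hf
    rw [eval_cell, eval_zero, hf 0 (by decide), hf₀ _ (by decide), hM]
  · rw [Mem.write_of_ne _ (by decide), Mem.write_of_ne _ (by decide), hτ₀, hf₀ _ (by decide), h0,
      eval_one]
    exact ⟨one_pos, le_rfl, fun i hi => absurd hi (Nat.not_lt_zero _), Or.inl rfl⟩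
  · intro k τ hk hf hkτ hinv
    have hsame : ∀ c ∈ [2, 3, 4, 5], τ c = σ c := by
      intro c hc
      rw [hf c (by revert c hc; decide), hf₀ c (by revert c hc; decide)]
    have e2 : (cell 2 (var vI)).eval τ = σ 2 k := by
      rw [eval_cell, eval_cell, eval_zero, hkτ, hsame _ (by decide)]
    have e3 : (cell 3 (var vI)).eval τ = σ 3 k := by
      rw [eval_cell, eval_cell, eval_zero, hkτ, hsame _ (by decide)]
    have e4 : (cell 4 (var vI)).eval τ = σ 4 k := by
      rw [eval_cell, eval_cell, eval_zero, hkτ, hsame _ (by decide)]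
    have e5 : (cell 5 (var vI)).eval τ = σ 5 k := by
      rw [eval_cell, eval_cell, eval_zero, hkτ, hsame _ (by decide)]
    have hdk := hden k hk
    refine Runs.mono (Runs.ifLt (fun h => Runs.skip ?_) fun h =>
      Runs.ifLt (fun h' => Runs.seq (Runs.assign (fun _ => ?_) fun τ₁ hf₁ hτ₁ =>
        Runs.assign (fun hb => hb _ _) fun τ₂ hf₂ hτ₂ => ?_)) fun h' => Runs.skip ?_)
      (by decide) fun _ h => h
    all_goals rw [e2, e3] at h
    all_goals try simp only [eval_mul, e3, e4, e5] at h'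
    all_goals try simp only [eval_cell, eval_zero] at h'
    · rw [Mem.write_of_ne _ (by decide), Mem.write_of_ne _ (by decide)]
      refine ⟨hinv.den_pos, hinv.num_nonneg, fun i hi hle => ?_, ?_⟩
      · rcases Nat.lt_succ_iff_lt_or_eq.mp hi with h' | rfl
        · exact hinv.le i h' hle
        · omega
      · exact hinv.attained.imp id fun ⟨i, hi, hr⟩ => ⟨i, by omega, hr⟩
    · rw [eval_mul, e3, e4]; exact hfits k hk
    · rw [Mem.write_of_ne _ (by decide), Mem.write_of_ne _ (by decide), hτ₂, hf₂ _ (by decide), hτ₁,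
        eval_mul, e3, e4]
      have e5' : (cell 5 (var vI)).eval τ₁ = σ 5 k := by
        rw [← e5]
        simp only [eval_cell, eval_zero, hf₁ _ (show 5 ≠ vLbNum by decide),
          hf₁ _ (show vI ≠ vLbNum by decide)]
      rw [e5']
      have hpos : 0 ≤ σ 4 k * σ 3 k := by
        have h1 : 0 ≤ τ vLbNum 0 * σ 5 k := mul_nonneg hinv.num_nonneg hdk.le
        by_contra hneg
        nlinarith [hinv.den_pos]
      refine ⟨hdk, hpos, fun i hi hle => ?_, Or.inr ⟨k, by omega, not_lt.mp h, rfl, rfl⟩⟩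
      rcases Nat.lt_succ_iff_lt_or_eq.mp hi with hik | rfl
      · have h1 := hinv.le i hik hle
        have h2 := hden i (by omega)
        have h3 := hinv.den_pos
        refine le_of_mul_le_mul_right ?_ h3
        nlinarith [mul_le_mul_of_nonneg_right h1 hdk.le, mul_le_mul_of_nonneg_right h'.le h2.le]
      · exact le_rfl
    · rw [Mem.write_of_ne _ (by decide), Mem.write_of_ne _ (by decide)]
      refine ⟨hinv.den_pos, hinv.num_nonneg, fun i hi hle => ?_, ?_⟩
      · rcases Nat.lt_succ_iff_lt_or_eq.mp hi with h'' | rfl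
        · exact hinv.le i h'' hle
        · exact not_lt.mp h'
      · exact hinv.attained.imp id fun ⟨i, hi, hr⟩ => ⟨i, by omega, hr⟩
  · rintro τ ⟨hf, hinv⟩
    refine hinv.congr fun c hc => ?_
    rw [hf c (by revert c hc; decide), hf₀ c (by revert c hc; decide)]
  · omega

end Preprocessing

end Scheme

/-! ### Error analysis -/

namespace Problem

variable {D : Problem}

/-- What the error analysis requires of the profits `p` and of the bound `lb`: it is the largest
revenue from a single class, or `0` if no class can be chosen. -/
structure Profits (D : Problem) (p : ℕ → ℚ) (lb : ℚ) : Prop where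
  pos : ∀ s < D.m, 0 < D.U s → 0 < p s
  le : ∀ s < D.m, D.L s ≤ D.U s → p s * D.U s ≤ lb
  attained : lb = 0 ∨ ∃ s < D.m, D.L s ≤ D.U s ∧ lb = p s * D.U s
  top_le : D.top ≤ D.F 1

namespace Profits

variable {p : ℕ → ℚ} {lb e : ℚ} {x y z : ℕ → ℕ}

theorem mul_nonneg (h : D.Profits p lb) (hx : D.IsAlloc x) (s : ℕ) : 0 ≤ p s * x s := by
  by_cases h0 : x s = 0
  · simp [h0]
  · have hm := hx.mem h0
    have hs := h.pos s (hx.lt_m h0) (by omega)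
    positivity

theorem mul_le (h : D.Profits p lb) (hx : D.IsAlloc x) {s : ℕ} (h0 : x s ≠ 0) :
    p s * x s ≤ lb := by
  have hm := hx.mem h0
  have hs := h.pos s (hx.lt_m h0) (by omega)
  refine le_trans ?_ (h.le s (hx.lt_m h0) (hm.1.trans hm.2))
  exact mul_le_mul_of_nonneg_left (by exact_mod_cast hm.2) hs.le

theorem pos_of_ne_zero (h : D.Profits p lb) (hx : D.IsAlloc x) {s : ℕ} (h0 : x s ≠ 0) :
    0 < lb := by
  have hs := h.pos s (hx.lt_m h0) (by have := hx.mem h0; omega)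
  have : (0 : ℚ) < x s := by exact_mod_cast Nat.pos_of_ne_zero h0
  exact lt_of_lt_of_le (by positivity) (h.mul_le hx h0)

theorem rev_nonneg (h : D.Profits p lb) (hx : D.IsAlloc x) : 0 ≤ D.rev p x :=
  Finset.sum_nonneg fun s _ => h.mul_nonneg hx s

/-- The scaling of the profits by `2 * m / (e * lb)`. As no class earns more than `lb`, it earns at
most `2 * m / e` units. If `lb` is `0`, then the factor is `0` by convention, and there are no
units. -/
def scaling (h : D.Profits p lb) (he : 0 < e) : D.Scaling where
  un s g := ⌊p s * g * (2 * D.m / (e * lb))⌋₊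
  Z := ⌊(2 * D.m * D.m / e : ℚ)⌋₊ + D.m + 2
  un_zero s := by simp
  m_lt := by omega
  sum_lt x hx := by
    refine lt_of_le_of_lt (b := ⌊(2 * D.m * D.m / e : ℚ)⌋₊) (Nat.le_floor ?_) (by omega)
    push_cast
    calc ∑ s ∈ Finset.range D.m, ((⌊p s * x s * (2 * D.m / (e * lb))⌋₊ : ℕ) : ℚ)
        ≤ ∑ _s ∈ Finset.range D.m, (2 * D.m / e : ℚ) := Finset.sum_le_sum fun s _ => ?_
      _ = 2 * D.m * D.m / e := by
        rw [Finset.sum_const, Finset.card_range, nsmul_eq_mul]; ring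
    by_cases h0 : x s = 0
    · simp only [h0, Nat.cast_zero, mul_zero, zero_mul, Nat.floor_zero]
      positivity
    · have hlb := h.pos_of_ne_zero hx h0
      refine (Nat.floor_le (_root_.mul_nonneg (h.mul_nonneg hx s) (by positivity))).trans ?_
      calc p s * x s * (2 * D.m / (e * lb)) ≤ lb * (2 * D.m / (e * lb)) :=
            mul_le_mul_of_nonneg_right (h.mul_le hx h0) (by positivity)
        _ = 2 * D.m / e := by field_simp

/-- A class of largest single revenue is an allocation by itself. -/
theorem exists_single (h : D.Profits p lb) (hlb : 0 < lb) : ∃ x, D.IsAlloc x ∧ D.rev p x = lb := by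
  obtain hc | ⟨s, hs, hle, heq⟩ := h.attained
  · exact absurd hc hlb.ne'
  refine ⟨Function.update 0 s (D.U s), ⟨fun i hi => ?_, fun i hi => ?_, fun S hS => ?_⟩, ?_⟩
  · rcases eq_or_ne i s with rfl | his
    · right; simp [hle]
    · left; simp [his]
  · rw [Function.update_of_ne (by omega)]; rfl
  · by_cases hsS : s ∈ S
    · rw [Finset.sum_update_of_mem hsS]
      have h1 : 1 ≤ S.card := Finset.card_pos.mpr ⟨s, hsS⟩
      simpa using ((D.U_le s hs).trans h.top_le).trans (D.F_mono h1)
    · rw [Finset.sum_update_of_notMem hsS]; simp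
  · rw [rev, Finset.sum_eq_single_of_mem s (Finset.mem_range.mpr hs) fun i _ his => by simp [his],
      Function.update_self, heq]

/-- Half of the error is due to rounding the entries down to levels, and half to rounding the
profits down to units. -/
theorem rev_le (h : D.Profits p lb) {a b : ℕ} (hb : 0 < b) (he : e = a / b)
    (hepos : 0 < e) (hz : D.IsAlloc z) (hmax : ∀ x, D.IsAlloc x → D.rev p x ≤ D.rev p z)
    (hx : D.IsAlloc x)
    (hunits : (h.scaling hepos).units (fun i => D.roundDown a b (z i)) ≤
      (h.scaling hepos).units x) :
    (1 - e) * D.rev p z ≤ D.rev p x := by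
  have hx0 := h.rev_nonneg hx
  have hz0 := h.rev_nonneg hz
  rcases le_or_gt 1 e with he1 | he1
  · nlinarith
  by_cases hall : ∀ s < D.m, z s = 0
  · have : D.rev p z = 0 := Finset.sum_eq_zero fun s hs => by
      rw [hall s (Finset.mem_range.mp hs)]; simp
    rw [this]; linarith
  push Not at hall
  obtain ⟨s₀, hs₀, hne⟩ := hall
  have hlb := h.pos_of_ne_zero hz hne
  have hm : (0 : ℚ) < D.m := by exact_mod_cast (by omega : 0 < D.m)
  have hlbz : lb ≤ D.rev p z := by
    obtain ⟨x₁, hx₁, hrev⟩ := h.exists_single hlb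
    rw [← hrev]; exact hmax x₁ hx₁
  have hy := hz.roundDown (a := a) (b := b)
  set y : ℕ → ℕ := fun i => D.roundDown a b (z i) with hydef
  have hbQ : (0 : ℚ) < b := by exact_mod_cast hb
  have hround : (1 - e / 2) * D.rev p z ≤ D.rev p y := by
    rw [rev, Finset.mul_sum]
    refine Finset.sum_le_sum fun s hs => ?_
    by_cases h0 : z s = 0
    · rw [h0, Nat.cast_zero, mul_zero, mul_zero]
      exact h.mul_nonneg hy s
    · have hp := h.pos s (hz.lt_m h0) (by have := hz.mem h0; omega)
      have hab : a ≤ 2 * b := by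
        have h1 : (a : ℚ) < b := by rwa [he, div_lt_one hbQ] at he1
        have h2 : a < b := by exact_mod_cast h1
        omega
      have := mul_le_roundDown (D := D) hb hab (hz.le_top s)
      rw [← he] at this
      nlinarith
  set κ : ℚ := 2 * D.m / (e * lb) with hκ
  have hκpos : 0 < κ := by positivity
  have hup : ((h.scaling hepos).units x : ℚ) ≤ κ * D.rev p x := by
    rw [Scaling.units, rev, Finset.mul_sum]
    push_cast
    refine Finset.sum_le_sum fun s _ => ?_
    refine (Nat.floor_le (_root_.mul_nonneg (h.mul_nonneg hx s) hκpos.le)).trans (le_of_eq ?_)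
    ring
  have hlow : κ * D.rev p y ≤ (h.scaling hepos).units y + D.m := by
    have h1 : ∀ s ∈ Finset.range D.m,
        κ * (p s * y s) ≤ ((h.scaling hepos).un s (y s) : ℚ) + 1 := by
      intro s _
      rw [mul_comm κ]
      exact (Nat.lt_floor_add_one _).le
    have h2 := Finset.sum_le_sum h1
    rw [Finset.sum_add_distrib, Finset.sum_const, Finset.card_range, nsmul_eq_mul, mul_one,
      ← Finset.mul_sum] at h2
    rw [Scaling.units]
    push_cast
    exact h2
  have hunits' : ((h.scaling hepos).units y : ℚ) ≤ (h.scaling hepos).units x := by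
    exact_mod_cast hunits
  have hκm : κ * (e / 2 * lb) = D.m := by rw [hκ]; field_simp
  have hfin : D.rev p y ≤ D.rev p x + e / 2 * lb := by
    refine le_of_mul_le_mul_left ?_ hκpos
    rw [mul_add, hκm]
    linarith
  nlinarith

end Profits

end Problem

/-! ### From instances to sorted problems -/

namespace GAP

variable {M K : ℕ} (I : GAP M K) (ε : ℚ)

theorem _root_.RAM.ofVec_natCast {n : ℕ} (v : Fin n → ℤ) (i : ℕ) :
    RAM.ofVec v i = if h : i < n then v ⟨i, h⟩ else 0 := by
  unfold RAM.ofVec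
  by_cases h : i < n <;> simp [h]

theorem input_zero : I.input ε 0 0 = M ∧ I.input ε 0 2 = ε.num ∧ I.input ε 0 3 = ε.den := by
  refine ⟨?_, ?_, ?_⟩
  · exact RAM.ofVec_natCast ![(M : ℤ), (K : ℤ), ε.num, (ε.den : ℤ)] 0
  · exact RAM.ofVec_natCast ![(M : ℤ), (K : ℤ), ε.num, (ε.den : ℤ)] 2
  · exact RAM.ofVec_natCast ![(M : ℤ), (K : ℤ), ε.num, (ε.den : ℤ)] 3

theorem input_one (k : ℕ) :
    I.input ε 1 k = ((if h : k < K then I.target ⟨k, h⟩ else 0 : ℕ) : ℤ) := by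
  refine (RAM.ofVec_natCast (fun k => I.target k) k).trans ?_
  split_ifs <;> simp

theorem input_top : I.input ε 1 0 = prefixSum I.target 1 := by
  have := I.input_one (ε := ε) 0
  simpa [prefixSum] using this

theorem input_two (i : Fin M) : I.input ε 2 (i : ℕ) = I.lower i := by
  simp [input, RAM.ofVec_natCast]

theorem input_three (i : Fin M) : I.input ε 3 (i : ℕ) = I.upper i := by
  simp [input, RAM.ofVec_natCast]

theorem input_four (i : Fin M) : I.input ε 4 (i : ℕ) = (I.profit i).num := by
  simp [input, RAM.ofVec_natCast]

theorem input_five (i : Fin M) : I.input ε 5 (i : ℕ) = (I.profit i).den := by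
  simp [input, RAM.ofVec_natCast]

/-- The key by which the classes are sorted: decreasing profits, and the class number for classes
with the same profit. -/
def key (i : Fin M) : ℚ ×ₗ Fin M := toLex (-I.profit i, i)

theorem key_lt_key {i j : Fin M} :
    I.key j < I.key i ↔ I.profit i < I.profit j ∨ I.profit j = I.profit i ∧ j < i := by
  simp [key, Prod.Lex.toLex_lt_toLex]

theorem before_iff (i j : Fin M) : Scheme.Before M (I.input ε) j i ↔ I.key j < I.key i := by
  rw [key_lt_key, Scheme.Before, input_four, input_four, input_five, input_five, Rat.lt_iff,
    Rat.eq_iff_mul_eq_mul]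
  have hi : ((i : ℕ) : ℤ) < M := by exact_mod_cast i.2
  have hj : ((j : ℕ) : ℤ) < M := by exact_mod_cast j.2
  have hi0 : (0 : ℤ) ≤ (i : ℕ) := Int.natCast_nonneg _
  have hj0 : (0 : ℤ) ≤ (j : ℕ) := Int.natCast_nonneg _
  have hij : j < i ↔ ((j : ℕ) : ℤ) < (i : ℕ) := by rw [Fin.lt_def]; norm_cast
  rw [hij]
  generalize (I.profit i).num * ((I.profit j).den : ℤ) = X
  generalize (I.profit j).num * ((I.profit i).den : ℤ) = Y
  constructor
  · intro h
    rcases lt_trichotomy X Y with h' | h' | h'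
    · exact Or.inl h'
    · subst h'; right; exact ⟨rfl, by omega⟩
    · nlinarith
  · rintro (h | ⟨rfl, h⟩)
    · nlinarith
    · omega

theorem rank_lt_rank {i j : Fin M} (h : I.key j < I.key i) :
    Scheme.rank M (I.input ε) j < Scheme.rank M (I.input ε) i := by
  refine Finset.card_lt_card ((Finset.ssubset_iff_of_subset fun k hk => ?_).mpr ⟨j, ?_, ?_⟩)
  · rw [Finset.mem_filter, Finset.mem_range] at hk ⊢
    have hk' := (I.before_iff ε j ⟨k, hk.1⟩).mp hk.2
    exact ⟨hk.1, (I.before_iff ε i ⟨k, hk.1⟩).mpr (hk'.trans h)⟩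
  · exact Finset.mem_filter.mpr ⟨Finset.mem_range.mpr j.2, (I.before_iff ε i j).mpr h⟩
  · rw [Finset.mem_filter, before_iff]
    exact fun hc => lt_irrefl _ hc.2

theorem rank_injective {i j : Fin M}
    (h : Scheme.rank M (I.input ε) i = Scheme.rank M (I.input ε) j) : i = j := by
  rcases lt_trichotomy (I.key i) (I.key j) with h' | h' | h'
  · have := I.rank_lt_rank ε h'; omega
  · exact (Prod.ext_iff.mp (toLex.injective h')).2
  · have := I.rank_lt_rank ε h'; omega

theorem rank_lt (i : Fin M) : Scheme.rank M (I.input ε) i < M := by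
  have : Scheme.rank M (I.input ε) i < (Finset.range M).card := by
    refine Finset.card_lt_card ((Finset.ssubset_iff_of_subset (Finset.filter_subset _ _)).mpr
      ⟨i, Finset.mem_range.mpr i.2, ?_⟩)
    rw [Finset.mem_filter, before_iff]
    exact fun hc => lt_irrefl _ hc.2
  rwa [Finset.card_range] at this

/-- The positions of the classes in the order by profits. -/
noncomputable def pos : Fin M ≃ Fin M :=
  Equiv.ofBijective (fun i => ⟨Scheme.rank M (I.input ε) i, I.rank_lt ε i⟩)
    (Finite.injective_iff_bijective.mp fun _ _ h => I.rank_injective ε (Fin.mk.inj_iff.mp h))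

theorem pos_val (i : Fin M) : (I.pos ε i : ℕ) = Scheme.rank M (I.input ε) i := rfl

/-- The vector `v`, sorted by profits and continued by `0`. -/
noncomputable def sorted {α : Type*} [Zero α] (v : Fin M → α) (s : ℕ) : α :=
  if h : s < M then v ((I.pos ε).symm ⟨s, h⟩) else 0

theorem sorted_pos {α : Type*} [Zero α] (v : Fin M → α) (i : Fin M) :
    I.sorted ε v (I.pos ε i) = v i := by simp [sorted]

theorem exists_pos_eq {s : ℕ} (hs : s < M) : ∃ i : Fin M, (I.pos ε i : ℕ) = s :=
  ⟨(I.pos ε).symm ⟨s, hs⟩, by simp⟩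

/-- The upper bound of class `i`, cut off at the largest entry of the target vector, and `0` if the
class is not profitable. -/
def capNat (i : Fin M) : ℕ := if 0 < I.profit i then min (I.upper i) (prefixSum I.target 1) else 0

/-- The sorted problem. -/
noncomputable def problem : Problem where
  m := M
  L := I.sorted ε I.lower
  U := I.sorted ε I.capNat
  F := prefixSum I.target
  top := prefixSum I.target 1
  L_pos s hs := by
    obtain ⟨i, rfl⟩ := I.exists_pos_eq ε hs
    rw [sorted_pos]; exact I.lower_pos i
  U_le s hs := by
    obtain ⟨i, rfl⟩ := I.exists_pos_eq ε hs
    rw [sorted_pos, capNat]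
    split_ifs
    exacts [min_le_right _ _, Nat.zero_le _]
  F_mono := prefixSum_mono _

theorem sorted_profit_antitone {s t : ℕ} (hst : s < t) (ht : t < M) :
    I.sorted ε I.profit t ≤ I.sorted ε I.profit s := by
  obtain ⟨i, rfl⟩ := I.exists_pos_eq ε (hst.trans ht)
  obtain ⟨j, rfl⟩ := I.exists_pos_eq ε ht
  rw [sorted_pos, sorted_pos]
  by_contra h
  have := I.rank_lt_rank ε (I.key_lt_key.mpr (Or.inl (not_le.mp h)))
  rw [pos_val, pos_val] at hst
  omega

theorem sum_range_eq_sum_pos {α : Type*} [AddCommMonoid α] (f : ℕ → α) :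
    ∑ s ∈ Finset.range M, f s = ∑ i, f (I.pos ε i) := by
  rw [Finset.sum_range, Equiv.sum_comp (I.pos ε) (fun s : Fin M => f s)]

theorem rev_problem (x : ℕ → ℕ) : (I.problem ε).rev (I.sorted ε I.profit) x =
    I.revenue fun i => x (I.pos ε i) := by
  rw [Problem.rev, revenue]
  exact (I.sum_range_eq_sum_pos ε _).trans (by simp only [sorted_pos])

theorem feasible_of_isAlloc {x : ℕ → ℕ} (hx : (I.problem ε).IsAlloc x) :
    I.Feasible fun i => x (I.pos ε i) := by
  refine ⟨fun i => ?_, (majorized_iff I.target_strictAnti.antitone).mpr fun S => ?_⟩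
  · have h := hx.bounds (I.pos ε i) (I.pos ε i).2
    simp only [problem, sorted_pos] at h
    refine h.imp id fun h => ⟨h.1, h.2.trans ?_⟩
    unfold capNat
    split_ifs
    exacts [min_le_left _ _, Nat.zero_le _]
  · have hinj : Function.Injective fun i : Fin M => (I.pos ε i : ℕ) :=
      Fin.val_injective.comp (I.pos ε).injective
    have h := hx.sum_le (S.map ⟨_, hinj⟩) (by
      intro s hs
      obtain ⟨i, -, rfl⟩ := Finset.mem_map.mp hs
      exact Finset.mem_range.mpr (I.pos ε i).2)
    rw [Finset.sum_map, Finset.card_map] at h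
    exact h

/-- Every feasible allocation is dominated by an allocation of the sorted problem, in which the
unprofitable classes have been left out. -/
theorem exists_isAlloc {x : Fin M → ℕ} (hx : I.Feasible x) :
    ∃ z, (I.problem ε).IsAlloc z ∧ I.revenue x ≤ (I.problem ε).rev (I.sorted ε I.profit) z := by
  have hmaj := (majorized_iff I.target_strictAnti.antitone).mp hx.majorized
  set x' : Fin M → ℕ := fun i => if 0 < I.profit i then x i else 0 with hx'
  have hle : ∀ i, x' i ≤ x i := fun i => by simp only [hx']; split_ifs <;> omega
  refine ⟨I.sorted ε x', ⟨fun s hs => ?_, fun s hs => ?_, fun S hS => ?_⟩, ?_⟩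
  · obtain ⟨i, rfl⟩ := I.exists_pos_eq ε hs
    simp only [problem, sorted_pos, hx', capNat]
    split_ifs with hp
    · refine (hx.bounds i).imp id fun h => ⟨h.1, le_min h.2 ?_⟩
      simpa using hmaj {i}
    · exact Or.inl rfl
  · exact dif_neg (not_lt.mpr hs)
  · obtain ⟨S', rfl⟩ : ∃ S' : Finset (Fin M), S'.map
        ⟨fun i => (I.pos ε i : ℕ), Fin.val_injective.comp (I.pos ε).injective⟩ = S := by
      refine ⟨Finset.univ.filter fun i => (I.pos ε i : ℕ) ∈ S, ?_⟩
      ext s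
      simp only [Finset.mem_map, Finset.mem_filter, Finset.mem_univ, true_and,
        Function.Embedding.coeFn_mk]
      constructor
      · rintro ⟨i, hi, rfl⟩; exact hi
      · intro hs
        obtain ⟨i, rfl⟩ := I.exists_pos_eq ε (Finset.mem_range.mp (hS hs))
        exact ⟨i, hs, rfl⟩
    rw [Finset.sum_map, Finset.card_map]
    simp only [Function.Embedding.coeFn_mk, sorted_pos]
    exact (Finset.sum_le_sum fun i _ => hle i).trans (hmaj S')
  · rw [rev_problem]
    simp only [sorted_pos, revenue, hx']
    refine Finset.sum_le_sum fun i _ => ?_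
    split_ifs with hp
    · exact le_rfl
    · rw [Nat.cast_zero, mul_zero]
      exact mul_nonpos_of_nonpos_of_nonneg (not_lt.mp hp) (Nat.cast_nonneg _)

theorem opt_le {v : ℚ} (h : ∀ x, (I.problem ε).IsAlloc x →
    (I.problem ε).rev (I.sorted ε I.profit) x ≤ v) : I.opt ≤ v := by
  obtain ⟨x, hx, heq⟩ := I.opt_isGreatest.1
  obtain ⟨z, hz, hle⟩ := I.exists_isAlloc ε hx
  rw [← heq]
  exact hle.trans (h z hz)

theorem cap_input {σ : RAM.Mem} (hσ : ∀ c ∈ [1, 3, 4], σ c = I.input ε c) (i : Fin M) :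
    Scheme.cap σ i = I.capNat i := by
  rw [Scheme.cap, hσ 1 (by simp), hσ 3 (by simp), hσ 4 (by simp), input_four, input_three,
    input_top, capNat]
  simp only [Rat.num_pos]
  split_ifs <;> simp

/-- The bound computed by the program meets the requirements of the error analysis. -/
theorem profits_of_singleBound {σ : RAM.Mem} {n d : ℤ} (h : Scheme.SingleBound σ M n d)
    (h2 : ∀ i : Fin M, σ 2 (i : ℕ) = I.lower i) (h3 : ∀ i : Fin M, σ 3 (i : ℕ) = I.capNat i)
    (h4 : ∀ i : Fin M, σ 4 (i : ℕ) = (I.profit i).num)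
    (h5 : ∀ i : Fin M, σ 5 (i : ℕ) = (I.profit i).den) :
    (I.problem ε).Profits (I.sorted ε I.profit) (n / d) := by
  have hd : (0 : ℚ) < d := by exact_mod_cast h.den_pos
  have hden : ∀ i, (0 : ℚ) < (I.profit i).den := fun i => by exact_mod_cast (I.profit i).pos
  refine ⟨fun s hs hU => ?_, fun s hs hle => ?_, ?_, le_rfl⟩
  · obtain ⟨i, rfl⟩ := I.exists_pos_eq ε hs
    simp only [problem, sorted_pos, capNat] at hU ⊢
    by_contra hc
    rw [if_neg hc] at hU
    omega
  · obtain ⟨i, rfl⟩ := I.exists_pos_eq ε hs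
    simp only [problem, sorted_pos] at hle ⊢
    have h' := h.le i i.2 (by rw [h2, h3]; exact_mod_cast hle)
    rw [h3, h4, h5] at h'
    have h'' : ((I.profit i).num : ℚ) * I.capNat i * d ≤ n * (I.profit i).den := by
      exact_mod_cast h'
    rw [le_div_iff₀ hd]
    nth_rewrite 1 [← Rat.num_div_den (I.profit i)]
    rw [div_mul_eq_mul_div, div_mul_eq_mul_div, div_le_iff₀ (hden i)]
    exact h''
  · rcases h.attained with rfl | ⟨i, hi, hle, hn, hd'⟩
    · left; simp
    · right
      obtain ⟨i, rfl⟩ : ∃ i' : Fin M, (i' : ℕ) = i := ⟨⟨i, hi⟩, rfl⟩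
      refine ⟨I.pos ε i, (I.pos ε i).2, ?_, ?_⟩
      · simp only [problem, sorted_pos]
        rw [h2, h3] at hle
        exact_mod_cast hle
      · simp only [problem, sorted_pos]
        rw [hn, hd', h3, h4, h5]
        push_cast
        nth_rewrite 3 [← Rat.num_div_den (I.profit i)]
        ring

end GAP

/-! ### Bounds on the resources -/

namespace Scheme

open RAM RAM.Expr RAM.Program

theorem forCost_le {n N T c : ℕ} (h : n + 1 ≤ N) : forCost n T c ≤ N * (T + c + 13) := by
  unfold forCost
  nlinarith [Nat.mul_le_mul_right (T + c + 10) h]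

/-- A bound on the number of steps of the program, if there are `l` levels, `m` classes and `s`
states. -/
def totalCost (l m s : ℕ) : ℕ :=
  sortCost m + (prefixCost m + (boundCost m + (30 + (dpCost l m s + outputCost m s))))

theorem totalCost_le {l m Z : ℕ} (hm : m + 2 ≤ Z) :
    totalCost l m (Z * Z * Z) ≤ 4000 * (l + 1) * Z ^ 4 := by
  have hZ : 1 ≤ Z := by omega
  have h12 : Z ≤ Z ^ 2 := Nat.le_self_pow (by norm_num) Z
  have h24 : Z ^ 2 ≤ Z ^ 4 := Nat.pow_le_pow_right hZ (by norm_num)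
  have h34 : Z ^ 3 ≤ Z ^ 4 := Nat.pow_le_pow_right hZ (by norm_num)
  have hs : Z * Z * Z + 1 ≤ 2 * Z ^ 3 := by
    have : 1 ≤ Z ^ 3 := Nat.one_le_pow _ _ hZ
    have : Z * Z * Z = Z ^ 3 := by ring
    omega
  have hsort : sortCost m ≤ 300 * Z ^ 2 := by
    refine (forCost_le (show m + 1 ≤ Z by omega)).trans ?_
    have h1 := forCost_le (n := m) (N := Z) (T := 100) (c := eM.cost) (by omega)
    have h2 : eM.cost = 2 := rfl
    rw [h2] at h1 ⊢
    nlinarith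
  have hprefix : prefixCost m ≤ 200 * Z := by
    have h1 := forCost_le (n := m + 1) (N := Z) (T := 100) (c := (eM + 1 : Expr).cost) (by omega)
    have h2 : (eM + 1 : Expr).cost = 4 := rfl
    rw [h2] at h1
    unfold prefixCost
    rw [h2]
    omega
  have hbound : boundCost m ≤ 200 * Z := by
    have h1 := forCost_le (n := m) (N := Z) (T := 100) (c := eM.cost) (by omega)
    have h2 : eM.cost = 2 := rfl
    rw [h2] at h1
    unfold boundCost
    rw [h2]
    omega
  have hlevel : levelCost m (Z * Z * Z) ≤ 1200 * Z ^ 4 := by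
    have h1 := forCost_le (n := Z * Z * Z) (T := entryP.bd) (c := eSize.cost) hs
    have h2 : entryP.bd ≤ 500 := by decide
    have h3 : eSize.cost = 8 := rfl
    have h4 : eM.cost = 2 := rfl
    have h5 : forCost (Z * Z * Z) entryP.bd eSize.cost ≤ 2 * Z ^ 3 * 521 :=
      h1.trans (Nat.mul_le_mul_left _ (by omega))
    refine (forCost_le (show m + 1 ≤ Z by omega)).trans ?_
    calc Z * (forCost (Z * Z * Z) entryP.bd eSize.cost + 6 + eM.cost + 13)
        ≤ Z * (2 * Z ^ 3 * 521 + 21) := Nat.mul_le_mul_left _ (by omega)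
      _ = 1042 * Z ^ 4 + 21 * Z := by ring
      _ ≤ _ := by omega
  have hnext : nextCost m ≤ 300 * Z := by
    have h1 := forCost_le (n := m) (N := Z) (T := (bumpP eL).bd + (bumpP eU).bd) (c := eM.cost)
      (by omega)
    have h2 : (bumpP eL).bd + (bumpP eU).bd + eM.cost + 13 ≤ 100 := by decide
    have h3 := h1.trans (Nat.mul_le_mul_left Z h2)
    have h4 : Expr.cost 0 + eGeom.cost + 1 + max (assign vNext eGeom).bd 1 +
      (assign vG (var vNext)).bd ≤ 100 := by decide
    unfold nextCost
    omega
  have hdp : dpCost l m (Z * Z * Z) ≤ 1600 * l * Z ^ 4 + 50 := by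
    unfold dpCost
    have : levelCost m (Z * Z * Z) + nextCost m + 10 ≤ 1600 * Z ^ 4 := by omega
    have := Nat.mul_le_mul_left l this
    nlinarith
  have hout : outputCost m (Z * Z * Z) ≤ 400 * Z ^ 4 := by
    have h1 := forCost_le (n := Z * Z * Z) (T := (ifLt 0 (cell aTable (var vT * eSize + var vN))
      (assign vEntry (cell aTable (var vT * eSize + var vN))) skip).bd) (c := eSize.cost) hs
    have h2 : (ifLt 0 (cell aTable (var vT * eSize + var vN))
      (assign vEntry (cell aTable (var vT * eSize + var vN))) skip).bd + eSize.cost + 13 ≤ 100 := by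
      decide
    have h3 := forCost_le (n := m) (N := Z) (T := (store 6 eCls eDigit).bd) (c := eM.cost)
      (by omega)
    have h4 : (store 6 eCls eDigit).bd + eM.cost + 13 ≤ 100 := by decide
    have h5 := h1.trans (Nat.mul_le_mul_left _ h2)
    have h6 := h3.trans (Nat.mul_le_mul_left _ h4)
    unfold outputCost
    omega
  have h1 : 1 ≤ Z ^ 4 := Nat.one_le_pow _ _ hZ
  have h2 : 4000 * (l + 1) * Z ^ 4 = 4000 * l * Z ^ 4 + 4000 * Z ^ 4 := by ring
  have h3 : 1600 * l * Z ^ 4 ≤ 4000 * l * Z ^ 4 :=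
    Nat.mul_le_mul_right _ (Nat.mul_le_mul_right _ (by norm_num))
  rw [h2]
  unfold totalCost
  omega

end Scheme

namespace GAP

open Scheme

variable {M K : ℕ} (I : GAP M K) (ε : ℚ)

/-- The bound `⌊2 * M ^ 2 / ε⌋ + M + 2` on the coordinates of the states of the dynamic program. -/
def radix (M : ℕ) (ε : ℚ) : ℕ := 2 * M * M * ε.den / ε.num.toNat + M + 2

/-- The number of levels. -/
noncomputable def levels : ℕ := (I.problem ε).numLev ε.num.toNat ε.den

/-- A word length that suffices for everything that is stored. The largest values are the codes of
allocations, which have `M + 1` digits of at most one bit more than the input integers, and above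
them a number that is bounded by the sum of the `K` entries of the target vector. -/
noncomputable def wordLength : ℕ :=
  (I.inputBits ε + 1) * (M + 3) + K + 3 * radix M ε + I.levels ε + M + 2

theorem natCast_toNat_num {ε : ℚ} (hε : 0 < ε) : ((ε.num.toNat : ℕ) : ℤ) = ε.num :=
  Int.toNat_of_nonneg (Rat.num_pos.mpr hε).le

theorem eq_num_div_den {ε : ℚ} (hε : 0 < ε) : ε = (ε.num.toNat : ℚ) / (ε.den : ℚ) := by
  have h : ((ε.num.toNat : ℕ) : ℚ) = ε.num := by exact_mod_cast natCast_toNat_num hε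
  rw [h]
  exact (Rat.num_div_den ε).symm

theorem toNat_num_pos {ε : ℚ} (hε : 0 < ε) : 0 < ε.num.toNat := by
  have := natCast_toNat_num hε
  have := Rat.num_pos.mpr hε
  omega

theorem floor_eq_radix {ε : ℚ} (hε : 0 < ε) :
    ⌊(2 * M * M / ε : ℚ)⌋₊ + M + 2 = radix M ε := by
  unfold radix
  congr 2
  rw [← Nat.floor_div_eq_div (K := ℚ)]
  congr 1
  nth_rewrite 1 [eq_num_div_den hε]
  push_cast
  rw [div_div_eq_mul_div]

theorem prefixSum_le_targetSum (r : ℕ) : prefixSum I.target r ≤ I.targetSum := by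
  have h1 : prefixSum I.target r ≤ prefixSum I.target (max r K) :=
    prefixSum_mono _ (le_max_left _ _)
  have h2 : prefixSum I.target (max r K) = I.targetSum := by
    unfold prefixSum targetSum
    rw [← Finset.sum_range_add_sum_Ico _ (le_max_right r K), Finset.sum_range,
      Finset.sum_eq_zero (s := Finset.Ico K (max r K))]
    · simp
    · intro i hi
      rw [dif_neg (by have := (Finset.mem_Ico.mp hi).1; omega)]
  omega

/-! #### Input sizes -/

section bits

theorem lt_two_pow_of_size {n β : ℕ} (h : n.size ≤ β) : n < 2 ^ β := Nat.size_le.mp h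

theorem target_lt (k : Fin K) : I.target k < 2 ^ I.inputBits ε :=
  lt_two_pow_of_size (((Finset.le_sup (f := fun k => (I.target k).size) (Finset.mem_univ k)).trans
    (le_max_left _ _)).trans (le_max_right _ _))

theorem class_size_le (i : Fin M) : max (max (I.lower i).size (I.upper i).size)
    (max (I.profit i).num.natAbs.size (I.profit i).den.size) ≤ I.inputBits ε :=
  ((Finset.le_sup (f := fun i => max (max (I.lower i).size (I.upper i).size)
    (max (I.profit i).num.natAbs.size (I.profit i).den.size)) (Finset.mem_univ i)).trans
    (le_max_right _ _)).trans (le_max_right _ _)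

theorem head_size_le : max (max M.size K.size) (max ε.num.natAbs.size ε.den.size) ≤
    I.inputBits ε := le_max_left _ _

theorem targetSum_lt : I.targetSum + 1 ≤ 2 ^ (K + I.inputBits ε) := by
  have h1 : I.targetSum ≤ K * 2 ^ I.inputBits ε := by
    refine (Finset.sum_le_sum fun k _ => (I.target_lt ε k).le).trans ?_
    simp
  have h2 : K + 1 ≤ 2 ^ K := Nat.lt_two_pow_self
  have h3 : 1 ≤ 2 ^ I.inputBits ε := Nat.one_le_two_pow
  rw [pow_add]
  nlinarith

theorem top_lt : prefixSum I.target 1 < 2 ^ I.inputBits ε := by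
  simp only [prefixSum, Finset.range_one, Finset.sum_singleton]
  split_ifs
  · exact I.target_lt ε _
  · exact Nat.two_pow_pos _

theorem fitsWord_ofVec {n W : ℕ} {v : Fin n → ℤ} (h : ∀ i, RAM.FitsWord W (v i)) (j : ℤ) :
    RAM.FitsWord W (RAM.ofVec v j) := by
  unfold RAM.ofVec
  split_ifs
  · exact h _
  · simp [RAM.FitsWord]

theorem bdd_input {W : ℕ} (hW : I.inputBits ε ≤ W) : RAM.Bdd W (I.input ε) := by
  have hfit : ∀ {v : ℤ}, v.natAbs.size ≤ I.inputBits ε → RAM.FitsWord W v := fun h =>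
    RAM.FitsWord.mono hW (lt_two_pow_of_size h)
  have hnat : ∀ {n : ℕ}, n < 2 ^ I.inputBits ε → RAM.FitsWord W (n : ℤ) := fun h =>
    RAM.FitsWord.mono hW h
  have h0 := I.head_size_le ε
  simp only [max_le_iff] at h0
  have hc := fun i => I.class_size_le ε i
  simp only [max_le_iff] at hc
  intro a j
  unfold input
  split
  · refine fitsWord_ofVec (fun i => hfit ?_) j
    fin_cases i
    exacts [h0.1.1, h0.1.2, h0.2.1, h0.2.2]
  · exact fitsWord_ofVec (fun k => hnat (I.target_lt ε k)) j
  · exact fitsWord_ofVec (fun i => hnat (lt_two_pow_of_size (hc i).1.1)) j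
  · exact fitsWord_ofVec (fun i => hnat (lt_two_pow_of_size (hc i).1.2)) j
  · exact fitsWord_ofVec (fun i => hfit (hc i).2.1) j
  · exact fitsWord_ofVec (fun i => hnat (lt_two_pow_of_size (hc i).2.2)) j
  · simp [RAM.FitsWord]

theorem pow_base_le (k : ℕ) :
    (prefixSum I.target 1 + 2) ^ k ≤ 2 ^ ((I.inputBits ε + 1) * k) := by
  rw [pow_mul]
  refine Nat.pow_le_pow_left ?_ k
  have := I.top_lt ε
  have h3 : 1 ≤ 2 ^ I.inputBits ε := Nat.one_le_two_pow
  rw [pow_succ]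
  omega

/-- The values that are stored fit into the words. -/
theorem room : Nat.succ M < 2 ^ I.wordLength ε ∧ I.targetSum < 2 ^ I.wordLength ε ∧
    (prefixSum I.target 1 + 2) ^ (M + 1) < 2 ^ I.wordLength ε ∧
    (I.targetSum + 1) * (prefixSum I.target 1 + 2) ^ (M + 1) < 2 ^ I.wordLength ε ∧
    radix M ε * radix M ε * radix M ε < 2 ^ I.wordLength ε ∧
    I.levels ε * M < 2 ^ I.wordLength ε ∧ radix M ε < 2 ^ I.wordLength ε ∧
    ∀ i, RAM.FitsWord (I.wordLength ε) ((I.profit i).num * I.capNat i) := by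
  have hlt : ∀ {e : ℕ}, e < I.wordLength ε → 2 ^ e < 2 ^ I.wordLength ε := fun h =>
    Nat.pow_lt_pow_right (by norm_num) h
  set β := I.inputBits ε with hβ
  have hW : I.wordLength ε =
      (β + 1) * (M + 1) + 2 * β + K + 3 * radix M ε + I.levels ε + M + 4 := by
    unfold wordLength; rw [← hβ]; ring
  have hprod : (I.targetSum + 1) * (prefixSum I.target 1 + 2) ^ (M + 1) < 2 ^ I.wordLength ε := by
    refine (Nat.mul_le_mul (I.targetSum_lt ε) (I.pow_base_le ε (M + 1))).trans_lt ?_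
    rw [← pow_add]
    exact hlt (by rw [hW, ← hβ]; omega)
  have hr : radix M ε < 2 ^ radix M ε := Nat.lt_two_pow_self
  refine ⟨?_, ?_, ?_, hprod, ?_, ?_, hr.trans_le (hlt (by omega)).le, fun i => ?_⟩
  · exact Nat.lt_two_pow_self.trans (hlt (by omega))
  · have : 0 < (prefixSum I.target 1 + 2) ^ (M + 1) := pow_pos (by omega) _
    nlinarith
  · nlinarith [Nat.zero_le I.targetSum,
      pow_pos (show 0 < prefixSum I.target 1 + 2 by omega) (M + 1)]
  · refine (Nat.mul_lt_mul'' (Nat.mul_lt_mul'' hr hr) hr).trans ?_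
    rw [← pow_add, ← pow_add]
    exact hlt (by omega)
  · have h1 : I.levels ε < 2 ^ I.levels ε := Nat.lt_two_pow_self
    have h2 : M < 2 ^ M := Nat.lt_two_pow_self
    refine (Nat.mul_lt_mul'' h1 h2).trans ?_
    rw [← pow_add]
    exact hlt (by omega)
  · have h1 : (I.profit i).num.natAbs < 2 ^ β := by
      have := I.class_size_le ε i
      simp only [max_le_iff] at this
      exact lt_two_pow_of_size this.2.1
    have h2 : I.capNat i < 2 ^ β := by
      unfold capNat
      split_ifs
      · exact (min_le_right _ _).trans_lt (I.top_lt ε)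
      · exact Nat.two_pow_pos _
    unfold RAM.FitsWord
    rw [Int.natAbs_mul, Int.natAbs_natCast]
    refine (Nat.mul_lt_mul'' h1 h2).trans ?_
    rw [← pow_add]
    exact hlt (by omega)

end bits

/-! #### Polynomial bounds -/

section poly

/-- The quantity in which the bounds are polynomial. -/
noncomputable def param : ℝ := M + K + Real.log I.targetSum + 1 / ε + 1

theorem le_param {ε : ℚ} (hε : 0 < ε) : (M : ℝ) ≤ I.param ε ∧ (K : ℝ) ≤ I.param ε ∧
    Real.log I.targetSum ≤ I.param ε ∧ 1 / (ε : ℝ) ≤ I.param ε ∧ 1 ≤ I.param ε := by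
  have h1 : 0 ≤ Real.log I.targetSum := Real.log_natCast_nonneg _
  have h2 : (0 : ℝ) < ε := by exact_mod_cast hε
  have h3 : 0 < 1 / (ε : ℝ) := by positivity
  have h4 : (0 : ℝ) ≤ M := Nat.cast_nonneg _
  have h5 : (0 : ℝ) ≤ K := Nat.cast_nonneg _
  unfold param
  refine ⟨?_, ?_, ?_, ?_, ?_⟩ <;> linarith

theorem radix_le {ε : ℚ} (hε : 0 < ε) : (radix M ε : ℝ) ≤ 5 * I.param ε ^ 3 := by
  obtain ⟨hM, -, -, he, h1⟩ := I.le_param hε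
  have hεR : (0 : ℝ) < ε := by exact_mod_cast hε
  have h0 : (0 : ℝ) ≤ M := Nat.cast_nonneg _
  have hfl : (⌊(2 * M * M / ε : ℚ)⌋₊ : ℝ) ≤ 2 * M * M * (1 / ε) := by
    have h : ((⌊(2 * M * M / ε : ℚ)⌋₊ : ℕ) : ℚ) ≤ 2 * M * M / ε := Nat.floor_le (by positivity)
    have h' : ((⌊(2 * M * M / ε : ℚ)⌋₊ : ℕ) : ℝ) ≤ 2 * M * M / ε := by exact_mod_cast h
    rwa [mul_one_div]
  rw [← floor_eq_radix hε]
  push_cast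
  set A := I.param ε
  have h2 : 2 * M * M * (1 / (ε : ℝ)) ≤ 2 * A * A * A := by gcongr
  have h3 : A ≤ A ^ 3 := le_self_pow₀ h1 (by norm_num)
  have h4 : 2 * A * A * A = 2 * A ^ 3 := by ring
  linarith

theorem levels_le {ε : ℚ} (hε : 0 < ε) : (I.levels ε : ℝ) ≤ 10 * I.param ε ^ 2 := by
  obtain ⟨hM, -, hl, he, h1⟩ := I.le_param hε
  have hεR : (0 : ℝ) < ε := by exact_mod_cast hε
  have hdiv : ((ε.num.toNat : ℕ) : ℝ) / (ε.den : ℕ) = ε := by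
    have := congrArg (Rat.cast (K := ℝ)) (eq_num_div_den hε)
    push_cast at this
    exact this.symm
  have h := (I.problem ε).numLev_le (toNat_num_pos hε) ε.den_pos
  rw [hdiv] at h
  have hlog : Real.log (I.problem ε).top ≤ Real.log I.targetSum := by
    have hle : prefixSum I.target 1 ≤ I.targetSum := I.prefixSum_le_targetSum 1
    change Real.log (prefixSum I.target 1 : ℕ) ≤ _
    rcases Nat.eq_zero_or_pos (prefixSum I.target 1) with h0 | h0
    · rw [h0, Nat.cast_zero, Real.log_zero]
      exact Real.log_natCast_nonneg _
    · exact Real.log_le_log (by exact_mod_cast h0) (by exact_mod_cast hle)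
  have hlog0 : 0 ≤ Real.log (I.problem ε).top := Real.log_natCast_nonneg _
  change (I.levels ε : ℝ) ≤ _ + _ + 2 + 2 * (M : ℝ) at h
  set A := I.param ε
  have h2 : 4 / (ε : ℝ) * Real.log (I.problem ε).top ≤ 4 * A * A := by
    rw [show 4 / (ε : ℝ) = 4 * (1 / ε) by ring]
    have := hlog.trans hl
    gcongr
  have h3 : 2 / (ε : ℝ) ≤ 2 * A := by
    rw [show 2 / (ε : ℝ) = 2 * (1 / ε) by ring]
    gcongr
  have h4 : A ≤ A ^ 2 := le_self_pow₀ h1 (by norm_num)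
  have h5 : 4 * A * A = 4 * A ^ 2 := by ring
  linarith

/-- Each of the polynomially many levels leads to `M` layers of `radix M ε ^ 3` entries. The
constant is `4000 * 11 * 5 ^ 4`. -/
theorem time_le {ε : ℚ} (hε : 0 < ε) {t : ℕ}
    (ht : t ≤ totalCost (I.levels ε) M (radix M ε * radix M ε * radix M ε)) :
    (t : ℝ) ≤ (27500000 : ℕ) * I.param ε ^ 14 := by
  have h1 : t ≤ 4000 * (I.levels ε + 1) * radix M ε ^ 4 :=
    ht.trans (totalCost_le (Nat.add_le_add_right (Nat.le_add_left _ _) 2))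
  have h2 : (t : ℝ) ≤ 4000 * (I.levels ε + 1) * (radix M ε : ℝ) ^ 4 := by exact_mod_cast h1
  have hA := (I.le_param hε).2.2.2.2
  have hA2 : 1 ≤ I.param ε ^ 2 := one_le_pow₀ hA
  have h3 : (I.levels ε : ℝ) + 1 ≤ 11 * I.param ε ^ 2 := by linarith [I.levels_le hε]
  calc (t : ℝ) ≤ 4000 * (I.levels ε + 1) * (radix M ε : ℝ) ^ 4 := h2
    _ ≤ 4000 * (11 * I.param ε ^ 2) * (5 * I.param ε ^ 3) ^ 4 := by
      gcongr
      exact I.radix_le hε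
    _ = (27500000 : ℕ) * I.param ε ^ 14 := by push_cast; ring

theorem wordLength_le {ε : ℚ} (hε : 0 < ε) :
    ((64 * I.wordLength ε : ℕ) : ℝ) ≤
      (27500000 : ℕ) * I.param ε ^ 14 * (I.inputBits ε + 1) := by
  obtain ⟨hM, hK, -, -, hA⟩ := I.le_param hε
  have hr := I.radix_le hε
  have hl := I.levels_le hε
  unfold wordLength
  push_cast
  set A := I.param ε
  have hβ : (1 : ℝ) ≤ I.inputBits ε + 1 := by
    have : (0 : ℝ) ≤ I.inputBits ε := Nat.cast_nonneg _
    linarith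
  set β : ℝ := I.inputBits ε + 1
  have h1 : A ≤ A ^ 14 := le_self_pow₀ hA (by norm_num)
  have h2 : A ^ 2 ≤ A ^ 14 := pow_le_pow_right₀ hA (by norm_num)
  have h3 : A ^ 3 ≤ A ^ 14 := pow_le_pow_right₀ hA (by norm_num)
  have h4 : K + 3 * (radix M ε : ℝ) + I.levels ε + M + 2 ≤ 29 * A ^ 14 := by linarith
  have h5 : (M : ℝ) + 3 ≤ 4 * A ^ 14 := by linarith
  have h6 : β * (M + 3) ≤ β * (4 * A ^ 14) := mul_le_mul_of_nonneg_left h5 (by linarith)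
  have h7 : 29 * A ^ 14 ≤ 29 * A ^ 14 * β := le_mul_of_one_le_right (by positivity) hβ
  have h8 : 0 ≤ A ^ 14 * β := by positivity
  linarith

end poly

end GAP

/-! ### The approximation scheme -/

namespace GAP

open Scheme RAM RAM.Expr

variable {M K : ℕ} (I : GAP M K) {ε : ℚ}

/-- The units that the program computes are those of the scaling. This includes the case in which
the bound `n / d` is `0`: both sides divide by zero and are `0`. -/
theorem ediv_eq_floor {a b m g : ℕ} {n d pn pd : ℤ} {p e : ℚ} (he : e = a / b) (hb : 0 < b)
    (hd : 0 < d) (hn : 0 ≤ n) (hpn : 0 ≤ pn) (hpd : 0 < pd) (hp : p = pn / pd) :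
    (pn * g * 2 * m * b * d) / (pd * a * n) = (⌊p * g * (2 * m / (e * (n / d : ℚ)))⌋₊ : ℕ) := by
  obtain ⟨n, rfl⟩ := Int.eq_ofNat_of_zero_le hn
  obtain ⟨d, rfl⟩ := Int.eq_ofNat_of_zero_le hd.le
  obtain ⟨pn, rfl⟩ := Int.eq_ofNat_of_zero_le hpn
  obtain ⟨pd, rfl⟩ := Int.eq_ofNat_of_zero_le hpd.le
  have h : p * g * (2 * m / (e * (((n : ℤ) : ℚ) / ((d : ℤ) : ℚ)))) =
      ((pn * g * 2 * m * b * d : ℕ) : ℚ) / ((pd * a * n : ℕ) : ℚ) := by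
    have hbQ : (b : ℚ) ≠ 0 := by exact_mod_cast hb.ne'
    have hdQ : (d : ℚ) ≠ 0 := by exact_mod_cast hd.ne'
    have hpdQ : (pd : ℚ) ≠ 0 := by exact_mod_cast hpd.ne'
    rw [hp, he]
    push_cast
    rcases eq_or_ne (n : ℚ) 0 with h0 | h0
    · simp [h0]
    rcases eq_or_ne (a : ℚ) 0 with h0' | h0'
    · simp [h0']
    field_simp
  rw [h, Nat.floor_div_eq_div]
  push_cast
  rfl

/-- The program computes a good allocation within the bounds on the resources. The dynamic program
is compared with the rounded version of an optimal allocation that has the exchange property. -/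
theorem exists_exec (hε : 0 < ε) : ∃ t σ, ∃ x : Fin M → ℕ,
    Exec (64 * I.wordLength ε) program (I.input ε) t σ ∧
    t ≤ totalCost (I.levels ε) M (radix M ε * radix M ε * radix M ε) ∧
    IsOutput σ x ∧ I.Feasible x ∧ (1 - ε) * I.opt ≤ I.revenue x := by
  obtain ⟨hr1, hr2, hr3, hr4, hr5, hr6, hr7, hr8⟩ := I.room ε
  obtain ⟨hin0, hin2, hin3⟩ := I.input_zero (ε := ε)
  set W := I.wordLength ε with hW
  set D := I.problem ε with hD
  set p := I.sorted ε I.profit with hp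
  set a := ε.num.toNat with ha
  obtain ⟨z, hz, hzmax, hzex⟩ := Problem.exists_optimal_exch (D := D) (p := p)
    fun i j hij hj => I.sorted_profit_antitone ε hij hj
  have hrun : Runs W program (totalCost (I.levels ε) M (radix M ε * radix M ε * radix M ε))
      (I.input ε) fun τ => ∃ x : Fin M → ℕ,
        IsOutput τ x ∧ I.Feasible x ∧ (1 - ε) * I.opt ≤ I.revenue x := by
    unfold program totalCost
    have hMW : M < 2 ^ W := by omega
    -- sorting
    refine Runs.seq ((runs_sortP hin0 hMW fun i j hi hj h => ?_).frame.mono le_rfl ?_)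
    · exact Fin.mk.inj_iff.mp (I.rank_injective ε (i := ⟨i, hi⟩) (j := ⟨j, hj⟩) h)
    rintro τ₁ ⟨hf₁, hord₁, hcap₁⟩
    -- prefix sums and powers
    have hN₁ : ∀ i : ℕ, τ₁ 1 i = ((if h : i < K then I.target ⟨i, h⟩ else 0 : ℕ) : ℤ) := by
      intro i
      rw [hf₁ 1 (by decide), input_one]
    have htop : (if h : 0 < K then I.target ⟨0, h⟩ else 0) = prefixSum I.target 1 := by
      simp [prefixSum]
    refine Runs.seq ((runs_prefixP (N := fun i => if h : i < K then I.target ⟨i, h⟩ else 0)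
      (M := M) ?_ hN₁ ?_ hr1 ?_ ?_).frame.mono le_rfl ?_)
    · rw [hf₁ 0 (by decide), hin0]
    · rw [hf₁ aPrefix (by decide)]; rfl
    · exact (I.prefixSum_le_targetSum (M + 1)).trans_lt hr2
    · rw [htop]; exact hr3
    rintro τ₂ ⟨hf₂, hpre₂⟩
    simp only [htop] at hpre₂
    -- the bound
    have hf₂' : ∀ c ∈ [0, 1, 2, 4, 5], τ₂ c = I.input ε c := by
      intro c hc
      rw [hf₂ c (by revert c hc; decide), hf₁ c (by revert c hc; decide)]
    have h3₂ : ∀ i : Fin M, τ₂ 3 (i : ℕ) = I.capNat i := by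
      intro i
      rw [hf₂ 3 (by decide), hcap₁ i i.2]
      exact I.cap_input ε (fun _ _ => rfl) i
    refine Runs.seq ((runs_boundP (M := M) ?_ hMW ?_ ?_ ?_ ?_).frame.mono le_rfl ?_)
    · rw [hf₂' 0 (by decide), hin0]
    · omega
    · intro i hi
      rw [hf₂' 5 (by decide), I.input_five ε ⟨i, hi⟩]
      exact_mod_cast (I.profit ⟨i, hi⟩).pos
    · intro i hi
      rw [hf₂' 4 (by decide), I.input_four ε ⟨i, hi⟩, h3₂ ⟨i, hi⟩]
      exact hr8 ⟨i, hi⟩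
    · rw [hf₂ vLbNum (by decide), hf₁ vLbNum (by decide)]; rfl
    rintro τ₃ ⟨hf₃, hbound⟩
    have hf₃' : ∀ c ∈ [0, 1, 2, 4, 5], τ₃ c = I.input ε c := by
      intro c hc
      rw [hf₃ c (by revert c hc; decide), hf₂' c hc]
    have h3₃ : ∀ i : Fin M, τ₃ 3 (i : ℕ) = I.capNat i := by
      intro i; rw [hf₃ 3 (by decide), h3₂]
    have hprof := I.profits_of_singleBound ε hbound
      (fun i => by rw [hf₃' 2 (by decide), input_two]) h3₃
      (fun i => by rw [hf₃' 4 (by decide), input_four])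
      (fun i => by rw [hf₃' 5 (by decide), input_five])
    set V := hprof.scaling hε with hV
    have hVZ : V.Z = radix M ε := floor_eq_radix hε
    -- the number of units
    have hzE : (2 * eM * eM * eDen / eNum + eM + 2).eval τ₃ = radix M ε := by
      simp only [eval_add, eval_mul, eval_div, eval_cell, eval_zero, eval_two, eval_three,
        hf₃' 0 (by decide), hin0, hin2, hin3]
      rw [← natCast_toNat_num hε]
      unfold radix
      push_cast
      rfl
    refine Runs.seq (Runs.mono (Runs.assign (fun _ => ?_) fun τ₄ hf₄ hτ₄ => ?_)
      (show Program.bd (.assign vZ (2 * eM * eM * eDen / eNum + eM + 2)) ≤ 30 by decide)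
      fun _ h => h)
    · rw [hzE]; exact fitsWord_natCast hr7
    rw [hzE] at hτ₄
    have hf₄' : ∀ c ∈ [0, 1, 2, 4, 5], τ₄ c = I.input ε c := by
      intro c hc
      rw [hf₄ c (by revert c hc; decide), hf₃' c hc]
    have hord₄ : ∀ i : Fin M, τ₄ aOrd (I.pos ε i : ℕ) = (i : ℕ) := by
      intro i
      rw [hf₄ aOrd (by decide), hf₃ aOrd (by decide), hf₂ aOrd (by decide), pos_val]
      exact hord₁ i i.2
    have hpre₄ : ∀ r : ℕ, r ≤ M + 1 → τ₄ aPrefix r = prefixSum I.target r ∧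
        τ₄ aPow r = ((prefixSum I.target 1 + 2) ^ r : ℕ) := by
      intro r hr
      rw [hf₄ aPrefix (by decide), hf₃ aPrefix (by decide), hf₄ aPow (by decide),
        hf₃ aPow (by decide)]
      exact hpre₂ r hr
    have hctx : Ctx V a ε.den τ₄ := by
      constructor
      · rw [hf₄' 0 (by decide), hin0]; rfl
      · rw [hf₄' 0 (by decide), hin2, natCast_toNat_num hε]
      · rw [hf₄' 0 (by decide), hin3]
      · rw [hf₄' 1 (by decide), input_top]; rfl
      · intro j hj
        obtain ⟨i, rfl⟩ := I.exists_pos_eq ε hj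
        rw [hord₄, hf₄' 2 (by decide), input_two]
        simp only [problem, sorted_pos]
      · intro j hj
        obtain ⟨i, rfl⟩ := I.exists_pos_eq ε hj
        rw [hord₄, hf₄ 3 (by decide), h3₃]
        simp only [problem, sorted_pos]
      · exact fun r hr => (hpre₄ r (Nat.le_succ_of_le hr)).1
      · exact fun k hk => (hpre₄ k hk).2
      · rw [hτ₄, hVZ]
      · intro j g hj hg hgU
        obtain ⟨i, rfl⟩ := I.exists_pos_eq ε hj
        have hpos : 0 < I.profit i := by
          have := hprof.pos _ (I.pos ε i).2 (hg.trans_le hgU)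
          rwa [sorted_pos] at this
        rw [hord₄, hf₄' 4 (by decide), hf₄' 5 (by decide), input_four, input_five,
          hf₄ vLbNum (by decide), hf₄ vLbDen (by decide)]
        refine ediv_eq_floor (eq_num_div_den hε) ε.den_pos hbound.den_pos hbound.num_nonneg
          (Rat.num_pos.mpr hpos).le (by exact_mod_cast (I.profit i).pos) ?_
        rw [sorted_pos]
        exact (Rat.num_div_den _).symm
    have hroom : Room V a ε.den W := by
      have hF : D.F D.m ≤ I.targetSum := I.prefixSum_le_targetSum M
      refine ⟨?_, ?_, ?_, hr6, ?_⟩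
      · rw [Problem.Scaling.size, hVZ]; exact hr5
      · exact (Nat.mul_le_mul_right _ (Nat.add_le_add_right hF 1)).trans_lt hr4
      · exact (I.prefixSum_le_targetSum 1).trans_lt hr2
      · rw [hVZ]; exact hr7
    -- the dynamic program
    have hsize : V.size = radix M ε * radix M ε * radix M ε := by
      rw [Problem.Scaling.size, hVZ]
    rw [← hsize]
    have hy := hz.roundDown (a := a) (b := ε.den)
    refine Runs.seq ((runs_dpP hroom hctx hy (hzex.roundDown hz)
      (fun i => Problem.exists_lev_eq_roundDown _) ?_ ?_).frame.mono le_rfl ?_)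
    · rw [hf₄ vT (by decide), hf₃ vT (by decide), hf₂ vT (by decide), hf₁ vT (by decide)]; rfl
    · intro k
      rw [hf₄ aTable (by decide), hf₃ aTable (by decide), hf₂ aTable (by decide),
        hf₁ aTable (by decide)]
      rfl
    rintro τ₅ ⟨hf₅, hctx₅, t, ht₅, hinv⟩
    have hord₅ : ∀ i : Fin M, τ₅ aOrd (I.pos ε i : ℕ) = (i : ℕ) := by
      intro i; rw [hf₅ aOrd (by decide), hord₄]
    refine (runs_outputP hroom hctx₅ hy ht₅ hinv ?_).mono le_rfl ?_
    · intro i j hi hj h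
      obtain ⟨i, rfl⟩ := I.exists_pos_eq ε hi
      obtain ⟨j, rfl⟩ := I.exists_pos_eq ε hj
      rw [hord₅, hord₅] at h
      rw [Fin.ext (by exact_mod_cast h : (i : ℕ) = j)]
    · rintro τ₆ ⟨x, hx, hunits, hout⟩
      refine ⟨fun i => x (I.pos ε i), fun i => ?_, I.feasible_of_isAlloc ε hx, ?_⟩
      · rw [← hout _ (I.pos ε i).2, hord₅]
      · rw [← rev_problem]
        have hle := hprof.rev_le ε.den_pos (eq_num_div_den hε) hε hz hzmax hx hunits
        have hx0 := hprof.rev_nonneg hx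
        have hopt := I.opt_le ε hzmax
        rcases le_or_gt ε 1 with h1 | h1
        · exact (mul_le_mul_of_nonneg_left hopt (by linarith)).trans hle
        · have hopt0 : 0 ≤ I.opt := I.opt_isGreatest.2 ⟨0, I.feasible_zero, by simp [revenue]⟩
          exact (mul_nonpos_of_nonpos_of_nonneg (by linarith) hopt0).trans hx0
  obtain ⟨t, τ, h1, h2, -, x, h3, h4, h5⟩ := hrun (by rw [hW, wordLength]; omega) small_program
    (I.bdd_input ε (by rw [hW, wordLength]; nlinarith [Nat.zero_le (I.inputBits ε * M)]))
  exact ⟨t, τ, x, h1, h2, h3, h4, h5⟩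

end GAP

theorem mainTheorem2 :
    ∃ (P : RAM.Program) (C d : ℕ), ∀ (M K : ℕ) (I : GAP M K) (ε : ℚ), 0 < ε →
      ∃ (w t : ℕ) (σ : RAM.Mem) (x : Fin M → ℕ),
        RAM.Exec w P (I.input ε) t σ ∧
        GAP.IsOutput σ x ∧
        I.Feasible x ∧
        (1 - ε) * I.opt ≤ I.revenue x ∧
        (t : ℝ) ≤ C * (M + K + Real.log I.targetSum + 1 / ε + 1) ^ d ∧
        (w : ℝ) ≤ C * (M + K + Real.log I.targetSum + 1 / ε + 1) ^ d * (I.inputBits ε + 1) := by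
  refine ⟨Scheme.program, 27500000, 14, fun M K I ε hε => ?_⟩
  obtain ⟨t, σ, x, h1, h2, h3, h4, h5⟩ := I.exists_exec hε
  exact ⟨_, t, σ, x, h1, h3, h4, h5, I.time_le hε h2, I.wordLength_le hε⟩
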